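/- Let $(W,S)$ be a Coxeter system of type $A_2$ and let $V$ be a reflection faithful representation of $W$ over $\mathbb{R}$, i.e. a finite-dimensional faithful representation such that for $w\in W$ the fixed space $V^w$ has codimension $1$ if and only if $w$ is a reflection. Let $T=\{t_1,t_2,t_3\}$ be the set of reflections of $W$ (in any order), let $R=S(V^*)$ be the ring of polynomial functions on $V$, graded with $\deg V^*=2$, let $(n)$ denote the grading shift, $M(n)_i=M_{n+i}$, and for $t\in T$ put $B_t=R\otimes_{R^t}R(1)$, a $\mathbb{Z}$-graded $R$-bimodule. (Bimodules are over $\mathbb{R}$, and morphisms are bimodule homomorphisms of degree $0$.) Let $\mathcal{C}$ be the Karoubi envelope of the additive category generated by the shifted tensor products $B_{s_1}\otimes_R\cdots\otimes_R B_{s_k}(n)$ with $k\ge 0$, $s_1,\dots,s_k\in T$, $n\in\mathbb{Z}$, that is, the full subcategory of graded $R$-bimodules whose objects are the direct summands of finite direct sums of such bimodules. Let $A(W)=\langle\mathcal{C}\rangle$ be its split Grothendieck ring: the free abelian group on the isomorphism classes of objects modulo the relations $\langle M\oplus N\rangle=\langle M\rangle+\langle N\rangle$, with the product induced by $\otimes_R$.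 It is a $\mathbb{Z}[v^{\pm1}]$-algebra with $v$ acting as $\langle R(1)\rangle$, i.e. $v\langle M\rangle=\langle M(1)\rangle$. Then $A(W)$ is presented, as a $\mathbb{Z}[v^{\pm 1}]$-algebra, by the generators $C_1,C_2,C_3$ with $C_i=\langle B_{t_i}\rangle$ and the relations 1. $C_i^2=(v+v^{-1})C_i$ for all $i$; 2. $C_iC_jC_i+C_j=C_i+C_jC_iC_j$ for all $i\neq j$; 3. $C_iC_jC_i=C_iC_kC_i$ whenever $\{i,j,k\}=\{1,2,3\}$; 4. $C_iC_jC_kC_i=C_iC_kC_jC_i$ whenever $\{i,j,k\}=\{1,2,3\}$. That is, there is an isomorphism of $\mathbb{Z}[v^{\pm1}]$-algebras from the algebra so presented onto $A(W)$ which maps each $C_i$ to $\langle B_{t_i}\rangle$. In particular, $A(W)$ is a quotient of the Hecke algebra $\mathcal{H}$ of affine type $\widetilde{A}_2$: let $\mathcal{H}$ be the $\mathbb{Z}[v^{\pm1}]$-algebra with generators $H_1,H_2,H_3$ and relations $H_i^2=1+(v^{-1}-v)H_i$ and $H_iH_jH_i=H_jH_iH_j$ for $i\ne j$, and let $C'_i=H_i+v$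 be its Kazhdan–Lusztig generators; then there is a surjective homomorphism of $\mathbb{Z}[v^{\pm1}]$-algebras $\mathcal{H}\to A(W)$ with $C'_i\mapsto\langle B_{t_i}\rangle$. -/

import Mathlib

open CategoryTheory TensorProduct

universe u

noncomputable section

section GradedBimodule

/-! ### Graded bimodules over a commutative graded `ℝ`-algebra -/

/-- A criterion for an internal direct sum decomposition, through the map which sends a vector
to the finite family of its homogeneous components. -/
theorem isInternal_of_components {M : Type u} [AddCommGroup M] [Module ℝ M]
    (gr : ℤ → Submodule ℝ M) (htop : ⨆ i, gr i = ⊤) (D : M →ₗ[ℝ] (ℤ →₀ M))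
    (hD : ∀ i, ∀ m ∈ gr i, D m = Finsupp.single i m) : DirectSum.IsInternal gr := by
  classical
  rw [DirectSum.isInternal_submodule_iff_iSupIndep_and_iSup_eq_top]
  refine ⟨?_, htop⟩
  rw [iSupIndep_def]
  intro i
  rw [Submodule.disjoint_def]
  intro x hx hx'
  have h1 : ∀ y ∈ ⨆ j, ⨆ (_ : j ≠ i), gr j, D y i = 0 := by
    intro y hy
    have hle : (⨆ j, ⨆ (_ : j ≠ i), gr j) ≤ LinearMap.ker (Finsupp.lapply i ∘ₗ D) := by
      refine iSup_le fun j => iSup_le fun hj => ?_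
      intro z hz
      simp [LinearMap.mem_ker, hD j z hz, hj]
    simpa using hle hy
  have h2 := h1 x hx'
  rw [hD i x hx] at h2
  simpa using h2

/-- The components map of an internal grading. -/
theorem exists_components {M : Type u} [AddCommGroup M] [Module ℝ M]
    (gr : ℤ → Submodule ℝ M) (h : DirectSum.IsInternal gr) :
    ∃ D : M →ₗ[ℝ] (ℤ →₀ M), ∀ i, ∀ m ∈ gr i, D m = Finsupp.single i m := by
  classical
  let e := LinearEquiv.ofBijective (DirectSum.coeLinearMap gr) h
  refine ⟨(DirectSum.toModule ℝ ℤ (ℤ →₀ M)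
    fun i => Finsupp.lsingle i ∘ₗ (gr i).subtype) ∘ₗ e.symm.toLinearMap, ?_⟩
  intro i m hm
  have : e.symm m = DirectSum.lof ℝ ℤ (fun i => gr i) i ⟨m, hm⟩ := by
    rw [LinearEquiv.symm_apply_eq]
    exact (DirectSum.coeLinearMap_lof gr i ⟨m, hm⟩).symm
  simp [this]

theorem isInternal_induction {M : Type u} [AddCommGroup M] [Module ℝ M]
    {gr : ℤ → Submodule ℝ M} (h : DirectSum.IsInternal gr) {p : M → Prop}
    (h0 : p 0) (hadd : ∀ x y, p x → p y → p (x + y)) (hom : ∀ i, ∀ m ∈ gr i, p m) (m : M) :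
    p m := by
  have hm : m ∈ ⨆ i, gr i := by rw [h.submodule_iSup_eq_top]; trivial
  exact Submodule.iSup_induction gr (motive := p) hm hom h0 hadd

variable {R : Type u} [CommRing R] [Algebra ℝ R]

/-- A `ℤ`-graded `R`-bimodule (with `ℝ` acting in the same way from both sides), where
`R = ⨁ 𝒜 i` is a commutative graded `ℝ`-algebra. The left action of `a` is `lact a`, the right
action of `a` is `ract a`; since `R` is commutative, a right action of `R` is the same thing as
an algebra homomorphism from `R` to the endomorphisms. -/
structure GradedBimodule (𝒜 : ℤ → Submodule ℝ R) : Type (u + 1) where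
  carrier : Type u
  [addCommGroup : AddCommGroup carrier]
  [module : Module ℝ carrier]
  lact : R →ₐ[ℝ] Module.End ℝ carrier
  ract : R →ₐ[ℝ] Module.End ℝ carrier
  act_comm : ∀ a b m, lact a (ract b m) = ract b (lact a m)
  gr : ℤ → Submodule ℝ carrier
  isInternal : DirectSum.IsInternal gr
  lact_mem : ∀ {i j : ℤ} {a : R} {m : carrier}, a ∈ 𝒜 i → m ∈ gr j → lact a m ∈ gr (i + j)
  ract_mem : ∀ {i j : ℤ} {a : R} {m : carrier}, a ∈ 𝒜 i → m ∈ gr j → ract a m ∈ gr (i + j)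

namespace GradedBimodule

attribute [instance] GradedBimodule.addCommGroup GradedBimodule.module

variable {𝒜 : ℤ → Submodule ℝ R}

/-- Morphisms of graded bimodules: bimodule homomorphisms of degree zero. -/
@[ext]
structure Hom (M N : GradedBimodule 𝒜) : Type u where
  toLin : M.carrier →ₗ[ℝ] N.carrier
  map_lact : ∀ a m, toLin (M.lact a m) = N.lact a (toLin m)
  map_ract : ∀ a m, toLin (M.ract a m) = N.ract a (toLin m)
  map_gr : ∀ {i m}, m ∈ M.gr i → toLin m ∈ N.gr i

instance : Category (GradedBimodule 𝒜) where
  Hom M N := Hom M N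
  id M := ⟨LinearMap.id, fun _ _ => rfl, fun _ _ => rfl, fun h => h⟩
  comp f g := ⟨g.toLin ∘ₗ f.toLin, fun a m => by simp [f.map_lact, g.map_lact],
    fun a m => by simp [f.map_ract, g.map_ract], fun h => g.map_gr (f.map_gr h)⟩

@[ext]
theorem hom_ext {M N : GradedBimodule 𝒜} {f g : M ⟶ N}
    (h : ∀ m, Hom.toLin f m = Hom.toLin g m) : f = g :=
  Hom.ext (LinearMap.ext h)

@[simp]
theorem id_toLin (M : GradedBimodule 𝒜) : Hom.toLin (𝟙 M) = LinearMap.id := rfl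

@[simp]
theorem comp_toLin {M N P : GradedBimodule 𝒜} (f : M ⟶ N) (g : N ⟶ P) :
    Hom.toLin (f ≫ g) = Hom.toLin g ∘ₗ Hom.toLin f := rfl

/-- The grading shift `M(n)`, with `M(n)_i = M_{n+i}`. -/
abbrev shift (M : GradedBimodule 𝒜) (n : ℤ) : GradedBimodule 𝒜 where
  carrier := M.carrier
  lact := M.lact
  ract := M.ract
  act_comm := M.act_comm
  gr i := M.gr (n + i)
  isInternal := by
    obtain ⟨D, hD⟩ := exists_components M.gr M.isInternal
    refine isInternal_of_components _ ?_
      (Finsupp.lmapDomain M.carrier ℝ (fun i => i - n) ∘ₗ D) ?_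
    · rw [← M.isInternal.submodule_iSup_eq_top]
      exact (Equiv.addLeft n).iSup_comp (g := M.gr)
    · intro i m hm
      simp [hD _ m hm, Finsupp.mapDomain_single]
  lact_mem {i j a m} ha hm := by
    have := M.lact_mem ha hm
    rwa [← add_assoc, add_comm i n, add_assoc] at this
  ract_mem {i j a m} ha hm := by
    have := M.ract_mem ha hm
    rwa [← add_assoc, add_comm i n, add_assoc] at this

/-- The direct sum of two graded bimodules. -/
abbrev sum (M N : GradedBimodule 𝒜) : GradedBimodule 𝒜 where
  carrier := M.carrier × N.carrier
  lact :=
    { toFun := fun a => (M.lact a).prodMap (N.lact a)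
      map_one' := by ext <;> simp
      map_mul' := fun a b => by ext <;> simp
      map_zero' := by ext <;> simp
      map_add' := fun a b => by ext <;> simp
      commutes' := fun r => by ext <;> simp }
  ract :=
    { toFun := fun a => (M.ract a).prodMap (N.ract a)
      map_one' := by ext <;> simp
      map_mul' := fun a b => by ext <;> simp
      map_zero' := by ext <;> simp
      map_add' := fun a b => by ext <;> simp
      commutes' := fun r => by ext <;> simp }
  act_comm a b m := by
    ext
    · exact M.act_comm a b m.1
    · exact N.act_comm a b m.2
  gr i := (M.gr i).prod (N.gr i)
  isInternal := by
    obtain ⟨D, hD⟩ := exists_components M.gr M.isInternal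
    obtain ⟨E, hE⟩ := exists_components N.gr N.isInternal
    refine isInternal_of_components _ ?_
      (Finsupp.mapRange.linearMap (LinearMap.inl ℝ _ _) ∘ₗ D ∘ₗ LinearMap.fst ℝ _ _ +
        Finsupp.mapRange.linearMap (LinearMap.inr ℝ _ _) ∘ₗ E ∘ₗ LinearMap.snd ℝ _ _) ?_
    · rw [eq_top_iff]
      rintro ⟨x, y⟩ -
      have h1 : ∀ x : M.carrier, ((x, 0) : M.carrier × N.carrier) ∈
          ⨆ i, (M.gr i).prod (N.gr i) := by
        intro x
        induction x using isInternal_induction M.isInternal with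
        | h0 => exact Submodule.zero_mem _
        | hadd x y hx hy => simpa using Submodule.add_mem _ hx hy
        | hom i m hm => exact Submodule.mem_iSup_of_mem i ⟨hm, Submodule.zero_mem _⟩
      have h2 : ∀ y : N.carrier, ((0, y) : M.carrier × N.carrier) ∈
          ⨆ i, (M.gr i).prod (N.gr i) := by
        intro y
        induction y using isInternal_induction N.isInternal with
        | h0 => exact Submodule.zero_mem _
        | hadd x y hx hy => simpa using Submodule.add_mem _ hx hy
        | hom i m hm => exact Submodule.mem_iSup_of_mem i ⟨Submodule.zero_mem _, hm⟩
      simpa using Submodule.add_mem _ (h1 x) (h2 y)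
    · rintro i ⟨x, y⟩ ⟨hx, hy⟩
      simp only [LinearMap.add_apply, LinearMap.comp_apply, LinearMap.fst_apply,
        LinearMap.snd_apply]
      rw [hD i x hx, hE i y hy]
      simp [← Finsupp.single_add]
  lact_mem ha hm := ⟨M.lact_mem ha hm.1, N.lact_mem ha hm.2⟩
  ract_mem ha hm := ⟨M.ract_mem ha hm.1, N.ract_mem ha hm.2⟩

/-- The zero graded bimodule. -/
abbrev zero (𝒜 : ℤ → Submodule ℝ R) : GradedBimodule 𝒜 where
  carrier := PUnit.{u + 1}
  lact := AlgHom.ofLinearMap 0 (Subsingleton.elim _ _) (fun _ _ => Subsingleton.elim _ _)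
  ract := AlgHom.ofLinearMap 0 (Subsingleton.elim _ _) (fun _ _ => Subsingleton.elim _ _)
  act_comm _ _ _ := rfl
  gr _ := ⊥
  isInternal := isInternal_of_components _ (Subsingleton.elim _ _) 0
    (fun _ _ _ => Subsingleton.elim _ _)
  lact_mem _ _ := Subsingleton.elim _ _
  ract_mem _ _ := Subsingleton.elim _ _

/-- The regular bimodule `R`. -/
abbrev unit (𝒜 : ℤ → Submodule ℝ R) [GradedAlgebra 𝒜] : GradedBimodule 𝒜 where
  carrier := R
  lact := Algebra.lmul ℝ R
  ract := Algebra.lmul ℝ R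
  act_comm a b m := mul_left_comm a b m
  gr := 𝒜
  isInternal := DirectSum.Decomposition.isInternal 𝒜
  lact_mem ha hm := SetLike.mul_mem_graded ha hm
  ract_mem ha hm := SetLike.mul_mem_graded ha hm

/-! ### Tensor products of graded bimodules -/

/-- A graded subalgebra of `R`: it contains the homogeneous components of its elements. -/
def IsGradedSubalgebra (𝒜 : ℤ → Submodule ℝ R) [GradedAlgebra 𝒜] (A : Subalgebra ℝ R) : Prop :=
  ∀ a ∈ A, ∀ i, (DirectSum.decompose 𝒜 a i : R) ∈ A

section Tensor

variable (A : Subalgebra ℝ R) (M N : GradedBimodule 𝒜)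

/-- The relations `m a ⊗ n = m ⊗ a n`, `a ∈ A`, which define `M ⊗_A N` as a quotient of
`M ⊗_ℝ N`. -/
def tensorRel : Submodule ℝ (M.carrier ⊗[ℝ] N.carrier) :=
  Submodule.span ℝ {x | ∃ a ∈ A, ∃ m n, x = M.ract a m ⊗ₜ[ℝ] n - m ⊗ₜ[ℝ] N.lact a n}

/-- The underlying vector space of `M ⊗_A N`. -/
abbrev TensorCarrier : Type u := (M.carrier ⊗[ℝ] N.carrier) ⧸ tensorRel A M N

variable {M N}

/-- The pure tensor `m ⊗ n` in `M ⊗_A N`. -/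
def tmul (m : M.carrier) (n : N.carrier) : TensorCarrier A M N :=
  (tensorRel A M N).mkQ (m ⊗ₜ n)

theorem tmul_add_left (m m' : M.carrier) (n : N.carrier) :
    tmul A (m + m') n = tmul A m n + tmul A m' n := by
  simp only [tmul, TensorProduct.add_tmul, map_add]

theorem tmul_add_right (m : M.carrier) (n n' : N.carrier) :
    tmul A m (n + n') = tmul A m n + tmul A m n' := by
  simp only [tmul, TensorProduct.tmul_add, map_add]

theorem tmul_smul_left (r : ℝ) (m : M.carrier) (n : N.carrier) :
    tmul A (r • m) n = r • tmul A m n := by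
  simp only [tmul, ← TensorProduct.smul_tmul', map_smul]

theorem tmul_smul_right (r : ℝ) (m : M.carrier) (n : N.carrier) :
    tmul A m (r • n) = r • tmul A m n := by
  simp only [tmul, TensorProduct.tmul_smul, map_smul]

theorem tmul_zero_left (n : N.carrier) : tmul A (0 : M.carrier) n = 0 := by
  simp only [tmul, TensorProduct.zero_tmul, map_zero]

theorem tmul_zero_right (m : M.carrier) : tmul A m (0 : N.carrier) = 0 := by
  simp only [tmul, TensorProduct.tmul_zero, map_zero]

variable {A} in
theorem tmul_balanced {a : R} (ha : a ∈ A) (m : M.carrier) (n : N.carrier) :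
    tmul A (M.ract a m) n = tmul A m (N.lact a n) := by
  rw [← sub_eq_zero, tmul, tmul, ← map_sub]
  exact (Submodule.Quotient.mk_eq_zero _).2 (Submodule.subset_span ⟨a, ha, m, n, rfl⟩)

variable {A} in
theorem tensor_induction {p : TensorCarrier A M N → Prop} (h0 : p 0)
    (hadd : ∀ x y, p x → p y → p (x + y)) (ht : ∀ m n, p (tmul A m n)) (x) : p x := by
  obtain ⟨x, rfl⟩ := (tensorRel A M N).mkQ_surjective x
  induction x using TensorProduct.induction_on with
  | zero => simpa using h0
  | tmul m n => exact ht m n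
  | add x y hx hy => rw [map_add]; exact hadd _ _ hx hy

variable {A} in
/-- Linear maps out of `M ⊗_A N` are determined by their values on pure tensors. -/
theorem tensor_hom_ext {P : Type u} [AddCommGroup P] [Module ℝ P]
    {f g : TensorCarrier A M N →ₗ[ℝ] P} (h : ∀ m n, f (tmul A m n) = g (tmul A m n)) : f = g := by
  refine LinearMap.ext fun x => ?_
  induction x using tensor_induction with
  | h0 => simp
  | hadd x y hx hy => simp [hx, hy]
  | ht m n => exact h m n

/-- Linear maps out of `M ⊗_A N` from balanced bilinear maps. -/
def tensorLift {P : Type u} [AddCommGroup P] [Module ℝ P]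
    (f : M.carrier →ₗ[ℝ] N.carrier →ₗ[ℝ] P)
    (hf : ∀ a ∈ A, ∀ m n, f (M.ract a m) n = f m (N.lact a n)) :
    TensorCarrier A M N →ₗ[ℝ] P :=
  (tensorRel A M N).liftQ (TensorProduct.lift f) (Submodule.span_le.2 (by
    rintro _ ⟨a, ha, m, n, rfl⟩
    simp [hf a ha m n]))

@[simp]
theorem tensorLift_tmul {P : Type u} [AddCommGroup P] [Module ℝ P]
    (f : M.carrier →ₗ[ℝ] N.carrier →ₗ[ℝ] P)
    (hf : ∀ a ∈ A, ∀ m n, f (M.ract a m) n = f m (N.lact a n)) (m : M.carrier) (n : N.carrier) :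
    tensorLift A f hf (tmul A m n) = f m n := by
  exact ((tensorRel A M N).liftQ_apply _ _).trans (TensorProduct.lift.tmul _ _)

/-- `tmul` as a bilinear map. -/
def tmulBilin (M N : GradedBimodule 𝒜) :
    M.carrier →ₗ[ℝ] N.carrier →ₗ[ℝ] TensorCarrier A M N :=
  LinearMap.mk₂ ℝ (tmul A) (tmul_add_left A) (tmul_smul_left A) (tmul_add_right A)
    (tmul_smul_right A)

@[simp]
theorem tmulBilin_apply (m : M.carrier) (n : N.carrier) : tmulBilin A M N m n = tmul A m n := rfl

/-- `f ⊗ g` for linear maps `f` and `g` which respect the inner actions. -/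
def tensorMap {M' N' : GradedBimodule 𝒜} (f : M.carrier →ₗ[ℝ] M'.carrier)
    (g : N.carrier →ₗ[ℝ] N'.carrier) (hf : ∀ a m, f (M.ract a m) = M'.ract a (f m))
    (hg : ∀ a n, g (N.lact a n) = N'.lact a (g n)) :
    TensorCarrier A M N →ₗ[ℝ] TensorCarrier A M' N' :=
  tensorLift A ((tmulBilin A M' N').compl₁₂ f g) (by
    intro a ha m n
    simp [hf, hg, tmul_balanced ha])

@[simp]
theorem tensorMap_tmul {M' N' : GradedBimodule 𝒜} (f : M.carrier →ₗ[ℝ] M'.carrier)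
    (g : N.carrier →ₗ[ℝ] N'.carrier) (hf : ∀ a m, f (M.ract a m) = M'.ract a (f m))
    (hg : ∀ a n, g (N.lact a n) = N'.lact a (g n)) (m : M.carrier) (n : N.carrier) :
    tensorMap A f g hf hg (tmul A m n) = tmul A (f m) (g n) := by
  simp [tensorMap]

theorem ract_comm (M : GradedBimodule 𝒜) (a b : R) (m : M.carrier) :
    M.ract a (M.ract b m) = M.ract b (M.ract a m) := by
  rw [← Module.End.mul_apply, ← Module.End.mul_apply, ← map_mul, ← map_mul, mul_comm]

theorem lact_comm (M : GradedBimodule 𝒜) (a b : R) (m : M.carrier) :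
    M.lact a (M.lact b m) = M.lact b (M.lact a m) := by
  rw [← Module.End.mul_apply, ← Module.End.mul_apply, ← map_mul, ← map_mul, mul_comm]

variable (M N)

/-- The left action of `R` on `M ⊗_A N`. -/
def tensorLact : R →ₐ[ℝ] Module.End ℝ (TensorCarrier A M N) where
  toFun a := tensorMap A (M.lact a) LinearMap.id (fun b m => M.act_comm a b m) (fun _ _ => rfl)
  map_one' := tensor_hom_ext (by simp)
  map_mul' a b := tensor_hom_ext (by simp)
  map_zero' := tensor_hom_ext (by simp [tmul_zero_left])
  map_add' a b := tensor_hom_ext (by simp [tmul_add_left])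
  commutes' r := tensor_hom_ext (by simp [tmul_smul_left])

/-- The right action of `R` on `M ⊗_A N`. -/
def tensorRact : R →ₐ[ℝ] Module.End ℝ (TensorCarrier A M N) where
  toFun a := tensorMap A LinearMap.id (N.ract a) (fun _ _ => rfl)
    (fun b n => (N.act_comm b a n).symm)
  map_one' := tensor_hom_ext (by simp)
  map_mul' a b := tensor_hom_ext (by simp)
  map_zero' := tensor_hom_ext (by simp [tmul_zero_right])
  map_add' a b := tensor_hom_ext (by simp [tmul_add_right])
  commutes' r := tensor_hom_ext (by simp [tmul_smul_right])

variable {M N}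

@[simp]
theorem tensorLact_tmul (a : R) (m : M.carrier) (n : N.carrier) :
    tensorLact A M N a (tmul A m n) = tmul A (M.lact a m) n := by
  simp [tensorLact]

@[simp]
theorem tensorRact_tmul (a : R) (m : M.carrier) (n : N.carrier) :
    tensorRact A M N a (tmul A m n) = tmul A m (N.ract a n) := by
  simp [tensorRact]

variable (M N)

/-- The degree `i` part of `M ⊗_A N`. -/
def tensorGr (i : ℤ) : Submodule ℝ (TensorCarrier A M N) :=
  Submodule.span ℝ {x | ∃ p q : ℤ, p + q = i ∧ ∃ m ∈ M.gr p, ∃ n ∈ N.gr q, x = tmul A m n}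

variable {M N}

theorem tmul_mem_tensorGr {p q : ℤ} {m : M.carrier} {n : N.carrier} (hm : m ∈ M.gr p)
    (hn : n ∈ N.gr q) : tmul A m n ∈ tensorGr A M N (p + q) :=
  Submodule.subset_span ⟨p, q, rfl, m, hm, n, hn, rfl⟩

theorem mem_of_tensorGr {P : Type u} [AddCommGroup P] [Module ℝ P]
    (f : TensorCarrier A M N →ₗ[ℝ] P) (i : ℤ) (Q : Submodule ℝ P)
    (h : ∀ p q : ℤ, p + q = i → ∀ m ∈ M.gr p, ∀ n ∈ N.gr q, f (tmul A m n) ∈ Q)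
    {x : TensorCarrier A M N} (hx : x ∈ tensorGr A M N i) : f x ∈ Q := by
  have hle : tensorGr A M N i ≤ Q.comap f := by
    refine Submodule.span_le.2 ?_
    rintro _ ⟨p, q, hpq, m, hm, n, hn, rfl⟩
    exact h p q hpq m hm n hn
  exact hle hx

variable (M N)

theorem tensorGr_isInternal [GradedAlgebra 𝒜] (hA : IsGradedSubalgebra 𝒜 A) :
    DirectSum.IsInternal (tensorGr A M N) := by
  classical
  obtain ⟨D, hD⟩ := exists_components M.gr M.isInternal
  obtain ⟨E, hE⟩ := exists_components N.gr N.isInternal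
  let F : M.carrier →ₗ[ℝ] N.carrier →ₗ[ℝ] (ℤ →₀ TensorCarrier A M N) :=
    (Finsupp.lsum ℝ (fun p : ℤ => LinearMap.flip
      (Finsupp.lsum ℝ (fun q : ℤ => LinearMap.flip
        (LinearMap.compr₂ (tmulBilin A M N) (Finsupp.lsingle (p + q))))
        : (ℤ →₀ N.carrier) →ₗ[ℝ] M.carrier →ₗ[ℝ] (ℤ →₀ TensorCarrier A M N)))
      : (ℤ →₀ M.carrier) →ₗ[ℝ] (ℤ →₀ N.carrier) →ₗ[ℝ] (ℤ →₀ TensorCarrier A M N)).compl₁₂ D E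
  have hF : ∀ p q : ℤ, ∀ m ∈ M.gr p, ∀ n ∈ N.gr q,
      F m n = Finsupp.single (p + q) (tmul A m n) := by
    intro p q m hm n hn
    simp [F, hD p m hm, hE q n hn]
  have hbal : ∀ a ∈ A, ∀ m n, F (M.ract a m) n = F m (N.lact a n) := by
    intro a ha m n
    induction m using isInternal_induction M.isInternal with
    | h0 => simp
    | hadd x y hx hy => simp only [map_add, LinearMap.add_apply, hx, hy]
    | hom p m hm =>
      induction n using isInternal_induction N.isInternal with
      | h0 => simp
      | hadd x y hx hy => simp only [map_add, hx, hy]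
      | hom q n hn =>
        have h : ∀ i, F (M.ract (DirectSum.decompose 𝒜 a i : R) m) n =
            F m (N.lact (DirectSum.decompose 𝒜 a i : R) n) := by
          intro i
          have hi : (DirectSum.decompose 𝒜 a i : R) ∈ 𝒜 i := SetLike.coe_mem _
          rw [hF _ _ _ (M.ract_mem hi hm) _ hn, hF _ _ _ hm _ (N.lact_mem hi hn),
            tmul_balanced (hA a ha i)]
          congr 1
          ring
        rw [← DirectSum.sum_support_decompose 𝒜 a]
        simp only [map_sum, LinearMap.sum_apply, h]
  refine isInternal_of_components _ ?_ (tensorLift A F hbal) ?_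
  · rw [eq_top_iff]
    rintro x -
    induction x using tensor_induction with
    | h0 => exact Submodule.zero_mem _
    | hadd x y hx hy => exact Submodule.add_mem _ hx hy
    | ht m n =>
      induction m using isInternal_induction M.isInternal with
      | h0 => rw [tmul_zero_left]; exact Submodule.zero_mem _
      | hadd x y hx hy => rw [tmul_add_left]; exact Submodule.add_mem _ hx hy
      | hom p m hm =>
        induction n using isInternal_induction N.isInternal with
        | h0 => rw [tmul_zero_right]; exact Submodule.zero_mem _
        | hadd x y hx hy => rw [tmul_add_right]; exact Submodule.add_mem _ hx hy
        | hom q n hn => exact Submodule.mem_iSup_of_mem (p + q) (tmul_mem_tensorGr A hm hn)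
  · intro i x hx
    have := mem_of_tensorGr A (tensorLift A F hbal - Finsupp.lsingle i) i ⊥ (by
      rintro p q rfl m hm n hn
      simp [hF p q m hm n hn]) hx
    simpa [sub_eq_zero] using this

/-- The graded bimodule `M ⊗_A N` for a graded subalgebra `A` of `R`. -/
abbrev tensorOver [GradedAlgebra 𝒜] (hA : IsGradedSubalgebra 𝒜 A) : GradedBimodule 𝒜 where
  carrier := TensorCarrier A M N
  lact := tensorLact A M N
  ract := tensorRact A M N
  act_comm a b x := by
    induction x using tensor_induction with
    | h0 => simp
    | hadd x y hx hy => simp only [map_add, hx, hy]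
    | ht m n => simp
  gr := tensorGr A M N
  isInternal := tensorGr_isInternal A M N hA
  lact_mem {i j a x} ha hx := mem_of_tensorGr A (tensorLact A M N a) j _ (by
    rintro p q rfl m hm n hn
    rw [tensorLact_tmul, ← add_assoc]
    exact tmul_mem_tensorGr A (M.lact_mem ha hm) hn) hx
  ract_mem {i j a x} ha hx := mem_of_tensorGr A (tensorRact A M N a) j _ (by
    rintro p q rfl m hm n hn
    rw [tensorRact_tmul, add_left_comm]
    exact tmul_mem_tensorGr A hm (N.ract_mem ha hn)) hx

end Tensor

/-- The tensor product `M ⊗_R N` of graded bimodules. -/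
abbrev tensor [GradedAlgebra 𝒜] (M N : GradedBimodule 𝒜) : GradedBimodule 𝒜 :=
  tensorOver ⊤ M N (fun _ _ _ => Algebra.mem_top)

end GradedBimodule
end GradedBimodule
end

noncomputable section

namespace GradedBimodule

variable {R : Type u} [CommRing R] [Algebra ℝ R] {𝒜 : ℤ → Submodule ℝ R}

/-! ### Compatibilities between tensor products, direct sums and shifts -/

section Compat

/-- Direct sums of isomorphisms. -/
def sumIso {M M' N N' : GradedBimodule 𝒜} (e : M ≅ M') (f : N ≅ N') : M.sum N ≅ M'.sum N' where
  hom := ⟨(Hom.toLin e.hom).prodMap (Hom.toLin f.hom),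
    fun a m => Prod.ext (Hom.map_lact e.hom a m.1) (Hom.map_lact f.hom a m.2),
    fun a m => Prod.ext (Hom.map_ract e.hom a m.1) (Hom.map_ract f.hom a m.2),
    fun h => ⟨Hom.map_gr e.hom h.1, Hom.map_gr f.hom h.2⟩⟩
  inv := ⟨(Hom.toLin e.inv).prodMap (Hom.toLin f.inv),
    fun a m => Prod.ext (Hom.map_lact e.inv a m.1) (Hom.map_lact f.inv a m.2),
    fun a m => Prod.ext (Hom.map_ract e.inv a m.1) (Hom.map_ract f.inv a m.2),
    fun h => ⟨Hom.map_gr e.inv h.1, Hom.map_gr f.inv h.2⟩⟩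
  hom_inv_id := hom_ext fun m => Prod.ext
    (LinearMap.congr_fun (congrArg Hom.toLin e.hom_inv_id) m.1)
    (LinearMap.congr_fun (congrArg Hom.toLin f.hom_inv_id) m.2)
  inv_hom_id := hom_ext fun m => Prod.ext
    (LinearMap.congr_fun (congrArg Hom.toLin e.inv_hom_id) m.1)
    (LinearMap.congr_fun (congrArg Hom.toLin f.inv_hom_id) m.2)

/-- Direct sums of retracts. -/
def sumRetract {M M' N N' : GradedBimodule 𝒜} (e : Retract M M') (f : Retract N N') :
    Retract (M.sum N) (M'.sum N') where
  i := ⟨(Hom.toLin e.i).prodMap (Hom.toLin f.i),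
    fun a m => Prod.ext (Hom.map_lact e.i a m.1) (Hom.map_lact f.i a m.2),
    fun a m => Prod.ext (Hom.map_ract e.i a m.1) (Hom.map_ract f.i a m.2),
    fun h => ⟨Hom.map_gr e.i h.1, Hom.map_gr f.i h.2⟩⟩
  r := ⟨(Hom.toLin e.r).prodMap (Hom.toLin f.r),
    fun a m => Prod.ext (Hom.map_lact e.r a m.1) (Hom.map_lact f.r a m.2),
    fun a m => Prod.ext (Hom.map_ract e.r a m.1) (Hom.map_ract f.r a m.2),
    fun h => ⟨Hom.map_gr e.r h.1, Hom.map_gr f.r h.2⟩⟩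
  retract := hom_ext fun m => Prod.ext
    (LinearMap.congr_fun (congrArg Hom.toLin e.retract) m.1)
    (LinearMap.congr_fun (congrArg Hom.toLin f.retract) m.2)

/-- Shifts of morphisms. -/
def shiftMap {M N : GradedBimodule 𝒜} (f : M ⟶ N) (n : ℤ) : M.shift n ⟶ N.shift n :=
  Hom.mk (M := M.shift n) (N := N.shift n) (Hom.toLin (M := M) (N := N) f) (Hom.map_lact f) (Hom.map_ract f)
    (fun h => Hom.map_gr f h)

/-- Shifts of isomorphisms. -/
def shiftIso {M N : GradedBimodule 𝒜} (e : M ≅ N) (n : ℤ) : M.shift n ≅ N.shift n where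
  hom := shiftMap e.hom n
  inv := shiftMap e.inv n
  hom_inv_id := hom_ext fun m => LinearMap.congr_fun (congrArg Hom.toLin e.hom_inv_id) m
  inv_hom_id := hom_ext fun m => LinearMap.congr_fun (congrArg Hom.toLin e.inv_hom_id) m

/-- Shifts of retracts. -/
def shiftRetract {M N : GradedBimodule 𝒜} (e : Retract M N) (n : ℤ) :
    Retract (M.shift n) (N.shift n) where
  i := shiftMap e.i n
  r := shiftMap e.r n
  retract := hom_ext fun m => LinearMap.congr_fun (congrArg Hom.toLin e.retract) m

/-- Two gradings on the same bimodule which agree define isomorphic graded bimodules. -/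
def isoOfEq {M N : GradedBimodule 𝒜} (e : M.carrier ≃ₗ[ℝ] N.carrier)
    (hl : ∀ a m, e (M.lact a m) = N.lact a (e m)) (hr : ∀ a m, e (M.ract a m) = N.ract a (e m))
    (hg : ∀ i m, m ∈ M.gr i → e m ∈ N.gr i) (hg' : ∀ i m, m ∈ N.gr i → e.symm m ∈ M.gr i) :
    M ≅ N where
  hom := Hom.mk e.toLinearMap hl hr (hg _ _)
  inv := Hom.mk e.symm.toLinearMap
    (fun a m => by
      have := hl a (e.symm m)
      simp only [LinearEquiv.apply_symm_apply] at this
      simp [← this])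
    (fun a m => by
      have := hr a (e.symm m)
      simp only [LinearEquiv.apply_symm_apply] at this
      simp [← this])
    (hg' _ _)
  hom_inv_id := hom_ext fun m => e.symm_apply_apply m
  inv_hom_id := hom_ext fun m => e.apply_symm_apply m

def shiftShift (M : GradedBimodule 𝒜) (n m : ℤ) : (M.shift n).shift m ≅ M.shift (n + m) :=
  isoOfEq (M := (M.shift n).shift m) (N := M.shift (n + m)) (LinearEquiv.refl ℝ M.carrier)
    (fun _ _ => rfl) (fun _ _ => rfl)
    (fun i x h => by change x ∈ M.gr (n + m + i); rw [add_assoc]; exact h)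
    (fun i x h => by change x ∈ M.gr (n + (m + i)); rw [← add_assoc]; exact h)

def shiftZero (M : GradedBimodule 𝒜) : M.shift 0 ≅ M :=
  isoOfEq (M := M.shift 0) (LinearEquiv.refl ℝ M.carrier)
    (fun _ _ => rfl) (fun _ _ => rfl)
    (fun i x (h : x ∈ M.gr (0 + i)) => by rw [zero_add] at h; exact h)
    (fun i x h => by change x ∈ M.gr (0 + i); rw [zero_add]; exact h)

def shiftSum (M N : GradedBimodule 𝒜) (n : ℤ) :
    (M.sum N).shift n ≅ (M.shift n).sum (N.shift n) :=
  isoOfEq (M := (M.sum N).shift n) (N := (M.shift n).sum (N.shift n))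
    (LinearEquiv.refl ℝ (M.carrier × N.carrier))
    (fun _ _ => rfl) (fun _ _ => rfl) (fun _ _ h => h) (fun _ _ h => h)

def shiftZeroObj (n : ℤ) : (zero 𝒜).shift n ≅ zero 𝒜 :=
  isoOfEq (M := (zero 𝒜).shift n) (LinearEquiv.refl ℝ PUnit.{u + 1})
    (fun _ _ => rfl) (fun _ _ => rfl) (fun _ _ h => h) (fun _ _ h => h)

def sumAssoc (M N P : GradedBimodule 𝒜) : (M.sum N).sum P ≅ M.sum (N.sum P) :=
  isoOfEq (M := (M.sum N).sum P) (N := M.sum (N.sum P))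
    (LinearEquiv.prodAssoc ℝ M.carrier N.carrier P.carrier)
    (fun _ _ => rfl) (fun _ _ => rfl) (fun _ _ h => ⟨h.1.1, h.1.2, h.2⟩)
    (fun _ _ h => ⟨⟨h.1, h.2.1⟩, h.2.2⟩)

def zeroSum (M : GradedBimodule 𝒜) : (zero 𝒜).sum M ≅ M :=
  isoOfEq (M := (zero 𝒜).sum M) (N := M)
    (LinearEquiv.prodUnique (R := ℝ) (M := M.carrier) (M₂ := PUnit.{u + 1})
      |> (LinearEquiv.prodComm ℝ PUnit.{u + 1} M.carrier).trans)
    (fun _ _ => rfl) (fun _ _ => rfl) (fun _ _ h => h.2)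
    (fun _ _ h => ⟨Submodule.zero_mem _, h⟩)

def sumZero (M : GradedBimodule 𝒜) : M.sum (zero 𝒜) ≅ M :=
  isoOfEq (M := M.sum (zero 𝒜)) (N := M)
    (LinearEquiv.prodUnique (R := ℝ) (M := M.carrier) (M₂ := PUnit.{u + 1}))
    (fun _ _ => rfl) (fun _ _ => rfl) (fun _ _ h => h.1)
    (fun _ _ h => ⟨h, Submodule.zero_mem _⟩)

variable [GradedAlgebra 𝒜]

/-- Tensor products of morphisms. -/
def tensorHom {M M' N N' : GradedBimodule 𝒜} (f : M ⟶ M') (g : N ⟶ N') :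
    M.tensor N ⟶ M'.tensor N' :=
  Hom.mk (M := M.tensor N) (N := M'.tensor N')
    (tensorMap ⊤ (Hom.toLin f) (Hom.toLin g) (Hom.map_ract f) (Hom.map_lact g))
    (fun a x => by
      induction x using tensor_induction with
      | h0 => simp only [map_zero]
      | hadd x y hx hy => simp only [map_add, hx, hy]
      | ht m n =>
        change tensorMap ⊤ _ _ _ _ (tensorLact ⊤ M N a _) = tensorLact ⊤ M' N' a _
        simp [f.map_lact])
    (fun a x => by
      induction x using tensor_induction with
      | h0 => simp only [map_zero]
      | hadd x y hx hy => simp only [map_add, hx, hy]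
      | ht m n =>
        change tensorMap ⊤ _ _ _ _ (tensorRact ⊤ M N a _) = tensorRact ⊤ M' N' a _
        simp [g.map_ract])
    (fun {i x} hx => mem_of_tensorGr ⊤ _ i (tensorGr ⊤ M' N' i) (by
      rintro p q rfl m hm n hn
      rw [tensorMap_tmul]
      exact tmul_mem_tensorGr ⊤ (f.map_gr hm) (g.map_gr hn)) hx)

theorem tensorHom_tmul {M M' N N' : GradedBimodule 𝒜} (f : M ⟶ M') (g : N ⟶ N')
    (m : M.carrier) (n : N.carrier) :
    Hom.toLin (tensorHom f g) (tmul ⊤ m n) = tmul ⊤ (Hom.toLin f m) (Hom.toLin g n) :=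
  tensorMap_tmul ⊤ _ _ (Hom.map_ract f) (Hom.map_lact g) m n

theorem tensorHom_comp {M M' M'' N N' N'' : GradedBimodule 𝒜} (f : M ⟶ M') (f' : M' ⟶ M'')
    (g : N ⟶ N') (g' : N' ⟶ N'') :
    tensorHom f g ≫ tensorHom f' g' = tensorHom (f ≫ f') (g ≫ g') :=
  Hom.ext (tensor_hom_ext fun m n => by simp [tensorHom])

theorem tensorHom_id (M N : GradedBimodule 𝒜) : tensorHom (𝟙 M) (𝟙 N) = 𝟙 (M.tensor N) :=
  Hom.ext (tensor_hom_ext fun m n => by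
    simp only [tensorHom, tensorMap_tmul, id_toLin, LinearMap.id_apply])

/-- Tensor products of isomorphisms. -/
def tensorIso {M M' N N' : GradedBimodule 𝒜} (e : M ≅ M') (f : N ≅ N') :
    M.tensor N ≅ M'.tensor N' where
  hom := tensorHom e.hom f.hom
  inv := tensorHom e.inv f.inv
  hom_inv_id := by rw [tensorHom_comp, e.hom_inv_id, f.hom_inv_id, tensorHom_id]
  inv_hom_id := by rw [tensorHom_comp, e.inv_hom_id, f.inv_hom_id, tensorHom_id]

/-- Tensor products of retracts. -/
def tensorRetract {M M' N N' : GradedBimodule 𝒜} (e : Retract M M') (f : Retract N N') :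
    Retract (M.tensor N) (M'.tensor N') where
  i := tensorHom e.i f.i
  r := tensorHom e.r f.r
  retract := by rw [tensorHom_comp, e.retract, f.retract, tensorHom_id]

/-- A convenient way to build isomorphisms out of a tensor product. -/
def isoOfTensor {M N P : GradedBimodule 𝒜}
    (f : (M.tensor N).carrier →ₗ[ℝ] P.carrier) (g : P.carrier →ₗ[ℝ] (M.tensor N).carrier)
    (hl : ∀ a m n, f (tmul ⊤ (M.lact a m) n) = P.lact a (f (tmul ⊤ m n)))
    (hr : ∀ a m n, f (tmul ⊤ m (N.ract a n)) = P.ract a (f (tmul ⊤ m n)))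
    (hgf : ∀ m n, g (f (tmul ⊤ m n)) = tmul ⊤ m n) (hfg : ∀ p, f (g p) = p)
    (hf : ∀ i j, ∀ m ∈ M.gr i, ∀ n ∈ N.gr j, f (tmul ⊤ m n) ∈ P.gr (i + j))
    (hg : ∀ i, ∀ p ∈ P.gr i, g p ∈ tensorGr ⊤ M N i) : M.tensor N ≅ P :=
  isoOfEq (LinearEquiv.ofLinearMap f g (LinearMap.ext hfg) (tensor_hom_ext hgf))
    (fun a x => by
      induction x using tensor_induction with
      | h0 => simp only [map_zero]
      | hadd x y hx hy => simp only [map_add, hx, hy]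
      | ht m n => exact (congrArg f (tensorLact_tmul ⊤ a m n)).trans (hl a m n))
    (fun a x => by
      induction x using tensor_induction with
      | h0 => simp only [map_zero]
      | hadd x y hx hy => simp only [map_add, hx, hy]
      | ht m n => exact (congrArg f (tensorRact_tmul ⊤ a m n)).trans (hr a m n))
    (fun i x hx => mem_of_tensorGr ⊤ f i (P.gr i) (by
      rintro p q rfl m hm n hn
      exact hf p q m hm n hn) hx)
    hg

theorem tensor_induction_left {M N P : GradedBimodule 𝒜}
    {p : TensorCarrier ⊤ (M.tensor N) P → Prop} (h0 : p 0)
    (hadd : ∀ x y, p x → p y → p (x + y))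
    (ht : ∀ m n q, p (tmul (M := M.tensor N) ⊤ (tmul ⊤ m n) q)) (x) : p x := by
  refine tensor_induction h0 hadd (fun x q => ?_) x
  refine tensor_induction (M := M) (N := N) (A := ⊤)
    (p := fun x => p (tmul (M := M.tensor N) ⊤ x q)) ?_ (fun x y hx hy => ?_)
    (fun m n => ht m n q) x
  · exact (tmul_zero_left (M := M.tensor N) ⊤ q).symm ▸ h0
  · exact (tmul_add_left (M := M.tensor N) ⊤ x y q).symm ▸ hadd _ _ hx hy

theorem tensor_induction_right {M N P : GradedBimodule 𝒜}
    {p : TensorCarrier ⊤ M (N.tensor P) → Prop} (h0 : p 0)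
    (hadd : ∀ x y, p x → p y → p (x + y))
    (ht : ∀ m n q, p (tmul (N := N.tensor P) ⊤ m (tmul ⊤ n q))) (x) : p x := by
  refine tensor_induction h0 hadd (fun m x => ?_) x
  refine tensor_induction (M := N) (N := P) (A := ⊤)
    (p := fun x => p (tmul (N := N.tensor P) ⊤ m x)) ?_ (fun x y hx hy => ?_)
    (fun n q => ht m n q) x
  · exact (tmul_zero_right (N := N.tensor P) ⊤ m).symm ▸ h0
  · exact (tmul_add_right (N := N.tensor P) ⊤ m x y).symm ▸ hadd _ _ hx hy

/-- The map `m ⊗ n ↦ (p ↦ m ⊗ (n ⊗ p))`. -/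
def assocFwdAux (M N P : GradedBimodule 𝒜) :
    TensorCarrier ⊤ M N →ₗ[ℝ] P.carrier →ₗ[ℝ] TensorCarrier ⊤ M (N.tensor P) :=
  tensorLift (P := P.carrier →ₗ[ℝ] TensorCarrier ⊤ M (N.tensor P)) ⊤
    (LinearMap.mk₂ ℝ (fun m n => tmulBilin ⊤ M (N.tensor P) m ∘ₗ tmulBilin ⊤ N P n)
      (fun m m' n => by ext; simp)
      (fun r m n => by ext; simp)
      (fun m n n' => LinearMap.ext fun p => by
        simp only [LinearMap.comp_apply, map_add, LinearMap.add_apply])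
      (fun r m n => LinearMap.ext fun p => by
        simp only [LinearMap.comp_apply, map_smul, LinearMap.smul_apply]))
    (fun a _ m n => LinearMap.ext fun p =>
      (tmul_balanced (N := N.tensor P) Algebra.mem_top m (tmul ⊤ n p)).trans
        (congrArg (tmul (N := N.tensor P) ⊤ m) (tensorLact_tmul ⊤ a n p)))

theorem assocFwdAux_tmul {M N P : GradedBimodule 𝒜} (m : M.carrier) (n : N.carrier)
    (p : P.carrier) :
    assocFwdAux M N P (tmul ⊤ m n) p = tmul (N := N.tensor P) ⊤ m (tmul ⊤ n p) :=
  LinearMap.congr_fun (tensorLift_tmul (M := M) (N := N) ⊤ _ _ m n) p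

/-- The map `(m ⊗ n) ⊗ p ↦ m ⊗ (n ⊗ p)`. -/
def assocFwd (M N P : GradedBimodule 𝒜) :
    TensorCarrier ⊤ (M.tensor N) P →ₗ[ℝ] TensorCarrier ⊤ M (N.tensor P) :=
  tensorLift (M := M.tensor N) (N := P) ⊤ (assocFwdAux M N P)
    (by
      intro a _ x p
      refine tensor_induction (M := M) (N := N) (A := ⊤) (p := fun x =>
        assocFwdAux M N P (tensorRact ⊤ M N a x) p = assocFwdAux M N P x (P.lact a p))
        ?_ ?_ ?_ x
      · simp only [map_zero, LinearMap.zero_apply]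
      · intro x y hx hy
        simp only [map_add, LinearMap.add_apply, hx, hy]
      · intro m n
        rw [tensorRact_tmul, assocFwdAux_tmul, assocFwdAux_tmul,
          tmul_balanced (A := ⊤) (Algebra.mem_top : a ∈ _) n p])

theorem assocFwd_tmul {M N P : GradedBimodule 𝒜} (m : M.carrier) (n : N.carrier) (p : P.carrier) :
    assocFwd M N P (tmul (M := M.tensor N) ⊤ (tmul ⊤ m n) p) =
      tmul (N := N.tensor P) ⊤ m (tmul ⊤ n p) :=
  (tensorLift_tmul (M := M.tensor N) ⊤ _ _ (tmul ⊤ m n) p).trans (assocFwdAux_tmul m n p)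

/-- The map `n ⊗ p ↦ (m ↦ (m ⊗ n) ⊗ p)`. -/
def assocBwdAux (M N P : GradedBimodule 𝒜) :
    TensorCarrier ⊤ N P →ₗ[ℝ] M.carrier →ₗ[ℝ] TensorCarrier ⊤ (M.tensor N) P :=
  tensorLift (P := M.carrier →ₗ[ℝ] TensorCarrier ⊤ (M.tensor N) P) ⊤
    (LinearMap.mk₂ ℝ (fun n p => (tmulBilin ⊤ (M.tensor N) P).flip p ∘ₗ
        (tmulBilin ⊤ M N).flip n)
      (fun n n' p => LinearMap.ext fun m => by
        simp only [LinearMap.comp_apply, map_add, LinearMap.add_apply])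
      (fun r n p => LinearMap.ext fun m => by
        simp only [LinearMap.comp_apply, map_smul, LinearMap.smul_apply])
      (fun n p p' => by ext; simp)
      (fun r n p => by ext; simp))
    (fun a _ n p => LinearMap.ext fun m =>
      (congrArg (fun z => tmul (M := M.tensor N) ⊤ z p) (tensorRact_tmul ⊤ a m n).symm).trans
        (tmul_balanced (M := M.tensor N) Algebra.mem_top (tmul ⊤ m n) p))

theorem assocBwdAux_tmul {M N P : GradedBimodule 𝒜} (m : M.carrier) (n : N.carrier)
    (p : P.carrier) :
    assocBwdAux M N P (tmul ⊤ n p) m = tmul (M := M.tensor N) ⊤ (tmul ⊤ m n) p :=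
  LinearMap.congr_fun (tensorLift_tmul (M := N) (N := P) ⊤ _ _ n p) m

/-- The map `m ⊗ (n ⊗ p) ↦ (m ⊗ n) ⊗ p`. -/
def assocBwd (M N P : GradedBimodule 𝒜) :
    TensorCarrier ⊤ M (N.tensor P) →ₗ[ℝ] TensorCarrier ⊤ (M.tensor N) P :=
  tensorLift (M := M) (N := N.tensor P) ⊤ (assocBwdAux M N P).flip
    (by
      intro a _ m x
      refine tensor_induction (M := N) (N := P) (A := ⊤) (p := fun x =>
        assocBwdAux M N P x (M.ract a m) = assocBwdAux M N P (tensorLact ⊤ N P a x) m)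
        ?_ ?_ ?_ x
      · simp only [map_zero, LinearMap.zero_apply]
      · intro x y hx hy
        simp only [map_add, LinearMap.add_apply, hx, hy]
      · intro n p
        rw [tensorLact_tmul, assocBwdAux_tmul, assocBwdAux_tmul,
          tmul_balanced (A := ⊤) (Algebra.mem_top : a ∈ _) m n])

theorem assocBwd_tmul {M N P : GradedBimodule 𝒜} (m : M.carrier) (n : N.carrier) (p : P.carrier) :
    assocBwd M N P (tmul (N := N.tensor P) ⊤ m (tmul ⊤ n p)) =
      tmul (M := M.tensor N) ⊤ (tmul ⊤ m n) p :=
  (tensorLift_tmul (N := N.tensor P) ⊤ _ _ m (tmul ⊤ n p)).trans (assocBwdAux_tmul m n p)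

/-- `(M ⊗ N) ⊗ P ≅ M ⊗ (N ⊗ P)`. -/
def tensorAssoc (M N P : GradedBimodule 𝒜) :
    (M.tensor N).tensor P ≅ M.tensor (N.tensor P) :=
  isoOfEq (M := (M.tensor N).tensor P) (N := M.tensor (N.tensor P))
    (LinearEquiv.ofLinearMap (assocFwd M N P) (assocBwd M N P)
      (LinearMap.ext fun x => by
        induction x using tensor_induction_right with
        | h0 => simp only [map_zero]
        | hadd x y hx hy => simp only [map_add, hx, hy]
        | ht m n p =>
          exact (congrArg (assocFwd M N P) (assocBwd_tmul m n p)).trans (assocFwd_tmul m n p))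
      (LinearMap.ext fun x => by
        induction x using tensor_induction_left with
        | h0 => simp only [map_zero]
        | hadd x y hx hy => simp only [map_add, hx, hy]
        | ht m n p =>
          exact (congrArg (assocBwd M N P) (assocFwd_tmul m n p)).trans (assocBwd_tmul m n p)))
    (fun a x => by
      induction x using tensor_induction_left with
      | h0 => simp only [map_zero]
      | hadd x y hx hy => simp only [map_add, hx, hy]
      | ht m n p =>
        refine (congrArg (assocFwd M N P) ((tensorLact_tmul (M := M.tensor N) ⊤ a _ p).trans
          (congrArg (fun z => tmul (M := M.tensor N) ⊤ z p) (tensorLact_tmul ⊤ a m n)))).trans ?_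
        refine (assocFwd_tmul _ n p).trans ?_
        refine Eq.trans ?_ (congrArg (tensorLact ⊤ M (N.tensor P) a) (assocFwd_tmul m n p)).symm
        exact (tensorLact_tmul (N := N.tensor P) ⊤ a m _).symm)
    (fun a x => by
      induction x using tensor_induction_left with
      | h0 => simp only [map_zero]
      | hadd x y hx hy => simp only [map_add, hx, hy]
      | ht m n p =>
        refine (congrArg (assocFwd M N P) (tensorRact_tmul (M := M.tensor N) ⊤ a _ p)).trans ?_
        refine (assocFwd_tmul m n _).trans ?_
        refine Eq.trans ?_ (congrArg (tensorRact ⊤ M (N.tensor P) a) (assocFwd_tmul m n p)).symm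
        exact ((tensorRact_tmul (N := N.tensor P) ⊤ a m _).trans
          (congrArg (tmul (N := N.tensor P) ⊤ m) (tensorRact_tmul ⊤ a n p))).symm)
    (fun i x hx => by
      refine mem_of_tensorGr (M := M.tensor N) ⊤ (assocFwd M N P) i
        (tensorGr ⊤ M (N.tensor P) i) ?_ hx
      rintro k l rfl y hy p hp
      refine mem_of_tensorGr ⊤ ((assocFwd M N P).comp ((tmulBilin ⊤ (M.tensor N) P).flip p)) k
        (tensorGr ⊤ M (N.tensor P) (k + l)) ?_ hy
      rintro r s rfl m hm n hn
      rw [add_assoc]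
      exact (assocFwd_tmul m n p).symm ▸
        tmul_mem_tensorGr (N := N.tensor P) ⊤ hm (tmul_mem_tensorGr ⊤ hn hp))
    (fun i x hx => by
      refine mem_of_tensorGr (N := N.tensor P) ⊤ (assocBwd M N P) i
        (tensorGr ⊤ (M.tensor N) P i) ?_ hx
      rintro k l rfl m hm y hy
      refine mem_of_tensorGr ⊤ ((assocBwd M N P).comp (tmulBilin ⊤ M (N.tensor P) m)) l
        (tensorGr ⊤ (M.tensor N) P (k + l)) ?_ hy
      rintro r s rfl n hn p hp
      rw [← add_assoc]
      exact (assocBwd_tmul m n p).symm ▸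
        tmul_mem_tensorGr (M := M.tensor N) ⊤ (tmul_mem_tensorGr ⊤ hm hn) hp)

/-- `R ⊗_R M ≅ M`. -/
def unitTensor (M : GradedBimodule 𝒜) : (unit 𝒜).tensor M ≅ M :=
  isoOfTensor (M := unit 𝒜) (N := M)
    (tensorLift (M := unit 𝒜) ⊤ M.lact.toLinearMap
      (fun a _ (m : R) n => by
        change M.lact (a * m) n = M.lact m (M.lact a n)
        rw [mul_comm, map_mul, Module.End.mul_apply]))
    (tmulBilin ⊤ (unit 𝒜) M (1 : R))
    (fun a (m : R) n => by
      simp only [tensorLift_tmul]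
      change M.lact (a * m) n = M.lact a (M.lact m n)
      rw [map_mul, Module.End.mul_apply])
    (fun a (m : R) n => by
      simp only [tensorLift_tmul]
      exact M.act_comm m a n)
    (fun (m : R) n => by
      simp only [tensorLift_tmul]
      refine (tmul_balanced (M := unit 𝒜) (A := ⊤) (Algebra.mem_top : m ∈ _) (1 : R) n).symm.trans ?_
      exact congrArg (fun z : R => tmul (M := unit 𝒜) ⊤ z n) (mul_one m))
    (fun p => by
      simp only [tensorLift_tmul, tmulBilin_apply]
      exact LinearMap.congr_fun (map_one M.lact) p)
    (fun i j m hm n hn => by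
      simp only [tensorLift_tmul]
      exact M.lact_mem hm hn)
    (fun i p hp => by
      have := tmul_mem_tensorGr (M := unit 𝒜) ⊤ (SetLike.one_mem_graded 𝒜) hp
      rwa [zero_add] at this)

/-- `M ⊗_R R ≅ M`. -/
def tensorUnit (M : GradedBimodule 𝒜) : M.tensor (unit 𝒜) ≅ M :=
  isoOfTensor (M := M) (N := unit 𝒜)
    (tensorLift (N := unit 𝒜) ⊤ M.ract.toLinearMap.flip
      (fun a _ m (n : R) => by
        change M.ract n (M.ract a m) = M.ract (a * n) m
        rw [mul_comm, map_mul, Module.End.mul_apply]))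
    ((tmulBilin ⊤ M (unit 𝒜)).flip (1 : R))
    (fun a m (n : R) => by
      simp only [tensorLift_tmul]
      exact (M.act_comm a n m).symm)
    (fun a m (n : R) => by
      simp only [tensorLift_tmul]
      change M.ract (a * n) m = M.ract a (M.ract n m)
      rw [map_mul, Module.End.mul_apply])
    (fun m (n : R) => by
      simp only [tensorLift_tmul, LinearMap.flip_apply, tmulBilin_apply]
      refine (tmul_balanced (N := unit 𝒜) (A := ⊤) (Algebra.mem_top : n ∈ _) m (1 : R)).trans ?_
      exact congrArg (fun z : R => tmul (N := unit 𝒜) ⊤ m z) (mul_one n))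
    (fun p => by
      simp only [tensorLift_tmul, LinearMap.flip_apply, tmulBilin_apply]
      exact LinearMap.congr_fun (map_one M.ract) p)
    (fun i j m hm n hn => by
      simp only [tensorLift_tmul]
      rw [add_comm]
      exact M.ract_mem hn hm)
    (fun i p hp => by
      have := tmul_mem_tensorGr (N := unit 𝒜) ⊤ hp (SetLike.one_mem_graded 𝒜)
      rwa [add_zero] at this)

/-- `M(n) ⊗ N ≅ (M ⊗ N)(n)`. -/
def shiftTensor (M N : GradedBimodule 𝒜) (n : ℤ) :
    (M.shift n).tensor N ≅ (M.tensor N).shift n :=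
  isoOfEq (M := (M.shift n).tensor N) (N := (M.tensor N).shift n)
    (LinearEquiv.refl ℝ (TensorCarrier ⊤ M N)) (fun _ _ => rfl) (fun _ _ => rfl)
    (fun i x hx => mem_of_tensorGr (M := M.shift n) ⊤ LinearMap.id i
      (tensorGr ⊤ M N (n + i)) (by
        rintro p q rfl m hm k hk
        rw [← add_assoc]
        exact tmul_mem_tensorGr (M := M) ⊤ hm hk) hx)
    (fun i x hx => mem_of_tensorGr (M := M) ⊤ LinearMap.id (n + i)
      (tensorGr ⊤ (M.shift n) N i) (by
        rintro p q hpq m hm k hk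
        have hm' : m ∈ (M.shift n).gr (p - n) := by
          change m ∈ M.gr (n + (p - n))
          rwa [add_sub_cancel]
        have := tmul_mem_tensorGr (M := M.shift n) ⊤ hm' hk
        rwa [show p - n + q = i by lia] at this) hx)

/-- `M ⊗ N(n) ≅ (M ⊗ N)(n)`. -/
def tensorShift (M N : GradedBimodule 𝒜) (n : ℤ) :
    M.tensor (N.shift n) ≅ (M.tensor N).shift n :=
  isoOfEq (M := M.tensor (N.shift n)) (N := (M.tensor N).shift n)
    (LinearEquiv.refl ℝ (TensorCarrier ⊤ M N)) (fun _ _ => rfl) (fun _ _ => rfl)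
    (fun i x hx => mem_of_tensorGr (N := N.shift n) ⊤ LinearMap.id i
      (tensorGr ⊤ M N (n + i)) (by
        rintro p q rfl m hm k hk
        rw [add_left_comm]
        exact tmul_mem_tensorGr (N := N) ⊤ hm hk) hx)
    (fun i x hx => mem_of_tensorGr (N := N) ⊤ LinearMap.id (n + i)
      (tensorGr ⊤ M (N.shift n) i) (by
        rintro p q hpq m hm k hk
        have hk' : k ∈ (N.shift n).gr (q - n) := by
          change k ∈ N.gr (n + (q - n))
          rwa [add_sub_cancel]
        have := tmul_mem_tensorGr (N := N.shift n) ⊤ hm hk'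
        rwa [show p + (q - n) = i by lia] at this) hx)

/-- The first inclusion into a direct sum. -/
def sumInl (M N : GradedBimodule 𝒜) : M ⟶ M.sum N :=
  Hom.mk (N := M.sum N) (LinearMap.inl ℝ _ _)
    (fun a _ => Prod.ext rfl (map_zero (N.lact a)).symm)
    (fun a _ => Prod.ext rfl (map_zero (N.ract a)).symm)
    (fun h => ⟨h, Submodule.zero_mem _⟩)

/-- The second inclusion into a direct sum. -/
def sumInr (M N : GradedBimodule 𝒜) : N ⟶ M.sum N :=
  Hom.mk (N := M.sum N) (LinearMap.inr ℝ _ _)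
    (fun a _ => Prod.ext (map_zero (M.lact a)).symm rfl)
    (fun a _ => Prod.ext (map_zero (M.ract a)).symm rfl)
    (fun h => ⟨Submodule.zero_mem _, h⟩)

/-- The first projection of a direct sum. -/
def sumFst (M N : GradedBimodule 𝒜) : M.sum N ⟶ M :=
  Hom.mk (M := M.sum N) (LinearMap.fst ℝ _ _) (fun _ _ => rfl) (fun _ _ => rfl) (fun h => h.1)

/-- The second projection of a direct sum. -/
def sumSnd (M N : GradedBimodule 𝒜) : M.sum N ⟶ N :=
  Hom.mk (M := M.sum N) (LinearMap.snd ℝ _ _) (fun _ _ => rfl) (fun _ _ => rfl) (fun h => h.2)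

/-- A direct sum is recognized by its inclusions and projections. -/
def isoSumOfBiproduct {X Y Z : GradedBimodule 𝒜} (i₁ : Y ⟶ X) (i₂ : Z ⟶ X) (p₁ : X ⟶ Y)
    (p₂ : X ⟶ Z) (h₁₁ : i₁ ≫ p₁ = 𝟙 Y) (h₂₂ : i₂ ≫ p₂ = 𝟙 Z)
    (h₁₂ : ∀ y, Hom.toLin p₂ (Hom.toLin i₁ y) = 0) (h₂₁ : ∀ z, Hom.toLin p₁ (Hom.toLin i₂ z) = 0)
    (h : ∀ x, Hom.toLin i₁ (Hom.toLin p₁ x) + Hom.toLin i₂ (Hom.toLin p₂ x) = x) :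
    X ≅ Y.sum Z :=
  isoOfEq (N := Y.sum Z)
    (LinearEquiv.ofLinearMap ((Hom.toLin p₁).prod (Hom.toLin p₂))
      ((Hom.toLin i₁).coprod (Hom.toLin i₂))
      (LinearMap.ext fun x => by
        have e₁ := LinearMap.congr_fun (congrArg Hom.toLin h₁₁) x.1
        have e₂ := LinearMap.congr_fun (congrArg Hom.toLin h₂₂) x.2
        simp only [comp_toLin, id_toLin, LinearMap.comp_apply, LinearMap.id_apply] at e₁ e₂
        ext
        · simp [e₁, h₂₁]
        · simp [e₂, h₁₂])
      (LinearMap.ext fun x => by simp [h]))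
    (fun a x => Prod.ext (Hom.map_lact p₁ a x) (Hom.map_lact p₂ a x))
    (fun a x => Prod.ext (Hom.map_ract p₁ a x) (Hom.map_ract p₂ a x))
    (fun i x hx => ⟨Hom.map_gr p₁ hx, Hom.map_gr p₂ hx⟩)
    (fun i x hx => Submodule.add_mem _ (Hom.map_gr i₁ hx.1) (Hom.map_gr i₂ hx.2))

/-- `(M ⊕ N) ⊗ P ≅ (M ⊗ P) ⊕ (N ⊗ P)`. -/
def sumTensor (M N P : GradedBimodule 𝒜) :
    (M.sum N).tensor P ≅ (M.tensor P).sum (N.tensor P) :=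
  isoSumOfBiproduct (tensorHom (sumInl M N) (𝟙 P)) (tensorHom (sumInr M N) (𝟙 P))
    (tensorHom (sumFst M N) (𝟙 P)) (tensorHom (sumSnd M N) (𝟙 P))
    (by
      rw [tensorHom_comp, ← tensorHom_id]
      rfl)
    (by
      rw [tensorHom_comp, ← tensorHom_id]
      rfl)
    (fun y => by
      induction y using tensor_induction with
      | h0 => simp only [map_zero]
      | hadd x y hx hy => simp only [map_add, hx, hy, add_zero]
      | ht m n =>
        refine (congrArg _ (tensorHom_tmul _ _ m n)).trans ?_
        refine (tensorHom_tmul _ _ _ _).trans ?_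
        exact tmul_zero_left ⊤ _)
    (fun y => by
      induction y using tensor_induction with
      | h0 => simp only [map_zero]
      | hadd x y hx hy => simp only [map_add, hx, hy, add_zero]
      | ht m n =>
        refine (congrArg _ (tensorHom_tmul _ _ m n)).trans ?_
        refine (tensorHom_tmul _ _ _ _).trans ?_
        exact tmul_zero_left ⊤ _)
    (fun y => by
      induction y using tensor_induction with
      | h0 => simp only [map_zero, add_zero]
      | hadd x y hx hy =>
        refine Eq.trans ?_ (congrArg₂ _ hx hy)
        simp only [map_add]
        abel
      | ht m n =>
        simp only [tensorHom, tensorMap_tmul]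
        rw [← tmul_add_left]
        refine congrArg (fun z => tmul (M := M.sum N) ⊤ z n) ?_
        exact Prod.ext (add_zero m.1) (zero_add m.2))

/-- `P ⊗ (M ⊕ N) ≅ (P ⊗ M) ⊕ (P ⊗ N)`. -/
def tensorSum (P M N : GradedBimodule 𝒜) :
    P.tensor (M.sum N) ≅ (P.tensor M).sum (P.tensor N) :=
  isoSumOfBiproduct (tensorHom (𝟙 P) (sumInl M N)) (tensorHom (𝟙 P) (sumInr M N))
    (tensorHom (𝟙 P) (sumFst M N)) (tensorHom (𝟙 P) (sumSnd M N))
    (by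
      rw [tensorHom_comp, ← tensorHom_id]
      rfl)
    (by
      rw [tensorHom_comp, ← tensorHom_id]
      rfl)
    (fun y => by
      induction y using tensor_induction with
      | h0 => simp only [map_zero]
      | hadd x y hx hy => simp only [map_add, hx, hy, add_zero]
      | ht m n =>
        refine (congrArg _ (tensorHom_tmul _ _ m n)).trans ?_
        refine (tensorHom_tmul _ _ _ _).trans ?_
        exact tmul_zero_right ⊤ _)
    (fun y => by
      induction y using tensor_induction with
      | h0 => simp only [map_zero]
      | hadd x y hx hy => simp only [map_add, hx, hy, add_zero]
      | ht m n =>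
        refine (congrArg _ (tensorHom_tmul _ _ m n)).trans ?_
        refine (tensorHom_tmul _ _ _ _).trans ?_
        exact tmul_zero_right ⊤ _)
    (fun y => by
      induction y using tensor_induction with
      | h0 => simp only [map_zero, add_zero]
      | hadd x y hx hy =>
        refine Eq.trans ?_ (congrArg₂ _ hx hy)
        simp only [map_add]
        abel
      | ht m n =>
        simp only [tensorHom, tensorMap_tmul]
        rw [← tmul_add_right]
        refine congrArg (fun z => tmul (N := M.sum N) ⊤ m z) ?_
        exact Prod.ext (add_zero n.1) (zero_add n.2))

/-- A graded bimodule with zero underlying space is isomorphic to `zero`. -/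
def isoZero (M : GradedBimodule 𝒜) (h : ∀ m : M.carrier, m = 0) : M ≅ zero 𝒜 where
  hom := Hom.mk (N := zero 𝒜) 0 (fun _ _ => rfl) (fun _ _ => rfl) (fun _ => rfl)
  inv := Hom.mk (M := zero 𝒜) 0 (fun a _ => (map_zero (M.lact a)).symm)
    (fun a _ => (map_zero (M.ract a)).symm) (fun _ => Submodule.zero_mem _)
  hom_inv_id := hom_ext fun m => (h m).symm
  inv_hom_id := rfl

def zeroTensor (M : GradedBimodule 𝒜) : (zero 𝒜).tensor M ≅ zero 𝒜 :=
  isoZero _ fun x => by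
    induction x using tensor_induction with
    | h0 => rfl
    | hadd x y hx hy => rw [hx, hy, add_zero]
    | ht m n => exact tmul_zero_left (M := zero 𝒜) ⊤ n

def tensorZero (M : GradedBimodule 𝒜) : M.tensor (zero 𝒜) ≅ zero 𝒜 :=
  isoZero _ fun x => by
    induction x using tensor_induction with
    | h0 => rfl
    | hadd x y hx hy => rw [hx, hy, add_zero]
    | ht m n => exact tmul_zero_right (N := zero 𝒜) ⊤ m

end Compat
end GradedBimodule
end

noncomputable section

namespace GradedBimodule

variable {R : Type u} [CommRing R] [Algebra ℝ R] {𝒜 : ℤ → Submodule ℝ R} [GradedAlgebra 𝒜]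

section Grothendieck

/-! ### The category generated by a family of graded bimodules -/

variable {T : Type*} (B : T → GradedBimodule 𝒜)

/-- The tensor product `B_{t₁} ⊗ ⋯ ⊗ B_{t_k}` (over `R`); the empty one is `R`. -/
def word : List T → GradedBimodule 𝒜
  | [] => unit 𝒜
  | t :: l => (B t).tensor (word l)

/-- The finite direct sum of the shifted tensor products `B_{t₁} ⊗ ⋯ ⊗ B_{t_k} (n)`. -/
def sumOfWords : List (List T × ℤ) → GradedBimodule 𝒜
  | [] => zero 𝒜
  | p :: L => ((word B p.1).shift p.2).sum (sumOfWords L)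

/-- The objects of the Karoubi envelope of the category of shifted tensor products of the `B t`,
realized inside graded bimodules: the direct summands (retracts) of finite direct sums of shifted
tensor products of the `B t`. -/
def generated : ObjectProperty (GradedBimodule 𝒜) := fun M =>
  ∃ L : List (List T × ℤ), Nonempty (Retract M (sumOfWords B L))

/-- The category generated by the `B t`: a full subcategory of graded bimodules. -/
abbrev GeneratedCategory := (generated B).FullSubcategory

theorem wordAppend (l l' : List T) :
    Nonempty ((word B l).tensor (word B l') ≅ word B (l ++ l')) := by
  induction l with
  | nil => exact ⟨unitTensor _⟩
  | cons t l ih =>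
    obtain ⟨e⟩ := ih
    exact ⟨tensorAssoc _ _ _ ≪≫ tensorIso (Iso.refl _) e⟩

theorem sumOfWordsAppend (L L' : List (List T × ℤ)) :
    Nonempty ((sumOfWords B L).sum (sumOfWords B L') ≅ sumOfWords B (L ++ L')) := by
  induction L with
  | nil => exact ⟨zeroSum _⟩
  | cons p L ih =>
    obtain ⟨e⟩ := ih
    exact ⟨sumAssoc _ _ _ ≪≫ sumIso (Iso.refl _) e⟩

theorem sumOfWordsShift (L : List (List T × ℤ)) (n : ℤ) :
    ∃ L', Nonempty ((sumOfWords B L).shift n ≅ sumOfWords B L') := by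
  induction L with
  | nil => exact ⟨[], ⟨shiftZeroObj n⟩⟩
  | cons p L ih =>
    obtain ⟨L', ⟨e⟩⟩ := ih
    exact ⟨(p.1, p.2 + n) :: L', ⟨shiftSum _ _ n ≪≫ sumIso (shiftShift _ _ _) e⟩⟩

theorem wordTensorSumOfWords (p : List T × ℤ) (L : List (List T × ℤ)) :
    ∃ L', Nonempty (((word B p.1).shift p.2).tensor (sumOfWords B L) ≅ sumOfWords B L') := by
  induction L with
  | nil => exact ⟨[], ⟨tensorZero _⟩⟩
  | cons q L ih =>
    obtain ⟨L', ⟨e⟩⟩ := ih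
    obtain ⟨f⟩ := wordAppend B p.1 q.1
    refine ⟨(p.1 ++ q.1, p.2 + q.2) :: L', ⟨tensorSum _ _ _ ≪≫ sumIso ?_ e⟩⟩
    exact tensorShift _ _ _ ≪≫ shiftIso (shiftTensor _ _ _ ≪≫ shiftIso f _) _ ≪≫ shiftShift _ _ _

theorem sumOfWordsTensor (L L' : List (List T × ℤ)) :
    ∃ L'', Nonempty ((sumOfWords B L).tensor (sumOfWords B L') ≅ sumOfWords B L'') := by
  induction L with
  | nil => exact ⟨[], ⟨zeroTensor _⟩⟩
  | cons p L ih =>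
    obtain ⟨L₁, ⟨e⟩⟩ := ih
    obtain ⟨L₂, ⟨f⟩⟩ := wordTensorSumOfWords B p L'
    obtain ⟨g⟩ := sumOfWordsAppend B L₂ L₁
    exact ⟨L₂ ++ L₁, ⟨sumTensor _ _ _ ≪≫ sumIso f e ≪≫ g⟩⟩

theorem generated_tensor {M N : GradedBimodule 𝒜} (hM : generated B M) (hN : generated B N) :
    generated B (M.tensor N) := by
  obtain ⟨L, ⟨e⟩⟩ := hM
  obtain ⟨L', ⟨f⟩⟩ := hN
  obtain ⟨L'', ⟨g⟩⟩ := sumOfWordsTensor B L L'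
  exact ⟨L'', ⟨(tensorRetract e f).trans (Retract.ofIso g)⟩⟩

theorem generated_sum {M N : GradedBimodule 𝒜} (hM : generated B M) (hN : generated B N) :
    generated B (M.sum N) := by
  obtain ⟨L, ⟨e⟩⟩ := hM
  obtain ⟨L', ⟨f⟩⟩ := hN
  obtain ⟨g⟩ := sumOfWordsAppend B L L'
  exact ⟨L ++ L', ⟨(sumRetract e f).trans (Retract.ofIso g)⟩⟩

theorem generated_shift {M : GradedBimodule 𝒜} (hM : generated B M) (n : ℤ) :
    generated B (M.shift n) := by
  obtain ⟨L, ⟨e⟩⟩ := hM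
  obtain ⟨L', ⟨f⟩⟩ := sumOfWordsShift B L n
  exact ⟨L', ⟨(shiftRetract e n).trans (Retract.ofIso f)⟩⟩

theorem generated_word (l : List T) : generated B (word B l) :=
  ⟨[(l, 0)], ⟨Retract.ofIso ((shiftZero _).symm ≪≫ (sumZero _).symm)⟩⟩

theorem generated_unit : generated B (unit 𝒜) := generated_word B []

theorem generated_of (t : T) : generated B (B t) := by
  obtain ⟨L, ⟨e⟩⟩ := generated_word B [t]
  exact ⟨L, ⟨(Retract.ofIso (tensorUnit (B t)).symm).trans e⟩⟩

/-! ### The split Grothendieck ring -/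

/-- The set of isomorphism classes of objects of the category generated by the `B t`. -/
def IsoClass : Type (u + 1) := Quotient (isIsomorphicSetoid (GeneratedCategory B))

variable {B}

/-- The isomorphism class of an object. -/
def IsoClass.mk (M : GeneratedCategory B) : IsoClass B := Quotient.mk _ M

theorem IsoClass.mk_eq {M N : GeneratedCategory B} (e : M.obj ≅ N.obj) :
    IsoClass.mk M = IsoClass.mk N :=
  Quotient.sound ⟨ObjectProperty.isoMk _ e⟩

/-- The tensor product in the category generated by the `B t`. -/
def GeneratedCategory.tensor (M N : GeneratedCategory B) : GeneratedCategory B :=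
  ⟨M.obj.tensor N.obj, generated_tensor B M.property N.property⟩

/-- The direct sum in the category generated by the `B t`. -/
def GeneratedCategory.sum (M N : GeneratedCategory B) : GeneratedCategory B :=
  ⟨M.obj.sum N.obj, generated_sum B M.property N.property⟩

/-- The grading shift in the category generated by the `B t`. -/
def GeneratedCategory.shift (M : GeneratedCategory B) (n : ℤ) : GeneratedCategory B :=
  ⟨M.obj.shift n, generated_shift B M.property n⟩

variable (B) in
/-- The object `R(n)` of the category generated by the `B t`. -/
def GeneratedCategory.unitShift (n : ℤ) : GeneratedCategory B :=
  ⟨(unit 𝒜).shift n, generated_shift B (generated_unit B) n⟩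

/-- The isomorphism `M ≅ N` in the ambient category underlying one in the full subcategory. -/
def GeneratedCategory.toIso {M N : GeneratedCategory B} (e : M ≅ N) : M.obj ≅ N.obj :=
  (generated B).ι.mapIso e

instance : Monoid (IsoClass B) where
  mul := Quotient.map₂ GeneratedCategory.tensor (by
    rintro M M' ⟨e⟩ N N' ⟨f⟩
    exact ⟨ObjectProperty.isoMk _
      (tensorIso (GeneratedCategory.toIso e) (GeneratedCategory.toIso f))⟩)
  one := IsoClass.mk ⟨unit 𝒜, generated_unit B⟩
  mul_assoc := by
    rintro ⟨M⟩ ⟨N⟩ ⟨P⟩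
    exact IsoClass.mk_eq (tensorAssoc M.obj N.obj P.obj)
  one_mul := by
    rintro ⟨M⟩
    exact IsoClass.mk_eq (unitTensor M.obj)
  mul_one := by
    rintro ⟨M⟩
    exact IsoClass.mk_eq (tensorUnit M.obj)

theorem IsoClass.mk_mul_mk (M N : GeneratedCategory B) :
    IsoClass.mk M * IsoClass.mk N = IsoClass.mk (M.tensor N) := rfl

variable (B)

/-- The subgroup of the free abelian group on isomorphism classes which is generated by the
elements `[M ⊕ N] - [M] - [N]`. -/
def splitRelations : AddSubgroup (FreeAbelianGroup (IsoClass B)) :=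
  AddSubgroup.closure {x | ∃ M N : GeneratedCategory B,
    x = FreeAbelianGroup.of (IsoClass.mk (M.sum N)) - FreeAbelianGroup.of (IsoClass.mk M) -
      FreeAbelianGroup.of (IsoClass.mk N)}

theorem splitRelations_mul_left (x y : FreeAbelianGroup (IsoClass B))
    (hy : y ∈ splitRelations B) : x * y ∈ splitRelations B := by
  induction x using FreeAbelianGroup.induction_on with
  | zero => rw [zero_mul]; exact zero_mem _
  | neg x hx => rw [neg_mul]; exact neg_mem hx
  | add x x' hx hx' => rw [add_mul]; exact add_mem hx hx'
  | of P =>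
    obtain ⟨P, rfl⟩ : ∃ Q, IsoClass.mk Q = P := Quotient.exists_rep P
    induction hy using AddSubgroup.closure_induction with
    | zero => rw [mul_zero]; exact zero_mem _
    | neg x _ hx => rw [mul_neg]; exact neg_mem hx
    | add x x' _ _ hx hx' => rw [mul_add]; exact add_mem hx hx'
    | mem x hx =>
      obtain ⟨M, N, rfl⟩ := hx
      refine AddSubgroup.subset_closure ⟨P.tensor M, P.tensor N, ?_⟩
      rw [mul_sub, mul_sub, FreeAbelianGroup.of_mul_of, FreeAbelianGroup.of_mul_of,
        FreeAbelianGroup.of_mul_of, IsoClass.mk_mul_mk, IsoClass.mk_mul_mk, IsoClass.mk_mul_mk,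
        IsoClass.mk_eq (M := P.tensor (M.sum N)) (N := (P.tensor M).sum (P.tensor N))
          (tensorSum P.obj M.obj N.obj)]

theorem splitRelations_mul_right (x y : FreeAbelianGroup (IsoClass B))
    (hx : x ∈ splitRelations B) : x * y ∈ splitRelations B := by
  induction y using FreeAbelianGroup.induction_on with
  | zero => rw [mul_zero]; exact zero_mem _
  | neg x hx => rw [mul_neg]; exact neg_mem hx
  | add x x' hx hx' => rw [mul_add]; exact add_mem hx hx'
  | of P =>
    obtain ⟨P, rfl⟩ : ∃ Q, IsoClass.mk Q = P := Quotient.exists_rep P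
    induction hx using AddSubgroup.closure_induction with
    | zero => rw [zero_mul]; exact zero_mem _
    | neg x _ hx => rw [neg_mul]; exact neg_mem hx
    | add x x' _ _ hx hx' => rw [add_mul]; exact add_mem hx hx'
    | mem x hx =>
      obtain ⟨M, N, rfl⟩ := hx
      refine AddSubgroup.subset_closure ⟨M.tensor P, N.tensor P, ?_⟩
      rw [sub_mul, sub_mul, FreeAbelianGroup.of_mul_of, FreeAbelianGroup.of_mul_of,
        FreeAbelianGroup.of_mul_of, IsoClass.mk_mul_mk, IsoClass.mk_mul_mk, IsoClass.mk_mul_mk,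
        IsoClass.mk_eq (M := (M.sum N).tensor P) (N := (M.tensor P).sum (N.tensor P))
          (sumTensor M.obj N.obj P.obj)]

/-- The ideal with underlying subgroup `splitRelations B`. -/
def splitIdeal : TwoSidedIdeal (FreeAbelianGroup (IsoClass B)) :=
  TwoSidedIdeal.mk' (splitRelations B : Set _) (zero_mem _) add_mem neg_mem
    (fun {x y} hy => splitRelations_mul_left B x y hy)
    (fun {x y} hx => splitRelations_mul_right B x y hx)

/-- The split Grothendieck ring of the category generated by the `B t`: the free abelian group on
the isomorphism classes of objects modulo the relations `[M ⊕ N] = [M] + [N]`, with the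
multiplication induced by the tensor product over `R`. -/
def SplitGrothendieckRing : Type (u + 1) := (splitIdeal B).ringCon.Quotient

instance : Ring (SplitGrothendieckRing B) := inferInstanceAs (Ring (splitIdeal B).ringCon.Quotient)

variable {B}

/-- The class `⟨M⟩` of an object in the split Grothendieck ring. -/
def SplitGrothendieckRing.cls (M : GeneratedCategory B) : SplitGrothendieckRing B :=
  (splitIdeal B).ringCon.mk' (FreeAbelianGroup.of (IsoClass.mk M))

theorem SplitGrothendieckRing.cls_eq {M N : GeneratedCategory B} (e : M.obj ≅ N.obj) :
    cls M = cls N := by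
  rw [cls, cls, IsoClass.mk_eq e]

theorem SplitGrothendieckRing.cls_mul (M N : GeneratedCategory B) :
    cls M * cls N = cls (M.tensor N) := by
  refine ((splitIdeal B).ringCon.mk'.map_mul _ _).symm.trans ?_
  rw [FreeAbelianGroup.of_mul_of, IsoClass.mk_mul_mk, cls]

theorem SplitGrothendieckRing.cls_unit :
    cls (⟨unit 𝒜, generated_unit B⟩ : GeneratedCategory B) = 1 :=
  map_one (splitIdeal B).ringCon.mk'

theorem SplitGrothendieckRing.cls_sum (M N : GeneratedCategory B) :
    cls (M.sum N) = cls M + cls N := by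
  refine Eq.trans ?_ ((splitIdeal B).ringCon.mk'.map_add _ _)
  refine (RingCon.eq _).2 ?_
  rw [TwoSidedIdeal.rel_iff, splitIdeal, TwoSidedIdeal.mem_mk', ← sub_sub]
  exact AddSubgroup.subset_closure ⟨M, N, rfl⟩

theorem SplitGrothendieckRing.induction {p : SplitGrothendieckRing B → Prop} (h0 : p 0)
    (hadd : ∀ x y, p x → p y → p (x + y)) (hneg : ∀ x, p x → p (-x)) (hc : ∀ M, p (cls M)) (x) :
    p x := by
  obtain ⟨x, rfl⟩ := RingCon.mk'_surjective (c := (splitIdeal B).ringCon) x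
  induction x using FreeAbelianGroup.induction_on with
  | zero => exact (map_zero (splitIdeal B).ringCon.mk').symm ▸ h0
  | neg x hx => exact (map_neg (splitIdeal B).ringCon.mk' _).symm ▸ hneg _ hx
  | add x x' hx hx' => exact (map_add (splitIdeal B).ringCon.mk' _ _).symm ▸ hadd _ _ hx hx'
  | of P =>
    obtain ⟨P, rfl⟩ : ∃ Q, IsoClass.mk Q = P := Quotient.exists_rep P
    exact hc P

theorem SplitGrothendieckRing.unitShift_mul (n : ℤ) (M : GeneratedCategory B) :
    cls (GeneratedCategory.unitShift B n) * cls M = cls (M.shift n) := by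
  rw [cls_mul]
  exact cls_eq (shiftTensor (unit 𝒜) M.obj n ≪≫ shiftIso (unitTensor M.obj) n)

theorem SplitGrothendieckRing.mul_unitShift (n : ℤ) (M : GeneratedCategory B) :
    cls M * cls (GeneratedCategory.unitShift B n) = cls (M.shift n) := by
  rw [cls_mul]
  exact cls_eq (tensorShift M.obj (unit 𝒜) n ≪≫ shiftIso (tensorUnit M.obj) n)

variable (B)

/-- The multiplicative map `vⁿ ↦ ⟨R(n)⟩`. -/
def SplitGrothendieckRing.shiftHom : Multiplicative ℤ →* SplitGrothendieckRing B where
  toFun n := cls (GeneratedCategory.unitShift B n.toAdd)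
  map_one' := (cls_eq (shiftZero (unit 𝒜))).trans cls_unit
  map_mul' m n := by
    rw [mul_unitShift]
    exact (cls_eq (shiftShift (unit 𝒜) _ _)).symm

/-- The ring homomorphism `ℤ[v, v⁻¹] → ⟨𝒞⟩`, `vⁿ ↦ ⟨R(n)⟩`. -/
def SplitGrothendieckRing.laurentHom : LaurentPolynomial ℤ →+* SplitGrothendieckRing B :=
  AddMonoidAlgebra.liftNCRingHom (Int.castRingHom _) (shiftHom B) fun _ _ => Int.cast_commute _ _

theorem SplitGrothendieckRing.laurentHom_T (n : ℤ) :
    laurentHom B (LaurentPolynomial.T n) = cls (GeneratedCategory.unitShift B n) := by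
  refine (AddMonoidAlgebra.liftNC_single _ _ _ _).trans ?_
  rw [AddMonoidHom.coe_coe, map_one, one_mul]
  rfl

/-- The split Grothendieck ring as an algebra over `ℤ[v, v⁻¹]`, where `v` is `T 1`; it acts by the
grading shift, see `v_smul_cls`. -/
instance : Algebra (LaurentPolynomial ℤ) (SplitGrothendieckRing B) :=
  (SplitGrothendieckRing.laurentHom B).toAlgebra' fun c x => by
    induction c using LaurentPolynomial.induction_on' with
    | add p q hp hq => rw [map_add, add_mul, mul_add, hp, hq]
    | C_mul_T n a =>
      have h1 : SplitGrothendieckRing.laurentHom B (LaurentPolynomial.C a) = (a : ℤ) := by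
        simp
      rw [map_mul, h1, SplitGrothendieckRing.laurentHom_T, mul_assoc, ← mul_assoc x,
        ← Int.cast_comm a x, mul_assoc]
      congr 1
      induction x using SplitGrothendieckRing.induction with
      | h0 => simp
      | hadd x y hx hy => rw [mul_add, add_mul, hx, hy]
      | hneg x hx => rw [mul_neg, neg_mul, hx]
      | hc M => rw [SplitGrothendieckRing.unitShift_mul, SplitGrothendieckRing.mul_unitShift]

variable {B}

theorem SplitGrothendieckRing.v_smul_cls (n : ℤ) (M : GeneratedCategory B) :
    (LaurentPolynomial.T n : LaurentPolynomial ℤ) • cls M = cls (M.shift n) := by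
  rw [Algebra.smul_def, ← unitShift_mul]
  exact congrArg (· * cls M) (laurentHom_T B n)

end Grothendieck
end GradedBimodule
end

noncomputable section

/-! ### Polynomial functions on a representation -/

section Polynomials

variable (U : Type u) [AddCommGroup U] [Module ℝ U]

/-- The grading of the symmetric algebra `S(U)` with `deg U = 2`: the part of degree `i` is
`U ^ k` if `i = 2 k` for a natural number `k`, and zero if there is no such `k`. -/
def symGrading (i : ℤ) : Submodule ℝ (SymmetricAlgebra ℝ U) :=
  ⨆ (k : ℕ) (_ : 2 * (k : ℤ) = i), LinearMap.range (SymmetricAlgebra.ι ℝ U) ^ k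

theorem range_pow_le_symGrading (k : ℕ) :
    LinearMap.range (SymmetricAlgebra.ι ℝ U) ^ k ≤ symGrading U (2 * (k : ℤ)) :=
  le_iSup₂_of_le (f := fun (l : ℕ) (_ : 2 * (l : ℤ) = 2 * (k : ℤ)) =>
    LinearMap.range (SymmetricAlgebra.ι ℝ U) ^ l) k rfl le_rfl

theorem symGrading_mul_le (i j : ℤ) :
    symGrading U i * symGrading U j ≤ symGrading U (i + j) := by
  simp only [symGrading, Submodule.iSup_mul, Submodule.mul_iSup]
  refine iSup_le fun k => iSup_le fun hk => iSup_le fun l => iSup_le fun hl => ?_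
  rw [← pow_add]
  exact le_iSup₂_of_le (f := fun (l : ℕ) (_ : 2 * (l : ℤ) = i + j) =>
    LinearMap.range (SymmetricAlgebra.ι ℝ U) ^ l) _ (by push_cast; lia) le_rfl

theorem symGrading_isInternal : DirectSum.IsInternal (symGrading U) := by
  let D : SymmetricAlgebra ℝ U →ₐ[ℝ] AddMonoidAlgebra (SymmetricAlgebra ℝ U) ℤ :=
    SymmetricAlgebra.lift
      { toFun := fun x => AddMonoidAlgebra.single 2 (SymmetricAlgebra.ι ℝ U x)
        map_add' := fun x y => by rw [map_add, AddMonoidAlgebra.single_add]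
        map_smul' := fun r x => by
          rw [map_smul, RingHom.id_apply, AddMonoidAlgebra.smul_single] }
  have hD : ∀ (k : ℕ) (x), x ∈ LinearMap.range (SymmetricAlgebra.ι ℝ U) ^ k →
      D x = AddMonoidAlgebra.single (2 * (k : ℤ)) x := by
    intro k x hx
    induction hx using Submodule.pow_induction_on_left' with
    | algebraMap r =>
      rw [AlgHom.commutes]
      rfl
    | add x y i hx hy ihx ihy => rw [map_add, ihx, ihy, AddMonoidAlgebra.single_add]
    | mem_mul m hm i x hx ih =>
      obtain ⟨m, rfl⟩ := hm
      rw [map_mul, ih, SymmetricAlgebra.lift_ι_apply]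
      refine (AddMonoidAlgebra.single_mul_single _ _ _ _).trans ?_
      congr 1
      push_cast
      ring
  refine isInternal_of_components _ ?_
    ((AddMonoidAlgebra.coeffLinearEquiv ℝ).toLinearMap ∘ₗ D.toLinearMap) ?_
  · rw [eq_top_iff]
    rintro x -
    have hclosed : ∀ x y, x ∈ ⨆ i, symGrading U i → y ∈ ⨆ i, symGrading U i →
        x * y ∈ ⨆ i, symGrading U i := by
      intro x y hx hy
      have h := Submodule.mul_mem_mul hx hy
      rw [Submodule.iSup_mul] at h
      simp only [Submodule.mul_iSup] at h
      refine (iSup_le fun i => iSup_le fun j => ?_ :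
        (⨆ i, ⨆ j, symGrading U i * symGrading U j) ≤ ⨆ i, symGrading U i) h
      exact (symGrading_mul_le U i j).trans (le_iSup (symGrading U) (i + j))
    induction x using SymmetricAlgebra.induction with
    | algebraMap r =>
      refine Submodule.mem_iSup_of_mem _ (range_pow_le_symGrading U 0 ?_)
      rw [pow_zero]
      exact Submodule.algebraMap_mem r
    | ι x =>
      refine Submodule.mem_iSup_of_mem _ (range_pow_le_symGrading U 1 ?_)
      rw [pow_one]
      exact LinearMap.mem_range_self _ x
    | mul a b ha hb => exact hclosed a b ha hb
    | add a b ha hb => exact Submodule.add_mem _ ha hb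
  · intro i x hx
    have hle : symGrading U i ≤ LinearMap.ker
        (((AddMonoidAlgebra.coeffLinearEquiv ℝ).toLinearMap ∘ₗ D.toLinearMap) -
          Finsupp.lsingle i) := by
      refine iSup_le fun k => iSup_le fun hk => ?_
      subst hk
      intro y hy
      rw [LinearMap.mem_ker, LinearMap.sub_apply, sub_eq_zero]
      exact congrArg AddMonoidAlgebra.coeff (hD k y hy)
    simpa [sub_eq_zero] using hle hx

instance symGrading_gradedAlgebra : GradedAlgebra (symGrading U) :=
  { (symGrading_isInternal U).chooseDecomposition with
    one_mem := by
      refine range_pow_le_symGrading U 0 ?_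
      rw [pow_zero]
      exact Submodule.one_le.1 le_rfl
    mul_mem := fun i j _ _ hx hy => symGrading_mul_le U i j (Submodule.mul_mem_mul hx hy) }

variable {U}

theorem symMap_mem (f : U →ₗ[ℝ] U) {i : ℤ} {x : SymmetricAlgebra ℝ U} (hx : x ∈ symGrading U i) :
    SymmetricAlgebra.lift (SymmetricAlgebra.ι ℝ U ∘ₗ f) x ∈ symGrading U i := by
  set F := SymmetricAlgebra.lift (SymmetricAlgebra.ι ℝ U ∘ₗ f) with hF
  have hle : symGrading U i ≤ (symGrading U i).comap F.toLinearMap := by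
    refine iSup_le fun k => iSup_le fun hk => ?_
    subst hk
    rw [← Submodule.map_le_iff_le_comap, Submodule.map_pow]
    refine le_trans (pow_le_pow_left' ?_ k) (range_pow_le_symGrading U k)
    rintro _ ⟨_, ⟨y, rfl⟩, rfl⟩
    exact ⟨f y, (SymmetricAlgebra.lift_ι_apply (SymmetricAlgebra.ι ℝ U ∘ₗ f) y).symm⟩
  exact hle hx

end Polynomials

section Soergel

variable {W : Type*} [Group W] {V : Type u} [AddCommGroup V] [Module ℝ V]

/-- The ring `R = S(V*)` of polynomial functions on `V`. -/
abbrev PolyFun (V : Type u) [AddCommGroup V] [Module ℝ V] : Type u :=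
  SymmetricAlgebra ℝ (Module.Dual ℝ V)

/-- The grading of `R = S(V*)` with `deg V* = 2`. -/
abbrev polyGrading (V : Type u) [AddCommGroup V] [Module ℝ V] : ℤ → Submodule ℝ (PolyFun V) :=
  symGrading (Module.Dual ℝ V)

/-- The action of `w ∈ W` on `R = S(V*)` by algebra automorphisms, induced by the dual
representation. -/
def polyAction (ρ : Representation ℝ W V) (w : W) : PolyFun V →ₐ[ℝ] PolyFun V :=
  SymmetricAlgebra.lift (SymmetricAlgebra.ι ℝ (Module.Dual ℝ V) ∘ₗ ρ.dual w)

/-- The ring `R^w` of `w`-invariant polynomial functions. -/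
def invariantRing (ρ : Representation ℝ W V) (w : W) : Subalgebra ℝ (PolyFun V) :=
  AlgHom.equalizer (polyAction ρ w) (AlgHom.id ℝ (PolyFun V))

theorem invariantRing_isGraded (ρ : Representation ℝ W V) (w : W) :
    GradedBimodule.IsGradedSubalgebra (polyGrading V) (invariantRing ρ w) := by
  intro a ha i
  have hcomm : ∀ b : PolyFun V, (DirectSum.decompose (polyGrading V) (polyAction ρ w b) i :
      PolyFun V) = polyAction ρ w (DirectSum.decompose (polyGrading V) b i : PolyFun V) := by
    intro b
    induction b using DirectSum.Decomposition.inductionOn (polyGrading V) with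
    | zero => simp
    | @homogeneous j m =>
      have hm : polyAction ρ w (m : PolyFun V) ∈ polyGrading V j := symMap_mem _ m.2
      by_cases hij : j = i
      · subst hij
        rw [DirectSum.decompose_of_mem_same _ hm, DirectSum.decompose_of_mem_same _ m.2]
      · rw [DirectSum.decompose_of_mem_ne _ hm hij, DirectSum.decompose_of_mem_ne _ m.2 hij,
          map_zero]
    | add x y hx hy => simp [hx, hy]
  have ha' : polyAction ρ w a = a := ha
  change polyAction ρ w _ = _
  rw [AlgHom.id_apply, ← hcomm, ha']

/-- The graded bimodule `B_t = R ⊗_{R^t} R (1)`. -/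
def soergelBimodule (ρ : Representation ℝ W V) (t : W) : GradedBimodule (polyGrading V) :=
  (GradedBimodule.tensorOver (invariantRing ρ t) (GradedBimodule.unit (polyGrading V))
    (GradedBimodule.unit (polyGrading V)) (invariantRing_isGraded ρ t)).shift 1

variable {I : Type*} {M : CoxeterMatrix I}

/-- The family of the `B_t`, where `t` runs through the set `T` of all reflections of `(W, S)`. -/
def reflectionBimodules (cs : CoxeterSystem M W) (ρ : Representation ℝ W V) :
    {t : W // cs.IsReflection t} → GradedBimodule (polyGrading V) :=
  fun t => soergelBimodule ρ t

/-- A representation of a Coxeter system is reflection faithful if it is faithful and the elements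
whose fixed subspace has codimension one are exactly the reflections. (The representation is also
required to be finite-dimensional, which is a separate hypothesis in what follows.) -/
structure IsReflectionFaithful (cs : CoxeterSystem M W) (ρ : Representation ℝ W V) : Prop where
  faithful : Function.Injective ρ
  codim_one_iff : ∀ w : W, Module.finrank ℝ (V ⧸ LinearMap.ker (ρ w - LinearMap.id)) = 1 ↔
    cs.IsReflection w

/-- The category `𝒞`: the Karoubi envelope of the category of shifted tensor products of the
`B_t`, `t ∈ T`. -/
abbrev ReflectionCategory (cs : CoxeterSystem M W) (ρ : Representation ℝ W V) :=
  GradedBimodule.GeneratedCategory (reflectionBimodules cs ρ)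

/-- The object `B_t` of `𝒞`. -/
def ReflectionCategory.of (cs : CoxeterSystem M W) (ρ : Representation ℝ W V)
    (t : {t : W // cs.IsReflection t}) : ReflectionCategory cs ρ :=
  ⟨reflectionBimodules cs ρ t, GradedBimodule.generated_of _ t⟩

/-- The algebra `A(W) = ⟨𝒞⟩` over `ℤ[v, v⁻¹]`. -/
abbrev ReflectionAlgebra (cs : CoxeterSystem M W) (ρ : Representation ℝ W V) :=
  GradedBimodule.SplitGrothendieckRing (reflectionBimodules cs ρ)

end Soergel

/-! ### Presented algebras -/

section Presentations

open LaurentPolynomial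

/-- The defining relations, between the free generators `C_0, C_1, C_2` over `ℤ[v, v⁻¹]`, where
`v` is `T 1`. -/
inductive A2Relation :
    FreeAlgebra (LaurentPolynomial ℤ) (Fin 3) → FreeAlgebra (LaurentPolynomial ℤ) (Fin 3) → Prop
  | quadratic (i : Fin 3) :
      A2Relation (FreeAlgebra.ι _ i ^ 2)
        ((T 1 + T (-1) : LaurentPolynomial ℤ) • FreeAlgebra.ι _ i)
  | braid (i j : Fin 3) (hij : i ≠ j) :
      A2Relation
        (FreeAlgebra.ι _ i * FreeAlgebra.ι _ j * FreeAlgebra.ι _ i + FreeAlgebra.ι _ j)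
        (FreeAlgebra.ι _ i + FreeAlgebra.ι _ j * FreeAlgebra.ι _ i * FreeAlgebra.ι _ j)
  | three (i j k : Fin 3) (hij : i ≠ j) (hik : i ≠ k) (hjk : j ≠ k) :
      A2Relation
        (FreeAlgebra.ι _ i * FreeAlgebra.ι _ j * FreeAlgebra.ι _ i)
        (FreeAlgebra.ι _ i * FreeAlgebra.ι _ k * FreeAlgebra.ι _ i)
  | four (i j k : Fin 3) (hij : i ≠ j) (hik : i ≠ k) (hjk : j ≠ k) :
      A2Relation
        (FreeAlgebra.ι _ i * FreeAlgebra.ι _ j * FreeAlgebra.ι _ k * FreeAlgebra.ι _ i)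
        (FreeAlgebra.ι _ i * FreeAlgebra.ι _ k * FreeAlgebra.ι _ j * FreeAlgebra.ι _ i)

/-- The `ℤ[v, v⁻¹]`-algebra with generators `C_0, C_1, C_2` and the relations `A2Relation`. -/
abbrev A2Algebra : Type := RingQuot A2Relation

/-- The generator `C_i`. -/
def A2Algebra.gen (i : Fin 3) : A2Algebra :=
  RingQuot.mkAlgHom (LaurentPolynomial ℤ) A2Relation (FreeAlgebra.ι _ i)

/-- The defining relations of the Iwahori–Hecke algebra of a Coxeter matrix `M`, between the
standard generators `H_i` (normalized so that `(H_i + v) (H_i - v⁻¹) = 0`): the quadratic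
relations, and for `M i j` finite (that is, nonzero in the encoding of Coxeter matrices) the braid
relations `H_i H_j H_i ⋯ = H_j H_i H_j ⋯` with `M i j` factors on both sides. -/
inductive HeckeRelation {I : Type} (M : CoxeterMatrix I) :
    FreeAlgebra (LaurentPolynomial ℤ) I → FreeAlgebra (LaurentPolynomial ℤ) I → Prop
  | quadratic (i : I) :
      HeckeRelation M (FreeAlgebra.ι _ i ^ 2)
        (1 + (T (-1) - T 1 : LaurentPolynomial ℤ) • FreeAlgebra.ι _ i)
  | braid (i j : I) (hM : M i j ≠ 0) :
      HeckeRelation M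
        (((CoxeterSystem.alternatingWord i j (M i j)).map (FreeAlgebra.ι _)).prod)
        (((CoxeterSystem.alternatingWord j i (M i j)).map (FreeAlgebra.ι _)).prod)

/-- The Iwahori–Hecke algebra over `ℤ[v, v⁻¹]` of the Coxeter group with Coxeter matrix `M`. -/
abbrev HeckeAlgebra {I : Type} (M : CoxeterMatrix I) : Type := RingQuot (HeckeRelation M)

/-- The standard generator `H_i` of the Hecke algebra. -/
def HeckeAlgebra.gen {I : Type} (M : CoxeterMatrix I) (i : I) : HeckeAlgebra M :=
  RingQuot.mkAlgHom (LaurentPolynomial ℤ) (HeckeRelation M) (FreeAlgebra.ι _ i)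

/-- The Kazhdan–Lusztig generator `C'_i = H_i + v` of the Hecke algebra. -/
def HeckeAlgebra.klGen {I : Type} (M : CoxeterMatrix I) (i : I) : HeckeAlgebra M :=
  HeckeAlgebra.gen M i + algebraMap (LaurentPolynomial ℤ) (HeckeAlgebra M) (T 1)

/-- The Coxeter matrix of affine type `Ã₂`: the Coxeter graph is a triangle with unlabelled
edges. -/
def affineA2 : CoxeterMatrix (Fin 3) where
  M := Matrix.of fun i j => if i = j then 1 else 3
  isSymm := by
    ext i j
    simp [Matrix.transpose_apply, eq_comm]
  diagonal i := by simp
  off_diagonal i j h := by simp [h]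

end Presentations

end

/-! For a subset `S` of `W` let `R(S)` be the quotient of `R ⊗_ℝ R` by the elements which the maps
`a ⊗ b ↦ a w(b)`, `w ∈ S`, all send to zero; it consists of the functions on the union of the graphs
of the elements of `S` (`graphs`). As a bimodule it is generated by the constant function one, which
spans its component of degree zero. Hence the endomorphisms of `R(S)` are scalars
(`isScalarEnd_graphs`), and direct summands of sums of shifts of such bimodules are again of this
kind (`exists_sublist_of_retract`).

The key is the decomposition `B_t ⊗ R(S) ≅ R(S ∪ tS)(1) ⊕ R(S ∩ tS)(-1)` (`tensor_graphs`). It needs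
a form `y` of degree two such that `w(y) = α - p` for all `w ∈ S` outside `tS`, where `α` is the
root of `t` and `p` is `t`-invariant: then `α - p - y`, with `y` acting from the right, is an
element which vanishes on `S \ tS` and serves as the second generator, next to the constant one.

In type `A₂` put `T_ij = {w | w t_j = t_i w}`, a set with two elements. For fixed `j` the three sets
`T_ij` partition `W`, and left multiplication by `t_k` preserves `T_kj` and exchanges the other two.
If `S \ t_k S` lies in one `T_mj` with `m ≠ k`, then `y` exists: two distinct reflections have
independent root vectors, which follows from faithfulness and from the order three of their product
(`IsReflectionBy.exists_form`). Starting with `R = R({1})` one meets only twenty sets, namely `{1}`,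
the `T_ij`, their complements and `W`. With suitable shifts call their bimodules `1`, `c_ij`,
`z_ij`, `x`. For `i ≠ k` the table reads `C_k c_ij = z_kj` and `C_k z_ij = x + c_kj`, further `C_k 1
= c_kk`, and `C_k` multiplies `c_kj`, `z_kj` and `x` by `v + v⁻¹`.

Consequently the twenty classes span `A(W)`. They are linearly independent: the dimension of the
space of morphisms from a shift of `R(S)` is an additive invariant, and these invariants are
triangular on the shifts of the twenty bimodules. On the algebraic side, the four relations allow
one to write down twenty elements of the presented algebra with the same table
(`A2Relations.table`). Their span contains one and is stable under left multiplication by the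
generators, so it is everything; the table determines the family and implies the relations. So the
presented algebra maps to `A(W)`, a spanning family going to a basis, and the map is bijective.
Finally `C_i - v` satisfies the Hecke relations, the braid relation being relation 2. -/

noncomputable section

namespace GradedBimodule

/-! ### Homogeneous components, quotients, and Krull–Schmidt decompositions -/

section Components

variable {R : Type u} [CommRing R] [Algebra ℝ R] {𝒜 : ℤ → Submodule ℝ R}

/-- The projection to the homogeneous component of degree `i`. -/
def proj (M : GradedBimodule 𝒜) (i : ℤ) : M.carrier →ₗ[ℝ] M.carrier :=
  Finsupp.lapply i ∘ₗ (exists_components M.gr M.isInternal).choose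

theorem proj_of_mem (M : GradedBimodule 𝒜) {i : ℤ} {m : M.carrier} (hm : m ∈ M.gr i) (j : ℤ) :
    M.proj j m = if i = j then m else 0 := by
  simp [proj, (exists_components M.gr M.isInternal).choose_spec i m hm, Finsupp.single_apply]

theorem proj_same (M : GradedBimodule 𝒜) {i : ℤ} {m : M.carrier} (hm : m ∈ M.gr i) :
    M.proj i m = m := by simp [M.proj_of_mem hm]

theorem proj_mem (M : GradedBimodule 𝒜) (i : ℤ) (m : M.carrier) : M.proj i m ∈ M.gr i := by
  induction m using isInternal_induction M.isInternal with
  | h0 => simp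
  | hadd x y hx hy => rw [map_add]; exact add_mem hx hy
  | hom j m hm =>
    rw [M.proj_of_mem hm]
    split_ifs with h
    · exact h ▸ hm
    · exact zero_mem _

/-- A linear map which preserves degrees commutes with the projections to the components. -/
theorem map_proj {M N : GradedBimodule 𝒜} (f : M.carrier →ₗ[ℝ] N.carrier)
    (hf : ∀ i m, m ∈ M.gr i → f m ∈ N.gr i) (i : ℤ) (m : M.carrier) :
    f (M.proj i m) = N.proj i (f m) := by
  induction m using isInternal_induction M.isInternal with
  | h0 => simp
  | hadd x y hx hy => simp only [map_add, hx, hy]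
  | hom j m hm =>
    rw [M.proj_of_mem hm, N.proj_of_mem (hf j m hm)]
    split_ifs <;> simp

/-- A bijective morphism of graded bimodules is an isomorphism. -/
def isoOfBijective {M N : GradedBimodule 𝒜} (f : M ⟶ N)
    (h : Function.Bijective (Hom.toLin f)) : M ≅ N :=
  isoOfEq (LinearEquiv.ofBijective (Hom.toLin f) h) (Hom.map_lact f) (Hom.map_ract f)
    (fun _ _ hm => Hom.map_gr f hm)
    (fun i n hn => by
      set m := (LinearEquiv.ofBijective (Hom.toLin f) h).symm n with hm
      have hfm : Hom.toLin f m = n :=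
        (LinearEquiv.ofBijective (Hom.toLin f) h).apply_symm_apply n
      -- The preimage of a homogeneous element is homogeneous: `m` and its component of degree `i`
      -- have the same image, and the map is injective.
      have : M.proj i m = m := h.1 (by
        rw [map_proj _ (fun i m hm => Hom.map_gr f hm), hfm, N.proj_same hn])
      exact this ▸ M.proj_mem i m)

/-- The quotient of a graded bimodule by a graded sub-bimodule. -/
abbrev quot (M : GradedBimodule 𝒜) (K : Submodule ℝ M.carrier)
    (hl : ∀ a, ∀ m ∈ K, M.lact a m ∈ K) (hr : ∀ a, ∀ m ∈ K, M.ract a m ∈ K)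
    (hg : ∀ i, ∀ m ∈ K, M.proj i m ∈ K) : GradedBimodule 𝒜 where
  carrier := M.carrier ⧸ K
  lact :=
    { toFun := fun a => K.mapQ K (M.lact a) (hl a)
      map_one' := by ext; simp
      map_mul' := fun a b => by ext; simp
      map_zero' := by ext; simp
      map_add' := fun a b => by ext; simp
      commutes' := fun r => by ext; simp }
  ract :=
    { toFun := fun a => K.mapQ K (M.ract a) (hr a)
      map_one' := by ext; simp
      map_mul' := fun a b => by ext; simp
      map_zero' := by ext; simp
      map_add' := fun a b => by ext; simp
      commutes' := fun r => by ext; simp }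
  act_comm a b m := by
    obtain ⟨m, rfl⟩ := K.mkQ_surjective m
    exact congrArg K.mkQ (M.act_comm a b m)
  gr i := (M.gr i).map K.mkQ
  isInternal := by
    let D := (exists_components M.gr M.isInternal).choose
    have hD := (exists_components M.gr M.isInternal).choose_spec
    refine isInternal_of_components _ ?_
      (K.liftQ (Finsupp.mapRange.linearMap K.mkQ ∘ₗ D) ?_) ?_
    · rw [← Submodule.map_iSup, M.isInternal.submodule_iSup_eq_top, Submodule.map_top,
        Submodule.range_mkQ]
    · intro m hm
      rw [LinearMap.mem_ker]
      ext i
      exact (Submodule.Quotient.mk_eq_zero _).2 (hg i m hm)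
    · rintro i _ ⟨m, hm, rfl⟩
      refine (K.liftQ_apply _ m).trans ?_
      rw [LinearMap.comp_apply, hD i m hm]
      simp
  lact_mem := by
    rintro i j a _ ha ⟨m, hm, rfl⟩
    exact ⟨_, M.lact_mem ha hm, rfl⟩
  ract_mem := by
    rintro i j a _ ha ⟨m, hm, rfl⟩
    exact ⟨_, M.ract_mem ha hm, rfl⟩

/-- Linear combinations of morphisms. -/
def linComb {M N : GradedBimodule 𝒜} (a b : ℝ) (f g : M ⟶ N) : M ⟶ N :=
  Hom.mk (a • Hom.toLin f + b • Hom.toLin g)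
    (fun c m => by simp [Hom.map_lact f, Hom.map_lact g])
    (fun c m => by simp [Hom.map_ract f, Hom.map_ract g])
    (fun h => add_mem (Submodule.smul_mem _ _ (Hom.map_gr f h))
      (Submodule.smul_mem _ _ (Hom.map_gr g h)))

@[simp]
theorem linComb_apply {M N : GradedBimodule 𝒜} (a b : ℝ) (f g : M ⟶ N) (m : M.carrier) :
    Hom.toLin (linComb a b f g) m = a • Hom.toLin f m + b • Hom.toLin g m := rfl

theorem comp_apply {M N P : GradedBimodule 𝒜} (f : M ⟶ N) (g : N ⟶ P) (m : M.carrier) :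
    Hom.toLin (f ≫ g) m = Hom.toLin g (Hom.toLin f m) := rfl

theorem retract_apply {M N : GradedBimodule 𝒜} (e : Retract M N) (m : M.carrier) :
    Hom.toLin e.r (Hom.toLin e.i m) = m := by
  rw [← comp_apply, e.retract]; rfl

/-- All endomorphisms are scalars. -/
def IsScalarEnd (E : GradedBimodule 𝒜) : Prop :=
  ∀ f : E ⟶ E, ∃ c : ℝ, ∀ m, Hom.toLin f m = c • m

/-- If all endomorphisms of `E` are scalars, then a summand of `E ⊕ S` is a summand of `S`, or the
sum of `E` and a summand of `S`. -/
theorem retract_sum_cases [GradedAlgebra 𝒜] {M E S : GradedBimodule 𝒜} (hE : E.IsScalarEnd)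
    (e : Retract M (E.sum S)) :
    Nonempty (Retract M S) ∨
      ∃ M' : GradedBimodule 𝒜, Nonempty (Retract M' S) ∧ Nonempty (M ≅ E.sum M') := by
  obtain ⟨i₁, hi₁⟩ : ∃ i : M ⟶ E, i = e.i ≫ sumFst E S := ⟨_, rfl⟩
  obtain ⟨r₁, hr₁⟩ : ∃ r : E ⟶ M, r = sumInl E S ≫ e.r := ⟨_, rfl⟩
  obtain ⟨c, hc⟩ := hE (r₁ ≫ i₁)
  simp only [comp_apply] at hc
  have hsplit : ∀ m, Hom.toLin (sumInr E S ≫ e.r) (Hom.toLin (e.i ≫ sumSnd E S) m) =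
      m - Hom.toLin r₁ (Hom.toLin i₁ m) := by
    intro m
    rw [eq_sub_iff_add_eq]
    simp only [hi₁, hr₁, comp_apply]
    rw [← map_add]
    refine Eq.trans (congrArg (Hom.toLin e.r) ?_) (retract_apply e m)
    exact Prod.ext (zero_add _) (add_zero _)
  by_cases h0 : c = 0
  · left
    subst h0
    -- Let `N` be the composite `M → E → M`. Then `N² = c N = 0`, and passing through `S` gives `1 -
    -- N`; composing with its inverse `1 + N` yields a retraction.
    refine ⟨⟨e.i ≫ sumSnd E S, (sumInr E S ≫ e.r) ≫ linComb 1 1 (𝟙 M) (i₁ ≫ r₁), ?_⟩⟩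
    ext m
    rw [comp_apply, comp_apply, hsplit, linComb_apply, comp_apply]
    simp [hc]
  · right
    -- The map `c⁻¹ • (i₁ ≫ r₁)` is idempotent and its image is a copy of `E`; `π` is the
    -- complementary idempotent.
    set π := linComb 1 (-c⁻¹) (𝟙 M) (i₁ ≫ r₁) with hπ
    have hπa : ∀ m, Hom.toLin π m = m - c⁻¹ • Hom.toLin r₁ (Hom.toLin i₁ m) := by
      intro m
      rw [hπ, linComb_apply, comp_apply, one_smul, neg_smul, sub_eq_add_neg]
      rfl
    have hππ : ∀ m, Hom.toLin π (Hom.toLin π m) = Hom.toLin π m := by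
      intro m
      simp [hπa, hc, smul_smul, h0]
    let K := LinearMap.ker (Hom.toLin π)
    -- The quotient by the kernel of `π` stands for the image of `π`, the complement of `E` in `M`.
    let M' := M.quot K
      (fun a m hm => by
        rw [LinearMap.mem_ker] at hm ⊢; rw [Hom.map_lact π, hm, map_zero])
      (fun a m hm => by
        rw [LinearMap.mem_ker] at hm ⊢; rw [Hom.map_ract π, hm, map_zero])
      (fun i m hm => by
        rw [LinearMap.mem_ker] at hm ⊢
        rw [map_proj _ (fun i m hm => Hom.map_gr π hm), hm, map_zero])
    let j : M' ⟶ M := Hom.mk (M := M') (K.liftQ (Hom.toLin π) le_rfl)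
      (fun a m => by
        obtain ⟨m, rfl⟩ := K.mkQ_surjective m
        exact Hom.map_lact π a m)
      (fun a m => by
        obtain ⟨m, rfl⟩ := K.mkQ_surjective m
        exact Hom.map_ract π a m)
      (by
        rintro i _ ⟨m, hm, rfl⟩
        exact Hom.map_gr π hm)
    let q : M ⟶ M' := Hom.mk (N := M') K.mkQ (fun _ _ => rfl) (fun _ _ => rfl)
      (fun hm => Submodule.mem_map_of_mem hm)
    have hj : ∀ m, Hom.toLin j (Hom.toLin q m) = Hom.toLin π m := fun m => rfl
    have hq : ∀ m, Hom.toLin q (Hom.toLin π m) = Hom.toLin q m := by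
      intro m
      refine (Submodule.Quotient.eq K).2 ?_
      rw [LinearMap.mem_ker, map_sub, hππ, sub_self]
    have hi₁π : ∀ m, Hom.toLin i₁ (Hom.toLin π m) = 0 := by
      intro m
      simp [hπa, hc, smul_smul, h0]
    -- On the image of `π` the map `i₁` vanishes, so there the passage `M → S → M` is the identity;
    -- this makes `M'` a summand of `S`.
    refine ⟨M', ⟨⟨j ≫ e.i ≫ sumSnd E S, (sumInr E S ≫ e.r) ≫ q, ?_⟩⟩, ⟨?_⟩⟩
    · ext m
      obtain ⟨m, rfl⟩ := K.mkQ_surjective m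
      change Hom.toLin q (Hom.toLin (sumInr E S ≫ e.r) (Hom.toLin (e.i ≫ sumSnd E S)
        (Hom.toLin π m))) = Hom.toLin q m
      rw [hsplit, hi₁π, map_zero, sub_zero, hq]
    · refine isoSumOfBiproduct r₁ j (linComb c⁻¹ 0 i₁ i₁) q ?_ ?_ ?_ ?_ ?_
      · ext m
        rw [comp_apply, linComb_apply, hc]
        simp [smul_smul, h0]
      · ext m
        obtain ⟨m, rfl⟩ := K.mkQ_surjective m
        exact hq m
      · intro y
        refine (Submodule.Quotient.mk_eq_zero K).2 ?_
        rw [LinearMap.mem_ker, hπa, hc]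
        simp [smul_smul, h0]
      · intro z
        obtain ⟨m, rfl⟩ := K.mkQ_surjective z
        rw [linComb_apply]
        have := hi₁π m
        change c⁻¹ • Hom.toLin i₁ (Hom.toLin π m) + (0 : ℝ) • Hom.toLin i₁ (Hom.toLin π m) = 0
        rw [this, smul_zero, smul_zero, add_zero]
      · intro x
        rw [hj, hπa, linComb_apply]
        simp

/-- The direct sum of a list of graded bimodules. -/
def sumList : List (GradedBimodule 𝒜) → GradedBimodule 𝒜
  | [] => zero 𝒜
  | M :: L => M.sum (sumList L)

/-- Summands of a direct sum of graded bimodules with only scalar endomorphisms are direct sums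
of some of these. -/
theorem exists_sublist_of_retract [GradedAlgebra 𝒜] (L : List (GradedBimodule 𝒜))
    (hL : ∀ E ∈ L, E.IsScalarEnd) (M : GradedBimodule 𝒜) (e : Retract M (sumList L)) :
    ∃ L', L'.Sublist L ∧ Nonempty (M ≅ sumList L') := by
  induction L generalizing M with
  | nil =>
    refine ⟨[], List.Sublist.refl _, ⟨isoZero M fun m => ?_⟩⟩
    rw [← retract_apply e m]
    exact map_zero (Hom.toLin e.r)
  | cons E L ih =>
    have ih := ih fun E hE => hL E (List.mem_cons_of_mem _ hE)
    rcases retract_sum_cases (hL E List.mem_cons_self) e with ⟨⟨e'⟩⟩ | ⟨M', ⟨e'⟩, ⟨f⟩⟩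
    · obtain ⟨L', hL', h⟩ := ih M e'
      exact ⟨L', hL'.cons _, h⟩
    · obtain ⟨L', hL', ⟨g⟩⟩ := ih M' e'
      exact ⟨E :: L', hL'.cons_cons _, ⟨f ≪≫ sumIso (Iso.refl E) g⟩⟩

theorem sumListAppend (L L' : List (GradedBimodule 𝒜)) :
    Nonempty ((sumList L).sum (sumList L') ≅ sumList (L ++ L')) := by
  induction L with
  | nil => exact ⟨zeroSum _⟩
  | cons p L ih =>
    obtain ⟨e⟩ := ih
    exact ⟨sumAssoc _ _ _ ≪≫ sumIso (Iso.refl _) e⟩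

end Components

end GradedBimodule
end

noncomputable section

namespace GradedBimodule

/-! ### Functions on unions of graphs -/

section Graphs

variable {R : Type u} [CommRing R] [Algebra ℝ R] {𝒜 : ℤ → Submodule ℝ R}

/-- A linear map `M → R` which is left linear, and right semilinear with respect to `σ`. -/
structure Value (M : GradedBimodule 𝒜) (σ : R →ₐ[ℝ] R) where
  toLin : M.carrier →ₗ[ℝ] R
  map_lact : ∀ a m, toLin (M.lact a m) = a * toLin m
  map_ract : ∀ a m, toLin (M.ract a m) = σ a * toLin m

/-- An element in the middle contributes the factor `σ a` from either side: by semilinearity of `μ`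
on the right, or by left linearity of `ν` followed by `σ`. -/
theorem Value.tensor_balanced {M N : GradedBimodule 𝒜} {σ τ : R →ₐ[ℝ] R} (μ : Value M σ)
    (ν : Value N τ) : ∀ a ∈ (⊤ : Subalgebra ℝ R), ∀ m n,
      (LinearMap.mul ℝ R).compl₁₂ μ.toLin (σ.toLinearMap ∘ₗ ν.toLin) (M.ract a m) n =
        (LinearMap.mul ℝ R).compl₁₂ μ.toLin (σ.toLinearMap ∘ₗ ν.toLin) m (N.lact a n) := by
  intro a _ m n
  simp only [LinearMap.compl₁₂_apply, LinearMap.mul_apply', LinearMap.comp_apply,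
    AlgHom.toLinearMap_apply, μ.map_ract, ν.map_lact, map_mul]
  ring

variable [GradedAlgebra 𝒜]

theorem isGradedSubalgebra_bot : IsGradedSubalgebra 𝒜 (⊥ : Subalgebra ℝ R) := by
  intro a ha i
  obtain ⟨r, rfl⟩ := Algebra.mem_bot.1 ha
  have h : algebraMap ℝ R r ∈ 𝒜 0 := SetLike.algebraMap_mem_graded 𝒜 r
  by_cases hi : 0 = i
  · subst hi
    rw [DirectSum.decompose_of_mem_same _ h]
    exact ha
  · rw [DirectSum.decompose_of_mem_ne _ h hi]
    exact zero_mem _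

variable (𝒜) in
/-- The graded bimodule `R ⊗_ℝ R`. -/
abbrev base : GradedBimodule 𝒜 := tensorOver ⊥ (unit 𝒜) (unit 𝒜) isGradedSubalgebra_bot

variable (𝒜) in
/-- The map `a ⊗ b ↦ a σ(b)` from `R ⊗_A R`, where `σ` fixes `A`. -/
def evOver (A : Subalgebra ℝ R) (σ : R →ₐ[ℝ] R) (hσ : ∀ a ∈ A, σ a = a) :
    TensorCarrier A (unit 𝒜) (unit 𝒜) →ₗ[ℝ] R :=
  tensorLift (M := unit 𝒜) (N := unit 𝒜) A ((LinearMap.mul ℝ R).compl₂ σ.toLinearMap)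
    (fun a ha (m n : R) => by
      change (a * m) * σ n = m * σ (a * n)
      rw [map_mul, hσ a ha]
      ring)

theorem evOver_tmul (A : Subalgebra ℝ R) (σ : R →ₐ[ℝ] R) (hσ : ∀ a ∈ A, σ a = a) (a b : R) :
    evOver 𝒜 A σ hσ (tmul (M := unit 𝒜) (N := unit 𝒜) A a b) = a * σ b :=
  tensorLift_tmul (M := unit 𝒜) (N := unit 𝒜) A _ _ a b

/-- `evOver` as a value. -/
def evValue (A : Subalgebra ℝ R) (hA : IsGradedSubalgebra 𝒜 A) (σ : R →ₐ[ℝ] R)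
    (hσ : ∀ a ∈ A, σ a = a) : Value (tensorOver A (unit 𝒜) (unit 𝒜) hA) σ where
  toLin := evOver 𝒜 A σ hσ
  map_lact a m := by
    induction m using tensor_induction with
    | h0 => simp only [map_zero, mul_zero]
    | hadd x y hx hy => simp only [map_add, hx, hy, mul_add]
    | ht m n =>
      refine (congrArg _ (tensorLact_tmul A a m n)).trans ?_
      refine (evOver_tmul A σ hσ _ _).trans ?_
      rw [evOver_tmul]
      exact mul_assoc a m (σ n)
  map_ract a m := by
    induction m using tensor_induction with
    | h0 => simp only [map_zero, mul_zero]
    | hadd x y hx hy => simp only [map_add, hx, hy, mul_add]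
    | ht m n =>
      refine (congrArg _ (tensorRact_tmul A a m n)).trans ?_
      refine (evOver_tmul A σ hσ _ _).trans ?_
      rw [evOver_tmul]
      refine (congrArg (fun z => (m : R) * z) (map_mul σ a n)).trans ?_
      exact mul_left_comm m (σ a) (σ n)

theorem fix_bot (σ : R →ₐ[ℝ] R) : ∀ a ∈ (⊥ : Subalgebra ℝ R), σ a = a := by
  intro a ha
  obtain ⟨r, rfl⟩ := Algebra.mem_bot.1 ha
  exact σ.commutes r

variable (𝒜) in
/-- The map `a ⊗ b ↦ a σ(b)`. -/
abbrev ev (σ : R →ₐ[ℝ] R) : (base 𝒜).carrier →ₗ[ℝ] R := evOver 𝒜 ⊥ σ (fix_bot σ)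

theorem ev_lact (σ : R →ₐ[ℝ] R) (a : R) (ξ : (base 𝒜).carrier) :
    ev 𝒜 σ ((base 𝒜).lact a ξ) = a * ev 𝒜 σ ξ :=
  (evValue ⊥ isGradedSubalgebra_bot σ (fix_bot σ)).map_lact a ξ

theorem ev_ract (σ : R →ₐ[ℝ] R) (a : R) (ξ : (base 𝒜).carrier) :
    ev 𝒜 σ ((base 𝒜).ract a ξ) = σ a * ev 𝒜 σ ξ :=
  (evValue ⊥ isGradedSubalgebra_bot σ (fix_bot σ)).map_ract a ξ

/-- The action of `R ⊗_ℝ R` on a bimodule. -/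
def biact (M : GradedBimodule 𝒜) : (base 𝒜).carrier →ₗ[ℝ] Module.End ℝ M.carrier :=
  tensorLift (M := unit 𝒜) (N := unit 𝒜) ⊥
    ((LinearMap.mul ℝ (Module.End ℝ M.carrier)).compl₁₂ M.lact.toLinearMap M.ract.toLinearMap)
    (fun a ha (m n : R) => by
      obtain ⟨r, rfl⟩ := Algebra.mem_bot.1 ha
      change M.lact (algebraMap ℝ R r * m) * M.ract n = M.lact m * M.ract (algebraMap ℝ R r * n)
      rw [map_mul, map_mul, AlgHom.commutes, AlgHom.commutes, mul_assoc, ← mul_assoc (M.lact m),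
        ← Algebra.commutes r (M.lact m), mul_assoc])

variable (𝒜) in
/-- The pure tensor `a ⊗ b` in `R ⊗_ℝ R`. -/
abbrev bt (a b : R) : (base 𝒜).carrier := tmul (M := unit 𝒜) (N := unit 𝒜) ⊥ a b

theorem base_lact_bt (a b c : R) : (base 𝒜).lact a (bt 𝒜 b c) = bt 𝒜 (a * b) c :=
  tensorLact_tmul (M := unit 𝒜) (N := unit 𝒜) ⊥ a b c

theorem base_ract_bt (a b c : R) : (base 𝒜).ract a (bt 𝒜 b c) = bt 𝒜 b (a * c) :=
  tensorRact_tmul (M := unit 𝒜) (N := unit 𝒜) ⊥ a b c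

theorem biact_bt (M : GradedBimodule 𝒜) (a b : R) (m : M.carrier) :
    biact M (bt 𝒜 a b) m = M.lact a (M.ract b m) :=
  LinearMap.congr_fun (tensorLift_tmul (M := unit 𝒜) (N := unit 𝒜) ⊥ _ _ a b) m

theorem biact_lact (M : GradedBimodule 𝒜) (a : R) (ξ : (base 𝒜).carrier) (m : M.carrier) :
    biact M ((base 𝒜).lact a ξ) m = M.lact a (biact M ξ m) := by
  induction ξ using tensor_induction with
  | h0 => simp only [map_zero, LinearMap.zero_apply]
  | hadd x y hx hy => simp only [map_add, LinearMap.add_apply, hx, hy]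
  | ht b c =>
    refine (congrArg (fun z => biact M z m) (tensorLact_tmul ⊥ a b c)).trans ?_
    refine (biact_bt M _ _ m).trans ?_
    refine Eq.trans ?_ (congrArg (M.lact a) (biact_bt M b c m)).symm
    exact LinearMap.congr_fun (map_mul M.lact a b) _

theorem biact_ract (M : GradedBimodule 𝒜) (a : R) (ξ : (base 𝒜).carrier) (m : M.carrier) :
    biact M ((base 𝒜).ract a ξ) m = M.ract a (biact M ξ m) := by
  induction ξ using tensor_induction with
  | h0 => simp only [map_zero, LinearMap.zero_apply]
  | hadd x y hx hy => simp only [map_add, LinearMap.add_apply, hx, hy]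
  | ht b c =>
    refine (congrArg (fun z => biact M z m) (tensorRact_tmul ⊥ a b c)).trans ?_
    refine (biact_bt M _ _ m).trans ?_
    refine Eq.trans ?_ (congrArg (M.ract a) (biact_bt M b c m)).symm
    rw [← M.act_comm]
    exact congrArg (M.lact b) (LinearMap.congr_fun (map_mul M.ract a c) m)

theorem biact_mem (M : GradedBimodule 𝒜) {i d : ℤ} {ξ : (base 𝒜).carrier} {m : M.carrier}
    (hξ : ξ ∈ (base 𝒜).gr i) (hm : m ∈ M.gr d) : biact M ξ m ∈ M.gr (i + d) := by
  refine mem_of_tensorGr ⊥ ((biact M).flip m) i (M.gr (i + d)) ?_ hξ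
  rintro p q rfl a ha b hb
  refine (biact_bt M a b m).symm ▸ ?_
  rw [add_assoc]
  exact M.lact_mem ha (M.ract_mem hb hm)

/-- A value is a bimodule map to the copy of `R` whose right action is twisted by `σ`, and on this
copy `R ⊗_ℝ R` acts through `ev`. -/
theorem Value.map_biact {M : GradedBimodule 𝒜} {σ : R →ₐ[ℝ] R} (ν : Value M σ)
    (ξ : (base 𝒜).carrier) (m : M.carrier) : ν.toLin (biact M ξ m) = ev 𝒜 σ ξ * ν.toLin m := by
  induction ξ using tensor_induction with
  | h0 => simp only [map_zero, LinearMap.zero_apply, zero_mul]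
  | hadd x y hx hy => simp only [map_add, LinearMap.add_apply, hx, hy, add_mul]
  | ht b c =>
    refine (congrArg ν.toLin (biact_bt M b c m)).trans ?_
    rw [ν.map_lact, ν.map_ract, ← mul_assoc]
    exact congrArg (· * ν.toLin m) (evOver_tmul ⊥ σ (fix_bot σ) b c).symm

/-- The tensor product of two values. -/
def Value.tensor {M N : GradedBimodule 𝒜} {σ τ : R →ₐ[ℝ] R} (μ : Value M σ) (ν : Value N τ) :
    Value (M.tensor N) (σ.comp τ) where
  toLin := tensorLift ⊤ ((LinearMap.mul ℝ R).compl₁₂ μ.toLin (σ.toLinearMap ∘ₗ ν.toLin))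
    (μ.tensor_balanced ν)
  map_lact a x := by
    induction x using tensor_induction with
    | h0 => simp only [map_zero, mul_zero]
    | hadd x y hx hy => simp only [map_add, hx, hy, mul_add]
    | ht m n =>
      refine (congrArg _ (tensorLact_tmul ⊤ a m n)).trans ?_
      simp [μ.map_lact, mul_assoc]
  map_ract a x := by
    induction x using tensor_induction with
    | h0 => simp only [map_zero, mul_zero]
    | hadd x y hx hy => simp only [map_add, hx, hy, mul_add]
    | ht m n =>
      refine (congrArg _ (tensorRact_tmul ⊤ a m n)).trans ?_
      simp [ν.map_ract, mul_left_comm]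

theorem Value.tensor_tmul {M N : GradedBimodule 𝒜} {σ τ : R →ₐ[ℝ] R} (μ : Value M σ)
    (ν : Value N τ) (m : M.carrier) (n : N.carrier) :
    (μ.tensor ν).toLin (tmul ⊤ m n) = μ.toLin m * σ (ν.toLin n) :=
  tensorLift_tmul ⊤ _ (μ.tensor_balanced ν) m n

end Graphs

/-- An action of a group on a graded algebra by graded automorphisms. -/
structure GradedAction {R : Type u} [CommRing R] [Algebra ℝ R] (𝒜 : ℤ → Submodule ℝ R)
    (W : Type*) [Group W] where
  act : W →* (R →ₐ[ℝ] R)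
  mem : ∀ (w : W) {i : ℤ} {a : R}, a ∈ 𝒜 i → act w a ∈ 𝒜 i

namespace GradedAction

variable {R : Type u} [CommRing R] [Algebra ℝ R] {𝒜 : ℤ → Submodule ℝ R}
  {W : Type*} [Group W] (σ : GradedAction 𝒜 W)

theorem act_mul_apply (v w : W) (a : R) : σ.act (v * w) a = σ.act v (σ.act w a) := by
  rw [map_mul]; rfl

theorem act_one_apply (a : R) : σ.act 1 a = a := by
  rw [map_one]; rfl

variable [GradedAlgebra 𝒜]

/-- The elements of `R ⊗_ℝ R`, considered as functions on `V × V`, which vanish on the graphs of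
the elements of `S`. -/
def vanishing (S : Set W) : Submodule ℝ (base 𝒜).carrier :=
  ⨅ w ∈ S, LinearMap.ker (ev 𝒜 (σ.act w))

theorem mem_vanishing {S : Set W} {ξ : (base 𝒜).carrier} :
    ξ ∈ σ.vanishing S ↔ ∀ w ∈ S, ev 𝒜 (σ.act w) ξ = 0 := by
  simp only [vanishing, Submodule.mem_iInf, LinearMap.mem_ker]

theorem ev_mem (w : W) {i : ℤ} {ξ : (base 𝒜).carrier} (hξ : ξ ∈ (base 𝒜).gr i) :
    ev 𝒜 (σ.act w) ξ ∈ 𝒜 i := by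
  refine mem_of_tensorGr (M := unit 𝒜) (N := unit 𝒜) ⊥ (ev 𝒜 (σ.act w)) i (𝒜 i) ?_ hξ
  rintro p q rfl a ha b hb
  refine (evOver_tmul (𝒜 := 𝒜) ⊥ _ (fix_bot _) a b).symm ▸ ?_
  exact SetLike.mul_mem_graded ha (σ.mem w hb)

/-- The graded bimodule of functions on the union of the graphs of the elements of `S`. -/
abbrev graphs (S : Set W) : GradedBimodule 𝒜 :=
  (base 𝒜).quot (σ.vanishing S)
    (fun a m hm => by
      rw [mem_vanishing] at hm ⊢
      intro w hw
      rw [ev_lact, hm w hw, mul_zero])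
    (fun a m hm => by
      rw [mem_vanishing] at hm ⊢
      intro w hw
      rw [ev_ract, hm w hw, mul_zero])
    (fun i m hm => by
      rw [mem_vanishing] at hm ⊢
      intro w hw
      rw [map_proj (N := unit 𝒜) (ev 𝒜 (σ.act w)) (fun i m h => σ.ev_mem w h) i m, hm w hw,
        map_zero])

variable {σ} {S : Set W}

/-- The restriction to the graph of an element of `S`. -/
def graphValue {w : W} (hw : w ∈ S) : Value (σ.graphs S) (σ.act w) where
  toLin := (σ.vanishing S).liftQ (ev 𝒜 (σ.act w)) (fun _ hξ => σ.mem_vanishing.1 hξ w hw)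
  map_lact a m := by
    obtain ⟨m, rfl⟩ := (σ.vanishing S).mkQ_surjective m
    exact ev_lact _ a m
  map_ract a m := by
    obtain ⟨m, rfl⟩ := (σ.vanishing S).mkQ_surjective m
    exact ev_ract _ a m

theorem graphValue_mk {w : W} (hw : w ∈ S) (ξ : (base 𝒜).carrier) :
    (graphValue hw).toLin ((σ.vanishing S).mkQ ξ) = ev 𝒜 (σ.act w) ξ := rfl

/-- The restrictions embed `graphs S` in a product of twisted copies of `R`, so that identities can
be checked on one graph at a time. -/
theorem graphs_eq_zero {x : (σ.graphs S).carrier}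
    (h : ∀ w (hw : w ∈ S), (graphValue hw).toLin x = 0) : x = 0 := by
  obtain ⟨ξ, rfl⟩ := (σ.vanishing S).mkQ_surjective x
  exact (Submodule.Quotient.mk_eq_zero _).2 (σ.mem_vanishing.2 h)

variable (σ S) in
/-- The constant function one. -/
def graphOne : (σ.graphs S).carrier := (σ.vanishing S).mkQ (bt 𝒜 1 1)

theorem graphValue_one {w : W} (hw : w ∈ S) : (graphValue hw).toLin (graphOne σ S) = 1 := by
  refine (graphValue_mk hw _).trans ((evOver_tmul (𝒜 := 𝒜) ⊥ _ (fix_bot _) 1 1).trans ?_)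
  rw [map_one, mul_one]

/-- Thus `graphs S` is cyclic over `R ⊗_ℝ R`, and the annihilator of its generator is `vanishing S`.
Its endomorphisms and the morphisms out of it are controlled by this. -/
theorem biact_graphOne (ξ : (base 𝒜).carrier) :
    biact (σ.graphs S) ξ (graphOne σ S) = (σ.vanishing S).mkQ ξ := by
  induction ξ using tensor_induction with
  | h0 => simp only [map_zero, LinearMap.zero_apply]
  | hadd x y hx hy => simp only [map_add, LinearMap.add_apply, hx, hy]
  | ht a b =>
    refine (biact_bt (σ.graphs S) a b (graphOne σ S)).trans ?_
    have h : (base 𝒜).lact a ((base 𝒜).ract b (bt 𝒜 1 1)) = bt 𝒜 a b := by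
      rw [base_ract_bt, base_lact_bt, mul_one, mul_one]
    exact congrArg (σ.vanishing S).mkQ h

theorem bt_mem {i j : ℤ} {a b : R} (ha : a ∈ 𝒜 i) (hb : b ∈ 𝒜 j) :
    bt 𝒜 a b ∈ (base 𝒜).gr (i + j) :=
  tmul_mem_tensorGr (M := unit 𝒜) (N := unit 𝒜) (m := a) (n := b) ⊥ ha hb

theorem graphOne_mem : graphOne σ S ∈ (σ.graphs S).gr 0 := by
  have h := bt_mem (𝒜 := 𝒜) (SetLike.one_mem_graded 𝒜) (SetLike.one_mem_graded 𝒜)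
  rw [add_zero] at h
  exact Submodule.mem_map_of_mem h

/-- The morphism out of `graphs S` which sends the constant function one to `m`. -/
def graphLift {M : GradedBimodule 𝒜} {d : ℤ} {m : M.carrier} (hm : m ∈ M.gr d)
    (h : ∀ ξ ∈ σ.vanishing S, biact M ξ m = 0) : (σ.graphs S).shift (-d) ⟶ M :=
  Hom.mk (M := (σ.graphs S).shift (-d)) ((σ.vanishing S).liftQ ((biact M).flip m) h)
    (fun a x => by
      obtain ⟨x, rfl⟩ := (σ.vanishing S).mkQ_surjective x
      exact biact_lact M a x m)
    (fun a x => by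
      obtain ⟨x, rfl⟩ := (σ.vanishing S).mkQ_surjective x
      exact biact_ract M a x m)
    (by
      rintro i _ ⟨x, hx, rfl⟩
      have := biact_mem M hx hm
      rwa [show -d + i + d = i by ring] at this)

/-- A bimodule with two homogeneous generators whose relations are those of `graphs S₁` and
`graphs S₂`. -/
theorem iso_of_generators {S₁ S₂ : Set W} {M : GradedBimodule 𝒜} {d₁ d₂ : ℤ} {m₁ m₂ : M.carrier}
    (hm₁ : m₁ ∈ M.gr d₁) (hm₂ : m₂ ∈ M.gr d₂)
    (hgen : ∀ m, ∃ ξ₁ ξ₂, biact M ξ₁ m₁ + biact M ξ₂ m₂ = m)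
    (h₁ : ∀ ξ ∈ σ.vanishing S₁, biact M ξ m₁ = 0) (h₂ : ∀ ξ ∈ σ.vanishing S₂, biact M ξ m₂ = 0)
    (hrel : ∀ ξ₁ ξ₂, biact M ξ₁ m₁ + biact M ξ₂ m₂ = 0 →
      ξ₁ ∈ σ.vanishing S₁ ∧ ξ₂ ∈ σ.vanishing S₂) :
    Nonempty (M ≅ ((σ.graphs S₁).shift (-d₁)).sum ((σ.graphs S₂).shift (-d₂))) := by
  let f₁ := graphLift hm₁ h₁
  let f₂ := graphLift hm₂ h₂
  let F : ((σ.graphs S₁).shift (-d₁)).sum ((σ.graphs S₂).shift (-d₂)) ⟶ M :=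
    Hom.mk (M := ((σ.graphs S₁).shift (-d₁)).sum ((σ.graphs S₂).shift (-d₂)))
      ((Hom.toLin f₁).coprod (Hom.toLin f₂))
      (fun a x => by
        refine Eq.trans ?_ (map_add (M.lact a) _ _).symm
        exact congrArg₂ _ (Hom.map_lact f₁ a x.1) (Hom.map_lact f₂ a x.2))
      (fun a x => by
        refine Eq.trans ?_ (map_add (M.ract a) _ _).symm
        exact congrArg₂ _ (Hom.map_ract f₁ a x.1) (Hom.map_ract f₂ a x.2))
      (fun hx => add_mem (Hom.map_gr f₁ hx.1) (Hom.map_gr f₂ hx.2))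
  -- Surjectivity of `F` is `hgen`. Injectivity is `hrel`: a relation between the two generators
  -- splits into a relation of each.
  refine ⟨(isoOfBijective F ⟨?_, ?_⟩).symm⟩
  · refine (injective_iff_map_eq_zero (Hom.toLin F)).2 ?_
    rintro ⟨x, y⟩ hxy
    obtain ⟨x, rfl⟩ := (σ.vanishing S₁).mkQ_surjective x
    obtain ⟨y, rfl⟩ := (σ.vanishing S₂).mkQ_surjective y
    obtain ⟨hx, hy⟩ := hrel x y hxy
    exact Prod.ext ((Submodule.Quotient.mk_eq_zero _).2 hx) ((Submodule.Quotient.mk_eq_zero _).2 hy)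
  · intro m
    obtain ⟨ξ₁, ξ₂, h⟩ := hgen m
    exact ⟨((σ.vanishing S₁).mkQ ξ₁, (σ.vanishing S₂).mkQ ξ₂), h⟩

end GradedAction

end GradedBimodule
end

noncomputable section

namespace GradedBimodule

namespace GradedAction

/-! ### Tensoring functions on graphs with the bimodule of a reflection -/

section Reflection

variable {R : Type u} [CommRing R] [Algebra ℝ R] {𝒜 : ℤ → Submodule ℝ R}
  {W : Type*} [Group W] (σ : GradedAction 𝒜 W)

/-- An involution `t` acts as a reflection with root `α`, and `A` is its ring of invariants. -/
structure IsRoot (t : W) (A : Subalgebra ℝ R) (α : R) : Prop where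
  mem_iff : ∀ a, a ∈ A ↔ σ.act t a = a
  mul_self : t * t = 1
  ne_zero : α ≠ 0
  mem : α ∈ 𝒜 2
  act_eq : σ.act t α = -α
  exists_eq : ∀ f, ∃ p ∈ A, ∃ q ∈ A, f = p + α * q

variable {σ} {A : Subalgebra ℝ R}

theorem IsRoot.fix {t : W} {α : R} (hα : σ.IsRoot t A α) : ∀ a ∈ A, σ.act t a = a :=
  fun a ha => (hα.mem_iff a).1 ha

theorem eq_zero_of_eq_neg {x : R} (h : x = -x) : x = 0 := by
  have h2 : (2 : ℝ) • x = 0 := by rw [two_smul]; nth_rewrite 2 [h]; exact add_neg_cancel x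
  simpa using h2

variable [GradedAlgebra 𝒜] {hA : IsGradedSubalgebra 𝒜 A}
  {N : GradedBimodule 𝒜}

variable (hA) in
/-- The elements `(1 ⊗ 1) ⊗ x` of `R ⊗_A R (1) ⊗_R N`. -/
def oneTmul : N.carrier →ₗ[ℝ]
    (((tensorOver A (unit 𝒜) (unit 𝒜) hA).shift 1).tensor N).carrier :=
  tmulBilin ⊤ ((tensorOver A (unit 𝒜) (unit 𝒜) hA).shift 1) N
    (tmul (M := unit 𝒜) (N := unit 𝒜) A (1 : R) (1 : R))

theorem oneTmul_mem {i : ℤ} {x : N.carrier} (hx : x ∈ N.gr i) :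
    oneTmul hA x ∈ (((tensorOver A (unit 𝒜) (unit 𝒜) hA).shift 1).tensor N).gr (-1 + i) := by
  refine tmul_mem_tensorGr (M := (tensorOver A (unit 𝒜) (unit 𝒜) hA).shift 1) ⊤ ?_ hx
  have := tmul_mem_tensorGr (M := unit 𝒜) (N := unit 𝒜) (m := (1 : R)) (n := (1 : R)) A
    (SetLike.one_mem_graded 𝒜) (SetLike.one_mem_graded 𝒜)
  exact this

theorem tmul_eq_oneTmul (a c : R) (x : N.carrier) :
    tmul (M := (tensorOver A (unit 𝒜) (unit 𝒜) hA).shift 1) ⊤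
      (tmul (M := unit 𝒜) (N := unit 𝒜) A a c) x =
      (((tensorOver A (unit 𝒜) (unit 𝒜) hA).shift 1).tensor N).lact a
        (oneTmul hA (N.lact c x)) := by
  refine Eq.trans ?_ (tensorLact_tmul ⊤ a _ _).symm
  refine Eq.trans ?_ (tmul_balanced (M := (tensorOver A (unit 𝒜) (unit 𝒜) hA).shift 1)
    (A := ⊤) (Algebra.mem_top : c ∈ _) _ _)
  refine congrArg (fun z => tmul (M := (tensorOver A (unit 𝒜) (unit 𝒜) hA).shift 1) ⊤ z x) ?_
  refine Eq.trans ?_ (congrArg _ (tensorLact_tmul (M := unit 𝒜) (N := unit 𝒜) A a _ _)).symm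
  refine Eq.trans ?_ (tensorRact_tmul (M := unit 𝒜) (N := unit 𝒜) A c _ _).symm
  exact congrArg₂ (fun y z : R => tmul (M := unit 𝒜) (N := unit 𝒜) A y z) (mul_one a).symm
    (mul_one c).symm

theorem oneTmul_ract (b : R) (x : N.carrier) :
    oneTmul hA (N.ract b x) =
      (((tensorOver A (unit 𝒜) (unit 𝒜) hA).shift 1).tensor N).ract b (oneTmul hA x) :=
  (tensorRact_tmul (M := (tensorOver A (unit 𝒜) (unit 𝒜) hA).shift 1) ⊤ b _ _).symm

/-- Only elements of `A` pass through both tensor signs; other left coefficients stay in front. -/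
theorem oneTmul_lact {a : R} (ha : a ∈ A) (x : N.carrier) :
    oneTmul hA (N.lact a x) =
      (((tensorOver A (unit 𝒜) (unit 𝒜) hA).shift 1).tensor N).lact a (oneTmul hA x) := by
  have h := tmul_eq_oneTmul (hA := hA) 1 a x
  rw [map_one] at h
  refine h.symm.trans ?_
  refine Eq.trans ?_ (tensorLact_tmul (M := (tensorOver A (unit 𝒜) (unit 𝒜) hA).shift 1) ⊤ a
    (tmul (M := unit 𝒜) (N := unit 𝒜) A (1 : R) (1 : R)) x).symm
  refine congrArg (fun z => tmul (M := (tensorOver A (unit 𝒜) (unit 𝒜) hA).shift 1) ⊤ z x) ?_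
  refine Eq.trans ?_ (tensorLact_tmul (M := unit 𝒜) (N := unit 𝒜) A a _ _).symm
  have h2 := tmul_balanced (M := unit 𝒜) (N := unit 𝒜) ha (1 : R) (1 : R)
  refine Eq.trans ?_ h2.symm
  exact congrArg (fun z : R => tmul (M := unit 𝒜) (N := unit 𝒜) A (1 : R) z) (mul_one a).symm

/-- The value `(a ⊗ c) ⊗ x ↦ a τ(c ν(x))`. -/
def inducedValue (τ : R →ₐ[ℝ] R) (hτ : ∀ a ∈ A, τ a = a) {ρ : R →ₐ[ℝ] R} (ν : Value N ρ) :
    Value (((tensorOver A (unit 𝒜) (unit 𝒜) hA).shift 1).tensor N) (τ.comp ρ) :=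
  Value.tensor (M := (tensorOver A (unit 𝒜) (unit 𝒜) hA).shift 1)
    { toLin := (evValue A hA τ hτ).toLin
      map_lact := (evValue A hA τ hτ).map_lact
      map_ract := (evValue A hA τ hτ).map_ract } ν

theorem inducedValue_oneTmul (τ : R →ₐ[ℝ] R) (hτ : ∀ a ∈ A, τ a = a) {ρ : R →ₐ[ℝ] R}
    (ν : Value N ρ) (x : N.carrier) :
    (inducedValue (hA := hA) τ hτ ν).toLin (oneTmul hA x) = τ (ν.toLin x) := by
  refine (Value.tensor_tmul _ ν _ x).trans ?_
  have h : evOver 𝒜 A τ hτ (tmul (M := unit 𝒜) (N := unit 𝒜) A (1 : R) (1 : R)) = 1 := by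
    rw [evOver_tmul, map_one, mul_one]
  exact (congrArg (· * τ (ν.toLin x)) h).trans (one_mul _)

/-- Since `R = A + αA` and coefficients from `A` can be moved into `N`, the left coefficients `1`
and `α` suffice. -/
theorem exists_oneTmul {t : W} {α : R} (hα : σ.IsRoot t A α)
    (m : (((tensorOver A (unit 𝒜) (unit 𝒜) hA).shift 1).tensor N).carrier) :
    ∃ x y, m = oneTmul hA x +
      (((tensorOver A (unit 𝒜) (unit 𝒜) hA).shift 1).tensor N).lact α (oneTmul hA y) := by
  refine tensor_induction (M := (tensorOver A (unit 𝒜) (unit 𝒜) hA).shift 1) (N := N) (A := ⊤)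
    (p := fun m => ∃ x y, m = oneTmul hA x +
      (((tensorOver A (unit 𝒜) (unit 𝒜) hA).shift 1).tensor N).lact α (oneTmul hA y)) ?_ ?_ ?_ m
  · exact ⟨0, 0, by rw [map_zero, map_zero, add_zero]⟩
  · rintro _ _ ⟨x, y, rfl⟩ ⟨x', y', rfl⟩
    refine ⟨x + x', y + y', ?_⟩
    rw [map_add, map_add, map_add]
    exact add_add_add_comm _ _ _ _
  · intro b n
    refine tensor_induction (M := unit 𝒜) (N := unit 𝒜) (A := A) (p := fun b => ∃ x y,
      tmul (M := (tensorOver A (unit 𝒜) (unit 𝒜) hA).shift 1) ⊤ b n = oneTmul hA x +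
      (((tensorOver A (unit 𝒜) (unit 𝒜) hA).shift 1).tensor N).lact α (oneTmul hA y)) ?_ ?_ ?_ b
    · refine ⟨0, 0, ?_⟩
      rw [map_zero, map_zero, add_zero]
      exact tmul_zero_left (M := (tensorOver A (unit 𝒜) (unit 𝒜) hA).shift 1) ⊤ n
    · rintro b b' ⟨x, y, h⟩ ⟨x', y', h'⟩
      refine ⟨x + x', y + y', ?_⟩
      refine (tmul_add_left (M := (tensorOver A (unit 𝒜) (unit 𝒜) hA).shift 1) ⊤ b b' n).trans ?_
      rw [h, h', map_add, map_add, map_add]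
      exact add_add_add_comm _ _ _ _
    · intro (a : R) (c : R)
      obtain ⟨p, hp, q, hq, rfl⟩ := hα.exists_eq a
      refine ⟨N.lact (p * c) n, N.lact (q * c) n, ?_⟩
      rw [tmul_eq_oneTmul, map_add, map_mul, LinearMap.add_apply, Module.End.mul_apply,
        ← oneTmul_lact hp, ← oneTmul_lact hq, ← Module.End.mul_apply, ← map_mul,
        ← Module.End.mul_apply (N.lact q), ← map_mul]

section Main

variable {t : W} {α : R} {S : Set W}

/-- The first value of `R ⊗_A R (1) ⊗ graphs S` over an element of `S`. -/
def leftValue {w : W} (hw : w ∈ S) :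
    Value (((tensorOver A (unit 𝒜) (unit 𝒜) hA).shift 1).tensor (σ.graphs S)) (σ.act w) :=
  inducedValue (hA := hA) (AlgHom.id ℝ R) (fun _ _ => rfl) (graphValue hw)

/-- The second value over an element of `S`. -/
def rightValue (hα : σ.IsRoot t A α) {w : W} (hw : w ∈ S) :
    Value (((tensorOver A (unit 𝒜) (unit 𝒜) hA).shift 1).tensor (σ.graphs S)) (σ.act (t * w)) :=
  let ν := inducedValue (hA := hA) (σ.act t) hα.fix (graphValue hw)
  ⟨ν.toLin, ν.map_lact, fun a m => by
    rw [act_mul_apply]; exact ν.map_ract a m⟩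

theorem leftValue_oneTmul {w : W} (hw : w ∈ S) (x : (σ.graphs S).carrier) :
    (leftValue (hA := hA) hw).toLin (oneTmul hA x) = (graphValue hw).toLin x :=
  inducedValue_oneTmul (AlgHom.id ℝ R) _ _ x

theorem rightValue_oneTmul (hα : σ.IsRoot t A α) {w : W} (hw : w ∈ S) (x : (σ.graphs S).carrier) :
    (rightValue (hA := hA) hα hw).toLin (oneTmul hA x) = σ.act t ((graphValue hw).toLin x) :=
  inducedValue_oneTmul (σ.act t) hα.fix _ x

/-- Write the element as `1 ⊗ x + α ⊗ y`. Over `w` the left value is `x + α y`, and `t` turns the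
right value into `x - α y`. As neither `2` nor `α` is a zero divisor, `x` and `y` vanish on every
graph. -/
theorem eq_zero_of_values [IsDomain R] (hα : σ.IsRoot t A α)
    {m : (((tensorOver A (unit 𝒜) (unit 𝒜) hA).shift 1).tensor (σ.graphs S)).carrier}
    (hl : ∀ w (hw : w ∈ S), (leftValue (hA := hA) hw).toLin m = 0)
    (hr : ∀ w (hw : w ∈ S), (rightValue (hA := hA) hα hw).toLin m = 0) : m = 0 := by
  obtain ⟨x, y, rfl⟩ := exists_oneTmul hα m
  have key : ∀ w (hw : w ∈ S), (graphValue hw).toLin x = 0 ∧ (graphValue hw).toLin y = 0 := by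
    intro w hw
    have h1 := hl w hw
    have h2 := congrArg (σ.act t) (hr w hw)
    rw [map_add, Value.map_lact, leftValue_oneTmul, leftValue_oneTmul] at h1
    rw [map_add, Value.map_lact, rightValue_oneTmul, rightValue_oneTmul, map_zero, map_add,
      map_mul, ← act_mul_apply, ← act_mul_apply, hα.mul_self, act_one_apply, act_one_apply,
      hα.act_eq] at h2
    have hx : (graphValue hw).toLin x = 0 := eq_zero_of_eq_neg (by linear_combination h1 + h2)
    refine ⟨hx, ?_⟩
    rw [hx, zero_add] at h1
    exact (mul_eq_zero.1 h1).resolve_left hα.ne_zero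
  rw [graphs_eq_zero fun w hw => (key w hw).1, graphs_eq_zero fun w hw => (key w hw).2, map_zero,
    map_zero, add_zero]

/-- The tensor product of `R ⊗_{R^t} R (1)` and the functions on the graphs of the elements
of `S`. -/
theorem tensor_graphs [IsDomain R] (hα : σ.IsRoot t A α) {p y : R} (hp : p ∈ A) (hp2 : p ∈ 𝒜 2) (hy2 : y ∈ 𝒜 2)
    (h : ∀ w ∈ S, t * w ∉ S → σ.act w y = α - p) :
    Nonempty (((tensorOver A (unit 𝒜) (unit 𝒜) hA).shift 1).tensor (σ.graphs S) ≅
      ((σ.graphs {w | w ∈ S ∨ t * w ∈ S}).shift 1).sum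
        ((σ.graphs {w | w ∈ S ∧ t * w ∈ S}).shift (-1))) := by
  have htt : ∀ w, t * (t * w) = w := fun w => by rw [← mul_assoc, hα.mul_self, one_mul]
  have hpt : σ.act t p = p := hα.fix p hp
  set M := ((tensorOver A (unit 𝒜) (unit 𝒜) hA).shift 1).tensor (σ.graphs S) with hM
  obtain ⟨e, he⟩ : ∃ e, e = graphOne σ S := ⟨_, rfl⟩
  -- The second generator. Its value at `w` is `α - p - w(y)`, which by hypothesis is zero at those
  -- `w ∈ S` for which `t w ∉ S`.
  obtain ⟨n, hn⟩ : ∃ n, n = (σ.graphs S).lact α e - (σ.graphs S).lact p e -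
    (σ.graphs S).ract y e := ⟨_, rfl⟩
  have he0 : e ∈ (σ.graphs S).gr 0 := he ▸ graphOne_mem
  have hn2 : n ∈ (σ.graphs S).gr 2 := by
    have h1 := (σ.graphs S).lact_mem hα.mem he0
    have h2 := (σ.graphs S).lact_mem hp2 he0
    have h3 := (σ.graphs S).ract_mem hy2 he0
    rw [add_zero] at h1 h2 h3
    rw [hn]
    exact Submodule.sub_mem _ (Submodule.sub_mem _ h1 h2) h3
  have hve : ∀ w (hw : w ∈ S), (graphValue hw).toLin e = 1 := fun w hw => by
    rw [he, graphValue_one]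
  have hvn : ∀ w (hw : w ∈ S), (graphValue hw).toLin n = α - p - σ.act w y := by
    intro w hw
    rw [hn, map_sub, map_sub, Value.map_lact, Value.map_lact, Value.map_ract, hve w hw, mul_one,
      mul_one, mul_one]
  have hvn0 : ∀ w (hw : w ∈ S), t * w ∉ S → (graphValue hw).toLin n = 0 := by
    intro w hw htw
    rw [hvn, h w hw htw, sub_self]
  have hl1 : ∀ w (hw : w ∈ S) ξ, (leftValue (hA := hA) hw).toLin (biact M ξ (oneTmul hA e)) =
      ev 𝒜 (σ.act w) ξ := by
    intro w hw ξ
    rw [Value.map_biact, leftValue_oneTmul, hve, mul_one]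
  have hr1 : ∀ w (hw : w ∈ S) ξ,
      (rightValue (hA := hA) hα hw).toLin (biact M ξ (oneTmul hA e)) =
        ev 𝒜 (σ.act (t * w)) ξ := by
    intro w hw ξ
    rw [Value.map_biact, rightValue_oneTmul, hve, map_one, mul_one]
  have hl2 : ∀ w (hw : w ∈ S) ξ, (leftValue (hA := hA) hw).toLin (biact M ξ (oneTmul hA n)) =
      ev 𝒜 (σ.act w) ξ * (graphValue hw).toLin n := by
    intro w hw ξ
    rw [Value.map_biact, leftValue_oneTmul]
  have hr2 : ∀ w (hw : w ∈ S) ξ,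
      (rightValue (hA := hA) hα hw).toLin (biact M ξ (oneTmul hA n)) =
        ev 𝒜 (σ.act (t * w)) ξ * σ.act t ((graphValue hw).toLin n) := by
    intro w hw ξ
    rw [Value.map_biact, rightValue_oneTmul]
  -- The shift in `B_t` lowers the degrees `0` and `2` of `e` and `n` to `-1` and `1`; hence the
  -- shifts `1` and `-1` of the two summands.
  have hm1 := oneTmul_mem (hA := hA) he0
  have hm2 := oneTmul_mem (hA := hA) hn2
  rw [add_zero] at hm1
  rw [show (-1 + 2 : ℤ) = 1 from rfl] at hm2
  have := iso_of_generators (σ := σ) (S₁ := {w | w ∈ S ∨ t * w ∈ S})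
    (S₂ := {w | w ∈ S ∧ t * w ∈ S}) hm1 hm2 ?_ ?_ ?_ ?_
  · rw [neg_neg] at this
    exact this
  -- Generation: `G` is the subbimodule generated by `e` and `n`.
  · let G : Submodule ℝ M.carrier := LinearMap.range ((biact M).flip (oneTmul hA e)) ⊔
      LinearMap.range ((biact M).flip (oneTmul hA n))
    have hGl : ∀ a, ∀ m ∈ G, M.lact a m ∈ G := by
      intro a m hm
      obtain ⟨_, ⟨ξ, rfl⟩, _, ⟨η, rfl⟩, rfl⟩ := Submodule.mem_sup.1 hm
      rw [map_add]
      exact Submodule.add_mem_sup ⟨_, biact_lact M a ξ _⟩ ⟨_, biact_lact M a η _⟩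
    have hGr : ∀ a, ∀ m ∈ G, M.ract a m ∈ G := by
      intro a m hm
      obtain ⟨_, ⟨ξ, rfl⟩, _, ⟨η, rfl⟩, rfl⟩ := Submodule.mem_sup.1 hm
      rw [map_add]
      exact Submodule.add_mem_sup ⟨_, biact_ract M a ξ _⟩ ⟨_, biact_ract M a η _⟩
    have hone : ∀ m, biact M (bt 𝒜 1 1) m = m := by
      intro m
      rw [biact_bt, map_one, map_one]
      rfl
    have hGe : oneTmul hA e ∈ G := Submodule.mem_sup_left ⟨bt 𝒜 1 1, hone (oneTmul hA e)⟩
    have hGn : oneTmul hA n ∈ G := Submodule.mem_sup_right ⟨bt 𝒜 1 1, hone (oneTmul hA n)⟩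
    -- Solve the definition of `n` for `α e`. The term with `p` may be taken out on the left because
    -- `p ∈ A`, the term with `y` on the right. From `1 ⊗ e` and `1 ⊗ α e` all `1 ⊗ x` follow by `R
    -- = A + αA`.
    have hGα : oneTmul hA ((σ.graphs S).lact α e) ∈ G := by
      have : (σ.graphs S).lact α e = n + (σ.graphs S).lact p e + (σ.graphs S).ract y e := by
        rw [hn]; abel
      rw [this, map_add, map_add, oneTmul_lact hp, oneTmul_ract]
      exact add_mem (add_mem hGn (hGl _ _ hGe)) (hGr _ _ hGe)
    have hGx : ∀ x, oneTmul hA x ∈ G := by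
      intro x
      obtain ⟨ξ, rfl⟩ := (σ.vanishing S).mkQ_surjective x
      rw [← biact_graphOne, ← he]
      induction ξ using tensor_induction with
      | h0 =>
        rw [map_zero, LinearMap.zero_apply, map_zero]
        exact zero_mem _
      | hadd x y hx hy =>
        rw [map_add, LinearMap.add_apply, map_add]
        exact add_mem hx hy
      | ht a b =>
        obtain ⟨q, hq, q', hq', hqq⟩ := hα.exists_eq a
        have h1 : biact (σ.graphs S) (bt 𝒜 a b) e = (σ.graphs S).ract b
            ((σ.graphs S).lact q e + (σ.graphs S).lact q' ((σ.graphs S).lact α e)) := by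
          rw [biact_bt, act_comm, hqq, map_add, mul_comm, map_mul]
          rfl
        refine (congrArg (fun z => oneTmul hA z) h1).symm ▸ ?_
        rw [oneTmul_ract, map_add, oneTmul_lact hq, oneTmul_lact hq']
        exact hGr _ _ (add_mem (hGl _ _ hGe) (hGl _ _ hGα))
    intro m
    obtain ⟨x, x', rfl⟩ := exists_oneTmul hα m
    obtain ⟨_, ⟨ξ, rfl⟩, _, ⟨η, rfl⟩, h⟩ :=
      Submodule.mem_sup.1 (add_mem (hGx x) (hGl α _ (hGx x')))
    exact ⟨ξ, η, h⟩
  · intro ξ hξ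
    rw [mem_vanishing] at hξ
    refine eq_zero_of_values hα (fun w hw => ?_) (fun w hw => ?_)
    · rw [hl1]
      exact hξ w (Or.inl hw)
    · rw [hr1]
      exact hξ _ (Or.inr (by rwa [htt]))
  · intro ξ hξ
    rw [mem_vanishing] at hξ
    refine eq_zero_of_values hα (fun w hw => ?_) (fun w hw => ?_)
    · rw [hl2]
      by_cases htw : t * w ∈ S
      · rw [hξ w ⟨hw, htw⟩, zero_mul]
      · rw [hvn0 w hw htw, mul_zero]
    · rw [hr2]
      by_cases htw : t * w ∈ S
      · rw [hξ (t * w) ⟨htw, by rwa [htt]⟩, zero_mul]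
      · rw [hvn0 w hw htw, map_zero, mul_zero]
  · intro ξ₁ ξ₂ hξ
    have hL : ∀ w (hw : w ∈ S), ev 𝒜 (σ.act w) ξ₁ +
        ev 𝒜 (σ.act w) ξ₂ * (graphValue hw).toLin n = 0 := by
      intro w hw
      rw [← hl1 w hw, ← hl2 w hw, ← map_add, hξ, map_zero]
    have hR : ∀ w (hw : w ∈ S), ev 𝒜 (σ.act (t * w)) ξ₁ +
        ev 𝒜 (σ.act (t * w)) ξ₂ * σ.act t ((graphValue hw).toLin n) = 0 := by
      intro w hw
      rw [← hr1 w hw, ← hr2 w hw, ← map_add, hξ, map_zero]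
    -- If `w` and `t w` are in `S`, the graph of `w` is seen twice: by the left value over `w` and
    -- by the right value over `t w`. The two values of `n` there are `±α - p - w(y)`; their
    -- difference `2α` isolates `ξ₂`.
    have hboth : ∀ w, w ∈ S → t * w ∈ S →
        ev 𝒜 (σ.act w) ξ₁ = 0 ∧ ev 𝒜 (σ.act w) ξ₂ = 0 := by
      intro w hw htw
      have h1 := hL w hw
      have h2 := hR (t * w) htw
      rw [hvn] at h1 h2
      rw [htt, map_sub, map_sub, hα.act_eq, hpt, ← act_mul_apply, htt] at h2
      have h3 : α * ev 𝒜 (σ.act w) ξ₂ = 0 :=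
        eq_zero_of_eq_neg (by linear_combination h1 - h2)
      have h4 := (mul_eq_zero.1 h3).resolve_left hα.ne_zero
      rw [h4, zero_mul, add_zero] at h1
      exact ⟨h1, h4⟩
    -- Here `n` vanishes at `w`, so the two values over `w` show `ξ₁` alone on the graphs of `w` and
    -- `t w`.
    have hone : ∀ w, w ∈ S → t * w ∉ S →
        ev 𝒜 (σ.act w) ξ₁ = 0 ∧ ev 𝒜 (σ.act (t * w)) ξ₁ = 0 := by
      intro w hw htw
      have h1 := hL w hw
      have h2 := hR w hw
      rw [hvn0 w hw htw, mul_zero, add_zero] at h1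
      rw [hvn0 w hw htw, map_zero, mul_zero, add_zero] at h2
      exact ⟨h1, h2⟩
    rw [mem_vanishing, mem_vanishing]
    refine ⟨fun w hw => ?_, fun w hw => (hboth w hw.1 hw.2).2⟩
    by_cases hw1 : w ∈ S
    · by_cases hw2 : t * w ∈ S
      · exact (hboth w hw1 hw2).1
      · exact (hone w hw1 hw2).1
    · have hw2 : t * w ∈ S := hw.resolve_left hw1
      have := (hone (t * w) hw2 (by rwa [htt])).2
      rwa [htt] at this

end Main

end Reflection

end GradedAction

end GradedBimodule
end

noncomputable section

/-! ### The Coxeter group of type `A₂` and its three reflections -/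

/-- The properties of the three reflections `t 0, t 1, t 2` of the Coxeter group of
type `A₂`; the third reflection besides `t i` and `t k` is `t (-(i + k))`. -/
structure IsA2Triple {W : Type*} [Group W] (t : Fin 3 → W) : Prop where
  injective : Function.Injective t
  mul_self : ∀ i, t i * t i = 1
  conj : ∀ i k, i ≠ k → t k * t i * t k = t (-(i + k))
  centralizer : ∀ w i, w * t i = t i * w → w = 1 ∨ w = t i
  exists_conj : ∀ w j, ∃ i, w * t j = t i * w

namespace CoxeterSystem

variable {W : Type*} [Group W] (cs : CoxeterSystem (CoxeterMatrix.A 2) W)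

theorem A2_braid : cs.simple 1 * (cs.simple 0 * cs.simple 1) =
    cs.simple 0 * (cs.simple 1 * cs.simple 0) := by
  have h := cs.simple_mul_simple_pow 0 1
  have h3 : CoxeterMatrix.A 2 0 1 = 3 := by
    simp [CoxeterMatrix.A]
  rw [h3, pow_succ, pow_two] at h
  have ha := cs.simple_mul_simple_self 0
  have hb := cs.simple_mul_simple_self 1
  calc cs.simple 1 * (cs.simple 0 * cs.simple 1)
      = cs.simple 0 * (cs.simple 0 * cs.simple 1 * (cs.simple 0 * cs.simple 1)) := by
        simp only [← mul_assoc, ha, one_mul]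
    _ = cs.simple 0 * (cs.simple 0 * cs.simple 1)⁻¹ := by rw [eq_inv_of_mul_eq_one_left h]
    _ = cs.simple 0 * (cs.simple 1 * cs.simple 0) := by
        rw [mul_inv_rev, cs.inv_simple, cs.inv_simple]

/-- The list is stable under left multiplication by the simple reflections. That the six words are
distinct is not part of the statement. -/
theorem A2_cases (w : W) :
    w = 1 ∨ w = cs.simple 0 ∨ w = cs.simple 1 ∨ w = cs.simple 0 * cs.simple 1 ∨
      w = cs.simple 1 * cs.simple 0 ∨ w = cs.simple 0 * (cs.simple 1 * cs.simple 0) := by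
  have ha := cs.simple_mul_simple_self 0
  have hb := cs.simple_mul_simple_self 1
  have ha' : ∀ x, cs.simple 0 * (cs.simple 0 * x) = x := fun x => by
    rw [← mul_assoc, ha, one_mul]
  have hb' : ∀ x, cs.simple 1 * (cs.simple 1 * x) = x := fun x => by
    rw [← mul_assoc, hb, one_mul]
  have hbr := cs.A2_braid
  have hbr' : cs.simple 1 * (cs.simple 0 * (cs.simple 1 * cs.simple 0)) =
      cs.simple 0 * cs.simple 1 := by
    rw [← hbr, hb']
  induction w using cs.simple_induction_left with
  | one => exact Or.inl rfl
  | mul_simple_left w i ih =>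
    fin_cases i <;> rcases ih with rfl | rfl | rfl | rfl | rfl | rfl <;>
      simp [ha, hb, ha', hb', hbr, hbr']

theorem A2_reflection {r : W} (hr : cs.IsReflection r) :
    r = cs.simple 0 ∨ r = cs.simple 1 ∨ r = cs.simple 0 * (cs.simple 1 * cs.simple 0) := by
  have ha := cs.simple_mul_simple_self 0
  have hb := cs.simple_mul_simple_self 1
  have ha' : ∀ x, cs.simple 0 * (cs.simple 0 * x) = x := fun x => by
    rw [← mul_assoc, ha, one_mul]
  have hb' : ∀ x, cs.simple 1 * (cs.simple 1 * x) = x := fun x => by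
    rw [← mul_assoc, hb, one_mul]
  have hbr := cs.A2_braid
  have hbr' : ∀ x, cs.simple 1 * (cs.simple 0 * (cs.simple 1 * x)) =
      cs.simple 0 * (cs.simple 1 * (cs.simple 0 * x)) := fun x => by
    have := congrArg (· * x) hbr
    simpa only [mul_assoc] using this
  obtain ⟨w, i, rfl⟩ := hr
  fin_cases i <;> rcases cs.A2_cases w with rfl | rfl | rfl | rfl | rfl | rfl <;>
      simp [mul_assoc, ha, hb, ha', hb', hbr, hbr']

theorem isA2Triple (t : Fin 3 ≃ {t : W // cs.IsReflection t}) :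
    IsA2Triple fun i => (t i : W) := by
  classical
  have ha := cs.simple_mul_simple_self 0
  have hb := cs.simple_mul_simple_self 1
  have ha' : ∀ x, cs.simple 0 * (cs.simple 0 * x) = x := fun x => by
    rw [← mul_assoc, ha, one_mul]
  have hb' : ∀ x, cs.simple 1 * (cs.simple 1 * x) = x := fun x => by
    rw [← mul_assoc, hb, one_mul]
  have hbr := cs.A2_braid
  have hbr' : ∀ x, cs.simple 1 * (cs.simple 0 * (cs.simple 1 * x)) =
      cs.simple 0 * (cs.simple 1 * (cs.simple 0 * x)) := fun x => by
    have := congrArg (· * x) hbr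
    simpa only [mul_assoc] using this
  have hinj : Function.Injective fun i => (t i : W) :=
    Subtype.val_injective.comp t.injective
  have hself : ∀ i, (t i : W) * t i = 1 := fun i => (t i).2.mul_self
  -- The bijection `t` gives three distinct reflections, and only three words are candidates, so
  -- these words are distinct. This excludes a collapse of the presentation.
  obtain ⟨hn1, hn2, hn3⟩ : cs.simple 0 ≠ cs.simple 1 ∧
      cs.simple 0 ≠ cs.simple 0 * (cs.simple 1 * cs.simple 0) ∧
      cs.simple 1 ≠ cs.simple 0 * (cs.simple 1 * cs.simple 0) := by
    have hsub : Finset.univ.image (fun i => (t i : W)) ⊆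
        {cs.simple 0, cs.simple 1, cs.simple 0 * (cs.simple 1 * cs.simple 0)} := by
      intro r hr
      obtain ⟨i, -, rfl⟩ := Finset.mem_image.1 hr
      simpa using cs.A2_reflection (t i).2
    have hcard := Finset.card_le_card hsub
    rw [Finset.card_image_of_injective _ hinj, Finset.card_univ, Fintype.card_fin] at hcard
    refine ⟨fun h => ?_, fun h => ?_, fun h => ?_⟩
    · rw [h, Finset.insert_eq_of_mem (by simp)] at hcard
      exact absurd (hcard.trans Finset.card_le_two) (by norm_num)
    · rw [← h, Finset.pair_comm, Finset.insert_eq_of_mem (by simp)] at hcard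
      exact absurd (hcard.trans Finset.card_le_two) (by norm_num)
    · rw [← h, Finset.pair_eq_singleton] at hcard
      exact absurd (hcard.trans Finset.card_le_two) (by norm_num)
  have hn4 : cs.simple 0 * cs.simple 1 ≠ cs.simple 1 * cs.simple 0 := by
    intro h
    apply hn3
    rw [← h, ha']
  have hcent : ∀ w i, w * (t i : W) = t i * w → w = 1 ∨ w = t i := by
    intro w i hw
    rcases cs.A2_reflection (t i).2 with h | h | h <;> rw [h] at hw ⊢ <;>
      rcases cs.A2_cases w with rfl | rfl | rfl | rfl | rfl | rfl <;>
      simp [mul_assoc, ha, hb, ha', hb', hbr, hbr', hn1, hn2, hn3, hn4, hn1.symm, hn2.symm,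
        hn3.symm, hn4.symm] at hw ⊢
  have hconj : ∀ w j, ∃ i, w * (t j : W) = t i * w := by
    intro w j
    obtain ⟨i, hi⟩ := t.surjective ⟨_, (t j).2.conj w⟩
    exact ⟨i, by rw [hi, inv_mul_cancel_right]⟩
  refine ⟨hinj, hself, ?_, hcent, hconj⟩
  -- The conjugate of `t i` is some `t l`. It is not `t i`, because `t k` does not centralize `t i`,
  -- and not `t k`, because `t i ≠ t k`; so `l` is the third index, and the three indices add up to
  -- zero in `Fin 3`.
  intro i k hik
  obtain ⟨l, hl⟩ := hconj (t k) i
  have hl' : (t k : W) * t i * t k = t l := by rw [hl, mul_assoc, hself, mul_one]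
  have h1 : l ≠ i := by
    rintro rfl
    rcases hcent (t k) l hl with h | h
    · have hone : (t k : W) ≠ 1 := fun h1 => by
        rcases cs.A2_reflection (t k).2 with h2 | h2 | h2
        · rw [h2] at h1
          exact hn4 (by rw [h1, one_mul, mul_one])
        · rw [h2] at h1
          exact hn4 (by rw [h1, one_mul, mul_one])
        · rw [h2] at h1
          have h3 := congrArg (fun x => cs.simple 0 * (x * cs.simple 0)) h1
          simp only [mul_assoc, ha, ha', mul_one, one_mul] at h3
          exact hn4 (by rw [h3, one_mul, mul_one])
      exact hone h
    · exact hik (hinj h.symm)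
  have h2 : l ≠ k := by
    rintro rfl
    exact hik (hinj (mul_left_cancel hl))
  rw [hl']
  have : l = -(i + k) := by
    clear hl hl'
    revert i k l
    decide
  rw [this]

end CoxeterSystem

/-! ### The cosets of the centralizers of the reflections -/

section Transporter

variable {W : Type*} [Group W]

/-- The elements which conjugate `t j` into `t i`. -/
def transporter (t : Fin 3 → W) (i j : Fin 3) : Set W := {w | w * t j = t i * w}

theorem fin3_third {i k : Fin 3} (h : i ≠ k) :
    -(i + k) ≠ i ∧ -(i + k) ≠ k ∧ -(-(i + k) + k) = i := by
  revert i k; decide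

theorem fin3_eq_or {i k : Fin 3} (h : i ≠ k) (j : Fin 3) : j = i ∨ j = k ∨ j = -(i + k) := by
  revert i k j; decide

namespace IsA2Triple

variable {t : Fin 3 → W} {i j k : Fin 3} {w u : W}

theorem mul_mem_same : t k * w ∈ transporter t k j ↔ w ∈ transporter t k j := by
  simp only [transporter, Set.mem_ofPred_eq, mul_assoc, mul_left_cancel_iff]

theorem one_mem (i : Fin 3) : 1 ∈ transporter t i i := by simp [transporter]

variable (h : IsA2Triple t)
include h

theorem mul_mul_self (i : Fin 3) (w : W) : t i * (t i * w) = w := by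
  rw [← mul_assoc, h.mul_self, one_mul]

/-- Left multiplication by `t k` conjugates the first index by `t k`. For fixed `j` it preserves the
set with first index `k` (`mul_mem_same`) and exchanges the other two. -/
theorem mul_mem_of_ne (hik : i ≠ k) :
    t k * w ∈ transporter t i j ↔ w ∈ transporter t (-(i + k)) j := by
  simp only [transporter, Set.mem_ofPred_eq]
  rw [← h.conj i k hik]
  constructor
  · intro hw
    have := congrArg (t k * ·) hw
    simp only [mul_assoc, h.mul_mul_self] at this ⊢
    exact this
  · intro hw
    rw [mul_assoc, hw]
    simp only [mul_assoc, h.mul_mul_self]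

theorem eq_of_mem (hw : w ∈ transporter t i j) (hw' : w ∈ transporter t k j) : i = k :=
  h.injective (mul_right_cancel (hw.symm.trans hw'))

theorem eq_of_mem' (hw : w ∈ transporter t i j) (hw' : w ∈ transporter t i k) : j = k :=
  h.injective (mul_left_cancel (hw.trans hw'.symm))

theorem exists_mem (w : W) (j : Fin 3) : ∃ i, w ∈ transporter t i j := h.exists_conj w j

theorem one_mem_iff : 1 ∈ transporter t i j ↔ i = j :=
  ⟨fun hw => h.eq_of_mem hw (one_mem j), by rintro rfl; exact one_mem i⟩

theorem ne_one (i : Fin 3) : t i ≠ 1 := by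
  intro h1
  have hi : i ≠ i + 1 := by clear h h1; revert i; decide
  have h2 := h.conj i (i + 1) hi
  rw [h1, mul_one, h.mul_self, ← h1] at h2
  have h3 := h.injective h2
  exact (fin3_third hi).1 h3.symm

/-- The quotient of two elements centralizes `t i`. So a transporter is a coset of `{1, t i}` and
has exactly two elements. -/
theorem eq_or_eq (hw : w ∈ transporter t i j) (hu : u ∈ transporter t i j) :
    w = u ∨ w = t i * u := by
  have hw' : w * t j = t i * w := hw
  have hu' : u * t j = t i * u := hu
  have : (w * u⁻¹) * t i = t i * (w * u⁻¹) := by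
    rw [← mul_assoc, ← hw', mul_assoc, mul_assoc, mul_right_inj, eq_mul_inv_iff_mul_eq, mul_assoc,
      ← hu', inv_mul_cancel_left]
  rcases h.centralizer _ _ this with h1 | h1
  · exact Or.inl (mul_inv_eq_one.1 h1)
  · exact Or.inr (by rw [← h1, inv_mul_cancel_right])

theorem transporter_nonempty (i j : Fin 3) : (transporter t i j).Nonempty := by
  by_cases hij : i = j
  · subst hij
    exact ⟨1, one_mem i⟩
  · refine ⟨t (-(i + j)) * 1, ?_⟩
    rw [h.mul_mem_of_ne (fin3_third hij).1.symm, h.one_mem_iff]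
    clear h
    revert i j; decide

/-- The two elements of a transporter have quotient `t i`, and conjugation then recovers `t j`. So
distinct transporters are incomparable. -/
theorem transporter_le {i' j' : Fin 3} (hs : transporter t i j ⊆ transporter t i' j') :
    i = i' ∧ j = j' := by
  obtain ⟨u, hu⟩ := h.transporter_nonempty i j
  have h1 := hs hu
  have h2 := hs (mul_mem_same.2 hu)
  have hi : i = i' := by
    rcases h.eq_or_eq h2 h1 with h3 | h3
    · exact absurd (mul_eq_right.1 h3) (h.ne_one i)
    · exact h.injective (mul_right_cancel h3)
  subst hi
  exact ⟨rfl, h.eq_of_mem' hu h1⟩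

theorem transporter_not_singleton : ¬ transporter t i j ⊆ {1} := by
  intro hs
  obtain ⟨u, hu⟩ := h.transporter_nonempty i j
  have h1 : u = 1 := hs hu
  have h2 : t i * u = 1 := hs (mul_mem_same.2 hu)
  rw [h1, mul_one] at h2
  exact h.ne_one i h2

theorem exists_transporter_le_compl : ∃ k, transporter t k j ⊆ (transporter t i j)ᶜ ∧
    transporter t (-(k + i)) j ⊆ (transporter t i j)ᶜ ∧ -(k + i) ≠ k := by
  refine ⟨i + 1, fun w hw hw' => ?_, fun w hw hw' => ?_, ?_⟩
  · have := h.eq_of_mem hw hw'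
    clear h hw hw'
    revert i; decide
  · have := h.eq_of_mem hw hw'
    clear h hw hw'
    revert i; decide
  · clear h
    revert i; decide

/-- The complement contains two different transporters with the same `j`, and a transporter contains
no other one. -/
theorem compl_not_le {i' j' : Fin 3} : ¬ (transporter t i j)ᶜ ⊆ transporter t i' j' := by
  intro hs
  obtain ⟨k, h1, h2, h3⟩ := h.exists_transporter_le_compl (i := i) (j := j)
  exact h3 ((h.transporter_le (h2.trans hs)).1.trans (h.transporter_le (h1.trans hs)).1.symm)

theorem compl_not_singleton : ¬ (transporter t i j)ᶜ ⊆ {1} := by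
  intro hs
  obtain ⟨k, h1, h2, h3⟩ := h.exists_transporter_le_compl (i := i) (j := j)
  exact h.transporter_not_singleton (h1.trans hs)

/-- The transporters with fixed `j` partition the group, and `t k` exchanges the two whose first
index is not `k`. -/
theorem union_eq (hik : i ≠ k) :
    {w | w ∈ transporter t i j ∨ t k * w ∈ transporter t i j} = (transporter t k j)ᶜ := by
  ext w
  simp only [Set.mem_ofPred_eq, Set.mem_compl_iff, h.mul_mem_of_ne hik]
  have h3 := fin3_third hik
  constructor
  · rintro (hw | hw) hw'
    · exact hik (h.eq_of_mem hw hw')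
    · exact h3.2.1 (h.eq_of_mem hw hw')
  · intro hw
    obtain ⟨l, hl⟩ := h.exists_mem w j
    rcases fin3_eq_or hik l with rfl | rfl | rfl
    · exact Or.inl hl
    · exact absurd hl hw
    · exact Or.inr hl

theorem inter_eq (hik : i ≠ k) :
    {w | w ∈ transporter t i j ∧ t k * w ∈ transporter t i j} = ∅ := by
  ext w
  simp only [Set.mem_ofPred_eq, h.mul_mem_of_ne hik, Set.mem_empty_iff_false, iff_false]
  rintro ⟨hw, hw'⟩
  exact (fin3_third hik).1 (h.eq_of_mem hw' hw)

theorem compl_inter_eq (hik : i ≠ k) :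
    {w | w ∈ (transporter t i j)ᶜ ∧ t k * w ∈ (transporter t i j)ᶜ} = transporter t k j := by
  rw [← compl_compl (transporter t k j), ← h.union_eq hik]
  ext w
  simp [not_or]

theorem compl_union_eq (hik : i ≠ k) :
    {w | w ∈ (transporter t i j)ᶜ ∨ t k * w ∈ (transporter t i j)ᶜ} = Set.univ := by
  have h0 := h.inter_eq (j := j) hik
  ext w
  have hw : w ∉ {w | w ∈ transporter t i j ∧ t k * w ∈ transporter t i j} := by rw [h0]; simp
  simp only [Set.mem_ofPred_eq, Set.mem_compl_iff, Set.mem_univ, iff_true]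
  rwa [← not_and_or]

theorem singleton_union_eq :
    {w | w ∈ ({1} : Set W) ∨ t k * w ∈ ({1} : Set W)} = transporter t k k := by
  ext w
  simp only [Set.mem_ofPred_eq, Set.mem_singleton_iff]
  constructor
  · rintro (rfl | hw)
    · exact one_mem k
    · rw [← mul_mem_same, hw]
      exact one_mem k
  · intro hw
    rcases h.eq_or_eq hw (one_mem k) with rfl | rfl
    · exact Or.inl rfl
    · exact Or.inr (by rw [mul_one, h.mul_self])

theorem singleton_inter_eq :
    {w | w ∈ ({1} : Set W) ∧ t k * w ∈ ({1} : Set W)} = ∅ := by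
  ext w
  simp only [Set.mem_ofPred_eq, Set.mem_singleton_iff, Set.mem_empty_iff_false, iff_false]
  rintro ⟨rfl, hw⟩
  exact h.ne_one k (by rwa [mul_one] at hw)

/-- Regroup as `(t i t k t i) (t k t i t k)`: both factors are the third reflection. -/
theorem cube (hik : i ≠ k) : t i * t k * (t i * t k) * (t i * t k) = 1 := by
  have h1 := h.conj i k hik
  have h2 := h.conj k i hik.symm
  rw [add_comm] at h2
  calc t i * t k * (t i * t k) * (t i * t k) = (t i * t k * t i) * (t k * t i * t k) := by
        simp only [mul_assoc]
    _ = 1 := by rw [h1, h2, h.mul_self]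

end IsA2Triple

end Transporter

end

noncomputable section

/-! ### Roots of a reflection faithful representation -/

section Roots

variable {W : Type*} [Group W] {V : Type u} [AddCommGroup V] [Module ℝ V]

theorem polyAction_ι (ρ : Representation ℝ W V) (w : W) (φ : Module.Dual ℝ V) :
    polyAction ρ w (SymmetricAlgebra.ι ℝ _ φ) = SymmetricAlgebra.ι ℝ _ (ρ.dual w φ) :=
  SymmetricAlgebra.lift_ι_apply (SymmetricAlgebra.ι ℝ (Module.Dual ℝ V) ∘ₗ ρ.dual w) φ

/-- The action of `W` on the graded ring `S(V*)`. -/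
def polyGradedAction (ρ : Representation ℝ W V) :
    GradedBimodule.GradedAction (polyGrading V) W where
  act :=
    { toFun := polyAction ρ
      map_one' := by
        refine SymmetricAlgebra.algHom_ext (LinearMap.ext fun φ => ?_)
        change polyAction ρ 1 (SymmetricAlgebra.ι ℝ _ φ) = SymmetricAlgebra.ι ℝ _ φ
        rw [polyAction_ι, map_one]
        rfl
      map_mul' := fun v w => by
        refine SymmetricAlgebra.algHom_ext (LinearMap.ext fun φ => ?_)
        change polyAction ρ (v * w) (SymmetricAlgebra.ι ℝ _ φ) =
          polyAction ρ v (polyAction ρ w (SymmetricAlgebra.ι ℝ _ φ))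
        rw [polyAction_ι, polyAction_ι, polyAction_ι, map_mul]
        rfl }
  mem w _ _ ha := symMap_mem (ρ.dual w) ha

theorem polyGradedAction_ι (ρ : Representation ℝ W V) (w : W) (φ : Module.Dual ℝ V) :
    (polyGradedAction ρ).act w (SymmetricAlgebra.ι ℝ _ φ) = SymmetricAlgebra.ι ℝ _ (ρ.dual w φ) :=
  polyAction_ι ρ w φ

/-- Evaluation at a point of `V` extends to the symmetric algebra and recovers the linear form. -/
theorem symmetricAlgebra_ι_injective :
    Function.Injective (SymmetricAlgebra.ι ℝ (Module.Dual ℝ V)) := by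
  intro φ ψ h
  ext v
  have := congrArg (SymmetricAlgebra.lift (Module.Dual.eval ℝ V v)) h
  rwa [SymmetricAlgebra.lift_ι_apply, SymmetricAlgebra.lift_ι_apply] at this

theorem ι_mem_polyGrading (φ : Module.Dual ℝ V) :
    SymmetricAlgebra.ι ℝ _ φ ∈ polyGrading V 2 := by
  have := range_pow_le_symGrading (Module.Dual ℝ V) 1
  rw [pow_one] at this
  exact this (LinearMap.mem_range_self _ φ)

/-- `ρ t` is the reflection `v ↦ v + a(v) r`. -/
structure IsReflectionBy (ρ : Representation ℝ W V) (t : W) (a : Module.Dual ℝ V) (r : V) :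
    Prop where
  apply_eq : ∀ v, ρ t v = v + a v • r
  apply_root : a r = -2

/-- For an involution, `f = ρ t - 1` satisfies `f² = -2 f`. Having rank one it is `v ↦ a(v) r`, and
the equation becomes `a(r) = -2`. -/
theorem exists_isReflectionBy (ρ : Representation ℝ W V) {t : W} (ht : t * t = 1)
    (h : Module.finrank ℝ (V ⧸ LinearMap.ker (ρ t - LinearMap.id)) = 1) :
    ∃ a r, IsReflectionBy ρ t a r := by
  set f := ρ t - LinearMap.id with hf
  have hff : ∀ v, f (f v) = (-2 : ℝ) • f v := by
    intro v
    have h1 : ρ t (ρ t v) = v := by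
      rw [← Module.End.mul_apply, ← map_mul, ht, map_one]; rfl
    simp only [hf, LinearMap.sub_apply, LinearMap.id_apply, map_sub, h1]
    module
  rw [f.quotKerEquivRange.finrank_eq] at h
  obtain ⟨⟨r, hr⟩, hr0, hspan⟩ := finrank_eq_one_iff'.1 h
  have hr1 : r ≠ 0 := fun h0 => hr0 (Subtype.ext h0)
  obtain ⟨g, hg, -⟩ := Submodule.exists_le_ker_of_notMem (p := (⊥ : Submodule ℝ V)) (v := r)
    (by simpa using hr1)
  -- Since `g r ≠ 0`, the form `g` reads off the coefficient of `f v` along `r`.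
  let a : Module.Dual ℝ V := (g r)⁻¹ • (g ∘ₗ f)
  have ha : ∀ v, f v = a v • r := by
    intro v
    obtain ⟨c, hc⟩ := hspan ⟨f v, LinearMap.mem_range_self f v⟩
    have hc' : c • r = f v := congrArg Subtype.val hc
    simp only [a, LinearMap.smul_apply, LinearMap.comp_apply, ← hc', map_smul, smul_eq_mul]
    congr 1
    field_simp
  refine ⟨a, r, fun v => ?_, ?_⟩
  · rw [← ha, hf]
    simp
  · obtain ⟨v, rfl⟩ := hr
    have h1 := hff v
    rw [ha (f v)] at h1
    exact smul_left_injective ℝ hr1 h1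

namespace IsReflectionBy

variable {ρ : Representation ℝ W V} {t : W} {a : Module.Dual ℝ V} {r : V}

theorem dual_apply (h : IsReflectionBy ρ t a r) (ht : t * t = 1) (φ : Module.Dual ℝ V) :
    ρ.dual t φ = φ + φ r • a := by
  ext v
  rw [Representation.dual_apply, inv_eq_of_mul_eq_one_left ht]
  simp [Module.Dual.transpose_apply, h.apply_eq, mul_comm]

/-- The substance is that every polynomial is `p + a q` with invariant `p` and `q`. For a linear
form `φ` one splits off the multiple `-φ(r)/2` of `a`; products are covered because `a²` is
invariant. -/
theorem isRoot (h : IsReflectionBy ρ t a r) (ht : t * t = 1) :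
    (polyGradedAction ρ).IsRoot t (invariantRing ρ t) (SymmetricAlgebra.ι ℝ _ a) where
  mem_iff f := Iff.rfl
  mul_self := ht
  ne_zero h0 := by
    have h1 : a = 0 := symmetricAlgebra_ι_injective (h0.trans (map_zero _).symm)
    have h2 := h.apply_root
    rw [h1, LinearMap.zero_apply] at h2
    norm_num at h2
  mem := ι_mem_polyGrading a
  act_eq := by
    rw [polyGradedAction_ι, h.dual_apply ht, h.apply_root, ← map_neg]
    congr 1
    module
  exists_eq f := by
    have hι : ∀ φ : Module.Dual ℝ V, polyAction ρ t (SymmetricAlgebra.ι ℝ _ φ) =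
        SymmetricAlgebra.ι ℝ _ (φ + φ r • a) := fun φ => by rw [polyAction_ι, h.dual_apply ht]
    induction f using SymmetricAlgebra.induction with
    | algebraMap c =>
      exact ⟨_, (invariantRing ρ t).algebraMap_mem c, 0, zero_mem _, by rw [mul_zero, add_zero]⟩
    | ι φ =>
      refine ⟨SymmetricAlgebra.ι ℝ _ (φ + (φ r / 2) • a), ?_, algebraMap ℝ _ (-(φ r / 2)),
        (invariantRing ρ t).algebraMap_mem _, ?_⟩
      · change polyAction ρ t _ = _
        rw [hι, AlgHom.id_apply]
        congr 1
        simp only [LinearMap.add_apply, LinearMap.smul_apply, h.apply_root, smul_eq_mul]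
        module
      · rw [mul_comm, ← Algebra.smul_def, ← map_smul, ← map_add]
        congr 1
        module
    | mul x y hx hy =>
      obtain ⟨p, hp, q, hq, rfl⟩ := hx
      obtain ⟨p', hp', q', hq', rfl⟩ := hy
      have ha2 : SymmetricAlgebra.ι ℝ _ a * SymmetricAlgebra.ι ℝ _ a ∈ invariantRing ρ t := by
        change polyAction ρ t _ = _
        rw [map_mul, hι, h.apply_root, AlgHom.id_apply,
          show a + (-2 : ℝ) • a = -a by module, map_neg, neg_mul_neg]
      refine ⟨p * p' + SymmetricAlgebra.ι ℝ _ a * SymmetricAlgebra.ι ℝ _ a * (q * q'),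
        add_mem (mul_mem hp hp') (mul_mem ha2 (mul_mem hq hq')), p * q' + q * p',
        add_mem (mul_mem hp hq') (mul_mem hq hp'), ?_⟩
      ring
    | add x y hx hy =>
      obtain ⟨p, hp, q, hq, rfl⟩ := hx
      obtain ⟨p', hp', q', hq', rfl⟩ := hy
      exact ⟨p + p', add_mem hp hp', q + q', add_mem hq hq', by ring⟩

/-- Two distinct reflections whose product has order three are separated by a linear form. -/
theorem exists_form {s : W} {b : Module.Dual ℝ V} {q : V} (hρ : Function.Injective ρ)
    (hs : IsReflectionBy ρ s b q) (h : IsReflectionBy ρ t a r) (hst : s ≠ t)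
    (hcube : s * t * (s * t) * (s * t) = 1) : ∃ φ : Module.Dual ℝ V, φ q = 0 ∧ φ r = -2 := by
  -- If `r = c q`, then `s t` is `v ↦ v + d(v) q` for a form `d` with `d(q) = 0`, and its cube is `v
  -- ↦ v + 3 d(v) q`. As the cube is trivial, `d = 0`, so `s` and `t` act in the same way, against
  -- faithfulness.
  have hr : r ∉ Submodule.span ℝ {q} := by
    intro hr
    obtain ⟨c, rfl⟩ := Submodule.mem_span_singleton.1 hr
    have hac : c * a q = -2 := by simpa using h.apply_root
    have h1 : ∀ v, ρ (s * t) v = v + (c * a v - b v) • q + (2 * b v) • q - (2 * (c * a v)) • q := by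
      intro v
      rw [map_mul, Module.End.mul_apply, h.apply_eq, hs.apply_eq, map_add, map_smul, map_smul,
        hs.apply_root]
      simp only [smul_eq_mul]
      module
    set d : V → ℝ := fun v => b v - c * a v with hd
    have h2 : ∀ v, ρ (s * t) v = v + d v • q := by
      intro v
      rw [h1, hd]
      module
    have h3 : ∀ v (x : ℝ), d (v + x • q) = d v := by
      intro v x
      simp only [hd, map_add, map_smul, hs.apply_root, smul_eq_mul]
      linear_combination (-x) * hac
    have h4 : ∀ v, ρ (s * t * (s * t) * (s * t)) v = v + (3 * d v) • q := by
      intro v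
      rw [map_mul, map_mul _ (s * t) (s * t), Module.End.mul_apply, Module.End.mul_apply, h2 v,
        h2 (v + _), h3, h2 (_ + _), h3, h3]
      module
    have h5 : s = t := by
      apply hρ
      ext v
      have h6 := h4 v
      rw [hcube, map_one] at h6
      have h7 : (3 * d v) • q = 0 := by simpa using h6
      have hq : q ≠ 0 := by
        rintro rfl
        have := hs.apply_root
        norm_num at this
      have h8 : d v = 0 := by simpa [hq] using h7
      rw [hs.apply_eq, h.apply_eq, smul_smul, mul_comm, ← sub_eq_zero.1 h8]
    exact hst h5
  obtain ⟨φ, hφ, hker⟩ := Submodule.exists_le_ker_of_notMem hr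
  -- The value `-2` is that of the root `a` of `t` on `r`, so that `a - φ` will vanish on `r` and be
  -- `t`-invariant.
  refine ⟨(-2 / φ r) • φ, ?_, ?_⟩
  · have : φ q = 0 := hker (Submodule.mem_span_singleton_self q)
    simp [this]
  · simp [hφ]

end IsReflectionBy

end Roots

/-! ### Tensor products with the bimodules of reflections -/

section A2

variable {W : Type*} [Group W] {V : Type u} [AddCommGroup V] [Module ℝ V]
  {ρ : Representation ℝ W V} {t : Fin 3 → W}

variable (ρ) in
/-- The functions on the union of the graphs of the elements of `S`. -/
abbrev graphBimodule (S : Set W) : GradedBimodule (polyGrading V) :=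
  (polyGradedAction ρ).graphs S

open GradedBimodule GradedAction

/-- Choose `φ` fixed by `t m` and equal to the root `a` of `t k` on its root vector; then `p = a -
φ` is fixed by `t k`. For `u` in the transporter put `y = u⁻¹ φ`. Then `w y = φ = a - p` for both `w
= u` and `w = t m * u`, which are the only elements that `t k` can move out of `S`. -/
theorem soergel_tensor_graphs (h : IsA2Triple t) (hρ : Function.Injective ρ)
    (hcodim : ∀ i, Module.finrank ℝ (V ⧸ LinearMap.ker (ρ (t i) - LinearMap.id)) = 1)
    {k m j : Fin 3} (hmk : m ≠ k) {S : Set W}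
    (hS : ∀ w ∈ S, t k * w ∉ S → w ∈ transporter t m j) :
    Nonempty ((soergelBimodule ρ (t k)).tensor (graphBimodule ρ S) ≅
      ((graphBimodule ρ {w | w ∈ S ∨ t k * w ∈ S}).shift 1).sum
        ((graphBimodule ρ {w | w ∈ S ∧ t k * w ∈ S}).shift (-1))) := by
  obtain ⟨a, r, hr⟩ := exists_isReflectionBy ρ (h.mul_self k) (hcodim k)
  obtain ⟨b, q, hq⟩ := exists_isReflectionBy ρ (h.mul_self m) (hcodim m)
  obtain ⟨φ, hφq, hφr⟩ := IsReflectionBy.exists_form hρ hq hr (h.injective.ne hmk) (h.cube hmk)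
  obtain ⟨u, hu⟩ := h.transporter_nonempty m j
  have hmφ : ρ.dual (t m) φ = φ := by
    rw [hq.dual_apply (h.mul_self m), hφq, zero_smul, add_zero]
  have huφ : ρ.dual u (ρ.dual u⁻¹ φ) = φ := by
    rw [← Module.End.mul_apply, ← map_mul, mul_inv_cancel, map_one]; rfl
  refine tensor_graphs (hr.isRoot (h.mul_self k)) (S := S)
    (p := SymmetricAlgebra.ι ℝ _ (a - φ)) (y := SymmetricAlgebra.ι ℝ _ (ρ.dual u⁻¹ φ)) ?_
    (ι_mem_polyGrading _) (ι_mem_polyGrading _) ?_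
  · change polyAction ρ (t k) _ = _
    rw [polyAction_ι, AlgHom.id_apply, hr.dual_apply (h.mul_self k), LinearMap.sub_apply,
      hr.apply_root, hφr, sub_self, zero_smul, add_zero]
  · intro w hw hw'
    rw [← map_sub, sub_sub_cancel, polyGradedAction_ι]
    congr 1
    rcases h.eq_or_eq (hS w hw hw') hu with rfl | rfl
    · exact huφ
    · rw [map_mul, Module.End.mul_apply, huφ, hmφ]

end A2

end

noncomputable section

namespace GradedBimodule

/-! ### Endomorphisms of the graph bimodules -/

section Scalar

variable {R : Type u} [CommRing R] [Algebra ℝ R] {𝒜 : ℤ → Submodule ℝ R} [GradedAlgebra 𝒜]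

theorem Hom.map_biact {M N : GradedBimodule 𝒜} (f : M ⟶ N) (ξ : (base 𝒜).carrier)
    (m : M.carrier) : Hom.toLin f (biact M ξ m) = biact N ξ (Hom.toLin f m) := by
  induction ξ using tensor_induction with
  | h0 => simp only [map_zero, LinearMap.zero_apply]
  | hadd x y hx hy => simp only [map_add, LinearMap.add_apply, hx, hy]
  | ht b c =>
    refine (congrArg (Hom.toLin f) (biact_bt M b c m)).trans ?_
    rw [Hom.map_lact f, Hom.map_ract f]
    exact (biact_bt N b c _).symm

variable (𝒜) in
/-- A nonnegatively graded algebra with only the scalars in degree zero. -/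
structure IsConnected : Prop where
  neg : ∀ i < 0, 𝒜 i = ⊥
  zero : 𝒜 0 ≤ Submodule.span ℝ {1}

variable (h𝒜 : IsConnected 𝒜)
include h𝒜

theorem base_gr_neg {i : ℤ} (hi : i < 0) {ξ : (base 𝒜).carrier} (hξ : ξ ∈ (base 𝒜).gr i) :
    ξ = 0 := by
  refine (Submodule.mem_bot ℝ).1 (mem_of_tensorGr (M := unit 𝒜) (N := unit 𝒜) ⊥ LinearMap.id i
    ⊥ ?_ hξ)
  rintro p q rfl (a : R) ha (b : R) hb
  rw [LinearMap.id_apply, Submodule.mem_bot]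
  rcases lt_or_ge p 0 with hp | hp
  · have : a = 0 := by simpa [h𝒜.neg p hp] using ha
    rw [this]
    exact tmul_zero_left (M := unit 𝒜) (N := unit 𝒜) ⊥ b
  · have : b = 0 := by simpa [h𝒜.neg q (by lia)] using hb
    rw [this]
    exact tmul_zero_right (M := unit 𝒜) (N := unit 𝒜) ⊥ a

theorem base_gr_zero {ξ : (base 𝒜).carrier} (hξ : ξ ∈ (base 𝒜).gr 0) :
    ξ ∈ Submodule.span ℝ {bt 𝒜 1 1} := by
  refine mem_of_tensorGr (M := unit 𝒜) (N := unit 𝒜) ⊥ LinearMap.id 0 _ ?_ hξ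
  rintro p q hpq (a : R) ha (b : R) hb
  rw [LinearMap.id_apply]
  rcases lt_trichotomy p 0 with hp | hp | hp
  · have : a = 0 := by simpa [h𝒜.neg p hp] using ha
    rw [this]
    refine (tmul_zero_left (M := unit 𝒜) (N := unit 𝒜) ⊥ b).symm ▸ zero_mem _
  · obtain rfl : q = 0 := by lia
    subst hp
    obtain ⟨x, rfl⟩ := Submodule.mem_span_singleton.1 (h𝒜.zero ha)
    obtain ⟨y, rfl⟩ := Submodule.mem_span_singleton.1 (h𝒜.zero hb)
    refine Submodule.mem_span_singleton.2 ⟨x * y, ?_⟩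
    refine Eq.trans ?_ (tmul_smul_left (M := unit 𝒜) (N := unit 𝒜) ⊥ x (1 : R) (y • (1 : R))).symm
    refine Eq.trans ?_ (congrArg (x • ·)
      (tmul_smul_right (M := unit 𝒜) (N := unit 𝒜) ⊥ y (1 : R) (1 : R))).symm
    rw [mul_smul]
  · have : b = 0 := by simpa [h𝒜.neg q (by lia)] using hb
    rw [this]
    refine (tmul_zero_right (M := unit 𝒜) (N := unit 𝒜) ⊥ a).symm ▸ zero_mem _

namespace GradedAction

variable {W : Type*} [Group W] {σ : GradedAction 𝒜 W} {S : Set W}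

theorem graphs_gr_neg {i : ℤ} (hi : i < 0) {x : (σ.graphs S).carrier}
    (hx : x ∈ (σ.graphs S).gr i) : x = 0 := by
  obtain ⟨ξ, hξ, rfl⟩ := hx
  rw [base_gr_neg h𝒜 hi hξ, map_zero]

theorem graphs_gr_zero {x : (σ.graphs S).carrier} (hx : x ∈ (σ.graphs S).gr 0) :
    ∃ c : ℝ, x = c • graphOne σ S := by
  obtain ⟨ξ, hξ, rfl⟩ := hx
  obtain ⟨c, rfl⟩ := Submodule.mem_span_singleton.1 (base_gr_zero h𝒜 hξ)
  exact ⟨c, map_smul _ _ _⟩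

/-- The constant one spans its homogeneous component, so an endomorphism multiplies it by a scalar;
as it generates the bimodule, the same scalar occurs everywhere. -/
theorem isScalarEnd_graphs (n : ℤ) : ((σ.graphs S).shift n).IsScalarEnd := by
  intro f
  have h1 : graphOne σ S ∈ ((σ.graphs S).shift n).gr (-n) := by
    change graphOne σ S ∈ (σ.graphs S).gr (n + -n)
    rw [add_neg_cancel]
    exact graphOne_mem
  have h2 := Hom.map_gr f h1
  have h3 : Hom.toLin f (graphOne σ S) ∈ (σ.graphs S).gr 0 := by
    rw [← add_neg_cancel n]
    exact h2
  obtain ⟨c, hc⟩ := graphs_gr_zero h𝒜 h3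
  refine ⟨c, fun m => ?_⟩
  obtain ⟨ξ, rfl⟩ := (σ.vanishing S).mkQ_surjective m
  rw [← biact_graphOne]
  refine (Hom.map_biact f ξ (graphOne σ S)).trans ?_
  rw [hc, map_smul]
  rfl

end GradedAction

end Scalar

/-! ### The regular bimodule as functions on the graph of the identity -/

section UnitGraph

variable {R : Type u} [CommRing R] [Algebra ℝ R] {𝒜 : ℤ → Submodule ℝ R} [GradedAlgebra 𝒜]
  {W : Type*} [Group W] (σ : GradedAction 𝒜 W)

namespace GradedAction

theorem sum_graphs_empty (M : GradedBimodule 𝒜) {S : Set W} (hS : S = ∅) (n : ℤ) :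
    Nonempty (M.sum ((σ.graphs S).shift n) ≅ M) := by
  subst hS
  refine ⟨sumIso (Iso.refl M) (isoZero _ fun x => ?_) ≪≫ sumZero M⟩
  exact graphs_eq_zero (σ := σ) (x := x) fun w hw => absurd hw (Set.notMem_empty w)

theorem unit_iso_graphs : Nonempty (unit 𝒜 ≅ (σ.graphs {1}).shift 0) := by
  let ν : Value (unit 𝒜) (σ.act 1) :=
    ⟨LinearMap.id, fun _ _ => rfl, fun a m => by rw [act_one_apply]; rfl⟩
  have hν : ∀ (ξ : (base 𝒜).carrier), biact (unit 𝒜) ξ (1 : R) = ev 𝒜 (σ.act 1) ξ := fun ξ =>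
    (ν.map_biact ξ (1 : R)).trans (mul_one _)
  obtain ⟨e⟩ := sum_graphs_empty σ ((σ.graphs ({1} : Set W)).shift (-0)) (rfl : (∅ : Set W) = ∅)
    (-0)
  -- The criterion for two generators is applied with second generator zero and the empty set of
  -- graphs.
  have := iso_of_generators (σ := σ) (S₁ := {1}) (S₂ := ∅) (M := unit 𝒜) (m₁ := (1 : R))
    (m₂ := (0 : R)) (SetLike.one_mem_graded 𝒜) (zero_mem (𝒜 0)) ?_ ?_ ?_ ?_
  · obtain ⟨f⟩ := this
    rw [neg_zero] at e f
    exact ⟨f ≪≫ e⟩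
  · intro (m : R)
    refine ⟨bt 𝒜 m 1, 0, ?_⟩
    rw [hν]
    have h1 := evOver_tmul (𝒜 := 𝒜) ⊥ (σ.act 1) (fix_bot _) m 1
    rw [map_one (σ.act 1), mul_one] at h1
    refine (congrArg₂ (· + ·) h1 (?_ : _ = (0 : R))).trans (add_zero m)
    rw [map_zero]
  · intro ξ hξ
    rw [hν]
    exact σ.mem_vanishing.1 hξ 1 rfl
  · intro ξ _
    exact map_zero (biact (unit 𝒜) ξ)
  · intro ξ₁ ξ₂ h
    refine ⟨σ.mem_vanishing.2 ?_, σ.mem_vanishing.2 fun w hw => absurd hw (Set.notMem_empty w)⟩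
    rintro w rfl
    rw [← hν]
    have h0 : biact (unit 𝒜) ξ₂ (0 : R) = (0 : R) := map_zero (biact (unit 𝒜) ξ₂)
    exact (add_zero _).symm.trans ((congrArg (fun z : R => biact (unit 𝒜) ξ₁ (1 : R) + z)
      h0).symm.trans h)

end GradedAction

end UnitGraph

/-! ### Sums of shifts of a family -/

section FamilySum

variable {R : Type u} [CommRing R] [Algebra ℝ R] {𝒜 : ℤ → Submodule ℝ R}
  {Λ : Type*} (E : Λ → GradedBimodule 𝒜)

/-- Finite direct sums of shifts of members of the family `E`. -/
def IsFamilySum (M : GradedBimodule 𝒜) : Prop :=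
  ∃ L : List (Λ × ℤ), Nonempty (M ≅ sumList (L.map fun p => (E p.1).shift p.2))

variable {E} {M N : GradedBimodule 𝒜}

theorem IsFamilySum.of_iso (hM : IsFamilySum E M) (e : N ≅ M) : IsFamilySum E N := by
  obtain ⟨L, ⟨f⟩⟩ := hM
  exact ⟨L, ⟨e ≪≫ f⟩⟩

theorem isFamilySum_zero : IsFamilySum E (zero 𝒜) := ⟨[], ⟨Iso.refl _⟩⟩

theorem isFamilySum_shift (l : Λ) (n : ℤ) : IsFamilySum E ((E l).shift n) :=
  ⟨[(l, n)], ⟨(sumZero _).symm⟩⟩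

theorem isFamilySum_self (l : Λ) : IsFamilySum E (E l) :=
  (isFamilySum_shift l 0).of_iso (shiftZero _).symm

theorem IsFamilySum.sum (hM : IsFamilySum E M) (hN : IsFamilySum E N) :
    IsFamilySum E (M.sum N) := by
  obtain ⟨L, ⟨e⟩⟩ := hM
  obtain ⟨L', ⟨f⟩⟩ := hN
  obtain ⟨g⟩ := sumListAppend (L.map fun p => (E p.1).shift p.2)
    (L'.map fun p => (E p.1).shift p.2)
  rw [← List.map_append] at g
  exact ⟨L ++ L', ⟨sumIso e f ≪≫ g⟩⟩

/-- An induction principle for sums of shifts of members of a family. -/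
theorem IsFamilySum.induction {p : GradedBimodule 𝒜 → Prop} (hM : IsFamilySum E M)
    (hiso : ∀ M N : GradedBimodule 𝒜, Nonempty (M ≅ N) → p N → p M) (h0 : p (zero 𝒜))
    (hsum : ∀ M l n, IsFamilySum E M → p M → p (((E l).shift n).sum M)) : p M := by
  obtain ⟨L, e⟩ := hM
  refine hiso _ _ e ?_
  clear e
  induction L with
  | nil => exact h0
  | cons q L ih => exact hsum _ q.1 q.2 ⟨L, ⟨Iso.refl _⟩⟩ ih

theorem IsFamilySum.shift (hM : IsFamilySum E M) (n : ℤ) : IsFamilySum E (M.shift n) := by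
  refine hM.induction (p := fun M => IsFamilySum E (M.shift n)) ?_ ?_ ?_
  · rintro M N ⟨e⟩ h
    exact h.of_iso (shiftIso e n)
  · exact isFamilySum_zero.of_iso (shiftZeroObj n)
  · intro M l m _ h
    exact (((isFamilySum_shift l _).of_iso (shiftShift _ m n)).sum h).of_iso (shiftSum _ _ n)

variable [GradedAlgebra 𝒜]

theorem IsFamilySum.tensor_left {B : GradedBimodule 𝒜}
    (hB : ∀ l, IsFamilySum E (B.tensor (E l))) (hM : IsFamilySum E M) :
    IsFamilySum E (B.tensor M) := by
  refine hM.induction (p := fun M => IsFamilySum E (B.tensor M)) ?_ ?_ ?_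
  · rintro M N ⟨e⟩ h
    exact h.of_iso (tensorIso (Iso.refl B) e)
  · exact isFamilySum_zero.of_iso (tensorZero B)
  · intro M l m _ h
    exact ((((hB l).shift m).of_iso (tensorShift _ _ m)).sum h).of_iso (tensorSum _ _ _)

theorem IsFamilySum.of_retract (hE : ∀ l n, ((E l).shift n).IsScalarEnd)
    (hM : IsFamilySum E M) (e : Retract N M) : IsFamilySum E N := by
  obtain ⟨L, ⟨f⟩⟩ := hM
  obtain ⟨L', hL', ⟨g⟩⟩ := exists_sublist_of_retract (L.map fun p => (E p.1).shift p.2)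
    (by
      intro F hF
      obtain ⟨p, -, rfl⟩ := List.mem_map.1 hF
      exact hE _ _) N (e.trans (Retract.ofIso f))
  obtain ⟨L'', -, rfl⟩ := List.sublist_map_iff.1 hL'
  exact ⟨L'', ⟨g⟩⟩

/-- Words arise from `R` by tensoring on the left with one `B s` at a time, so the products of the
`B s` with the family suffice. Direct summands are handled by the scalar endomorphisms. -/
theorem isFamilySum_generated {T : Type*} {B : T → GradedBimodule 𝒜}
    (hE : ∀ l n, ((E l).shift n).IsScalarEnd) (hunit : IsFamilySum E (unit 𝒜))
    (hB : ∀ s l, IsFamilySum E ((B s).tensor (E l))) (hM : generated B M) : IsFamilySum E M := by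
  obtain ⟨L, ⟨e⟩⟩ := hM
  have hw : ∀ l : List T, IsFamilySum E (word B l) := by
    intro l
    induction l with
    | nil => exact hunit
    | cons s l ih => exact ih.tensor_left (hB s)
  refine IsFamilySum.of_retract hE ?_ e
  clear e
  induction L with
  | nil => exact isFamilySum_zero
  | cons p L ih => exact ((hw p.1).shift p.2).sum ih

end FamilySum

end GradedBimodule

end

noncomputable section

open GradedBimodule

theorem symGrading_isConnected (U : Type u) [AddCommGroup U] [Module ℝ U] :
    IsConnected (symGrading U) where
  neg i hi := by
    refine eq_bot_iff.2 (iSup₂_le fun k hk => ?_)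
    lia
  zero := by
    refine iSup₂_le fun k hk => ?_
    obtain rfl : k = 0 := by lia
    rw [pow_zero, Submodule.one_eq_span]

/-- Labels for the indecomposable objects, up to shift, of the category generated by the
bimodules of the reflections in type `A₂`. -/
inductive A2Label
  | one
  | c (i j : Fin 3)
  | z (i j : Fin 3)
  | x
  deriving Fintype

namespace A2Label

/-- The set of group elements belonging to a label. -/
def set {W : Type*} [Group W] (t : Fin 3 → W) : A2Label → Set W
  | one => {1}
  | c i j => transporter t i j
  | z i j => (transporter t i j)ᶜ
  | x => Set.univ

/-- The normalizing shift belonging to a label. -/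
def level : A2Label → ℤ
  | one => 0
  | c _ _ => 1
  | z _ _ => 2
  | x => 3

end A2Label

/-! ### Products of the bimodules of the reflections with the twenty graph bimodules -/

section Table

variable {W : Type*} [Group W] {V : Type u} [AddCommGroup V] [Module ℝ V]
  {ρ : Representation ℝ W V} {t : Fin 3 → W}

variable (ρ t) in
/-- The graded bimodule belonging to a label. -/
def labelBimodule (l : A2Label) : GradedBimodule (polyGrading V) :=
  (graphBimodule ρ (l.set t)).shift l.level

variable (h : IsA2Triple t) (hρ : Function.Injective ρ)
  (hcodim : ∀ i, Module.finrank ℝ (V ⧸ LinearMap.ker (ρ (t i) - LinearMap.id)) = 1)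
include h hρ hcodim

theorem soergel_tensor_shift {k m j : Fin 3} (hmk : m ≠ k) {S U I : Set W}
    (hS : ∀ w ∈ S, t k * w ∉ S → w ∈ transporter t m j)
    (hU : {w | w ∈ S ∨ t k * w ∈ S} = U) (hI : {w | w ∈ S ∧ t k * w ∈ S} = I)
    {n a b : ℤ} (ha : 1 + n = a) (hb : -1 + n = b) :
    Nonempty ((soergelBimodule ρ (t k)).tensor ((graphBimodule ρ S).shift n) ≅
      ((graphBimodule ρ U).shift a).sum ((graphBimodule ρ I).shift b)) := by
  subst hU hI ha hb
  obtain ⟨e⟩ := soergel_tensor_graphs h hρ hcodim hmk hS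
  exact ⟨tensorShift _ _ n ≪≫ shiftIso e n ≪≫ shiftSum _ _ n ≪≫
    sumIso (shiftShift _ _ _) (shiftShift _ _ _)⟩

theorem soergel_tensor_stable {k : Fin 3} {S : Set W} (hS : ∀ w, t k * w ∈ S ↔ w ∈ S) (n : ℤ) :
    Nonempty ((soergelBimodule ρ (t k)).tensor ((graphBimodule ρ S).shift n) ≅
      (((graphBimodule ρ S).shift n).shift 1).sum (((graphBimodule ρ S).shift n).shift (-1))) := by
  -- Any index other than `k` would do, since no element is moved out of `S`.
  have hk : k + 1 ≠ k := by clear hS; revert k; decide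
  obtain ⟨e⟩ := soergel_tensor_shift h hρ hcodim (j := k) hk (S := S) (U := S) (I := S)
    (fun w hw hw' => absurd ((hS w).2 hw) hw') (by simp [hS]) (by simp [hS]) (n := n)
    (add_comm _ _) (add_comm _ _)
  exact ⟨e ≪≫ sumIso (shiftShift _ _ _).symm (shiftShift _ _ _).symm⟩

theorem soergel_tensor_one (k : Fin 3) :
    Nonempty ((soergelBimodule ρ (t k)).tensor (labelBimodule ρ t .one) ≅
      labelBimodule ρ t (.c k k)) := by
  have hk : k + 1 ≠ k := by revert k; decide
  obtain ⟨j, hj⟩ : ∃ j, (1 : W) ∈ transporter t (k + 1) j := ⟨_, IsA2Triple.one_mem _⟩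
  obtain ⟨e⟩ := soergel_tensor_shift h hρ hcodim (j := j) hk (S := {1})
    (fun w hw _ => (Set.mem_singleton_iff.1 hw) ▸ hj) h.singleton_union_eq h.singleton_inter_eq
    (n := 0) (a := 1) (b := -1) rfl rfl
  obtain ⟨f⟩ := GradedAction.sum_graphs_empty (polyGradedAction ρ)
    ((graphBimodule ρ (transporter t k k)).shift 1) (rfl : (∅ : Set W) = ∅) (-1)
  exact ⟨e ≪≫ f⟩

/-- The reflection `t k` carries this transporter to the third one, which is disjoint from it. The
intersection term is therefore zero, and the union is the complement of the transporter with first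
index `k`. -/
theorem soergel_tensor_c {i k : Fin 3} (hik : i ≠ k) (j : Fin 3) :
    Nonempty ((soergelBimodule ρ (t k)).tensor (labelBimodule ρ t (.c i j)) ≅
      labelBimodule ρ t (.z k j)) := by
  obtain ⟨e⟩ := soergel_tensor_shift h hρ hcodim (j := j) hik (S := transporter t i j)
    (fun w hw _ => hw) (h.union_eq hik) (h.inter_eq hik)
    (n := 1) (a := 2) (b := 0) rfl rfl
  obtain ⟨f⟩ := GradedAction.sum_graphs_empty (polyGradedAction ρ)
    ((graphBimodule ρ (transporter t k j)ᶜ).shift 2) (rfl : (∅ : Set W) = ∅) 0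
  exact ⟨e ≪≫ f⟩

/-- The complement consists of the transporters with first indices `k` and `-(i + k)`. The former is
preserved by `t k`; the latter is moved out of the set, to the one with index `i`, so the condition
holds with `m = -(i + k)`. -/
theorem soergel_tensor_z {i k : Fin 3} (hik : i ≠ k) (j : Fin 3) :
    Nonempty ((soergelBimodule ρ (t k)).tensor (labelBimodule ρ t (.z i j)) ≅
      (labelBimodule ρ t .x).sum (labelBimodule ρ t (.c k j))) := by
  refine soergel_tensor_shift h hρ hcodim (j := j) (fin3_third hik).2.1
    (S := (transporter t i j)ᶜ) (fun w _ hw => ?_) (h.compl_union_eq hik) (h.compl_inter_eq hik)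
    (n := 2) (a := 3) (b := 1) rfl rfl
  rw [← h.mul_mem_of_ne hik]
  exact not_not.1 hw

theorem soergel_tensor_label_self (k : Fin 3) {l : A2Label}
    (hl : (∃ j, l = .c k j) ∨ (∃ j, l = .z k j) ∨ l = .x) :
    Nonempty ((soergelBimodule ρ (t k)).tensor (labelBimodule ρ t l) ≅
      ((labelBimodule ρ t l).shift 1).sum ((labelBimodule ρ t l).shift (-1))) := by
  refine soergel_tensor_stable h hρ hcodim ?_ l.level
  rcases hl with ⟨j, rfl⟩ | ⟨j, rfl⟩ | rfl <;> intro w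
  · exact IsA2Triple.mul_mem_same
  · exact not_congr IsA2Triple.mul_mem_same
  · exact Iff.rfl

theorem soergel_tensor_label (k : Fin 3) (l : A2Label) :
    IsFamilySum (labelBimodule ρ t) ((soergelBimodule ρ (t k)).tensor (labelBimodule ρ t l)) := by
  have hself : ((∃ j, l = .c k j) ∨ (∃ j, l = .z k j) ∨ l = .x) →
      IsFamilySum (labelBimodule ρ t)
        ((soergelBimodule ρ (t k)).tensor (labelBimodule ρ t l)) := by
    intro hl
    obtain ⟨e⟩ := soergel_tensor_label_self h hρ hcodim k hl
    exact ((isFamilySum_shift l 1).sum (isFamilySum_shift l (-1))).of_iso e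
  cases l with
  | one =>
    obtain ⟨e⟩ := soergel_tensor_one h hρ hcodim k
    exact (isFamilySum_self _).of_iso e
  | c i j =>
    by_cases hik : i = k
    · subst hik
      exact hself (Or.inl ⟨j, rfl⟩)
    · obtain ⟨e⟩ := soergel_tensor_c h hρ hcodim hik j
      exact (isFamilySum_self _).of_iso e
  | z i j =>
    by_cases hik : i = k
    · subst hik
      exact hself (Or.inr (Or.inl ⟨j, rfl⟩))
    · obtain ⟨e⟩ := soergel_tensor_z h hρ hcodim hik j
      exact ((isFamilySum_self _).sum (isFamilySum_self _)).of_iso e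
  | x => exact hself (Or.inr (Or.inr rfl))

end Table

theorem unit_iso_labelBimodule {W : Type*} [Group W] {V : Type u} [AddCommGroup V] [Module ℝ V]
    (ρ : Representation ℝ W V) (t : Fin 3 → W) :
    Nonempty (unit (polyGrading V) ≅ labelBimodule ρ t .one) :=
  (polyGradedAction ρ).unit_iso_graphs

namespace GradedBimodule

variable {R : Type u} [CommRing R] [Algebra ℝ R] {𝒜 : ℤ → Submodule ℝ R}
  {M N P : GradedBimodule 𝒜}

theorem IsScalarEnd.of_iso (hM : M.IsScalarEnd) (e : N ≅ M) : N.IsScalarEnd := by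
  intro f
  obtain ⟨c, hc⟩ := hM (e.inv ≫ f ≫ e.hom)
  have he : ∀ m, Hom.toLin e.inv (Hom.toLin e.hom m) = m := fun m =>
    LinearMap.congr_fun (congrArg Hom.toLin e.hom_inv_id) m
  refine ⟨c, fun m => ?_⟩
  have h1 : Hom.toLin e.hom (Hom.toLin f (Hom.toLin e.inv (Hom.toLin e.hom m))) =
    c • Hom.toLin e.hom m := hc _
  rw [he] at h1
  rw [← he (Hom.toLin f m), h1, map_smul, he]

variable [GradedAlgebra 𝒜] {T : Type*} {B : T → GradedBimodule 𝒜}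

theorem generated_of_retract (hM : generated B M) (e : Retract N M) : generated B N := by
  obtain ⟨L, ⟨f⟩⟩ := hM
  exact ⟨L, ⟨e.trans f⟩⟩

theorem generated_of_iso (hM : generated B M) (e : M ≅ N) : generated B N :=
  generated_of_retract hM (Retract.ofIso e.symm)

theorem generated_of_sum (hM : generated B M) (e : M ≅ N.sum P) :
    generated B N ∧ generated B P :=
  ⟨generated_of_retract hM ⟨sumInl N P ≫ e.inv, e.hom ≫ sumFst N P, by
      rw [Category.assoc, e.inv_hom_id_assoc]; rfl⟩,
    generated_of_retract hM ⟨sumInr N P ≫ e.inv, e.hom ≫ sumSnd N P, by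
      rw [Category.assoc, e.inv_hom_id_assoc]; rfl⟩⟩

end GradedBimodule

/-! ### The labels describe exactly the objects of the category -/

section Generated

variable {W : Type*} [Group W] {cs : CoxeterSystem (CoxeterMatrix.A 2) W}
  {V : Type u} [AddCommGroup V] [Module ℝ V] {ρ : Representation ℝ W V}
  (hρ : IsReflectionFaithful cs ρ) (t : Fin 3 ≃ {t : W // cs.IsReflection t})
include hρ

theorem IsReflectionFaithful.codim (i : Fin 3) :
    Module.finrank ℝ (V ⧸ LinearMap.ker (ρ (t i : W) - LinearMap.id)) = 1 :=
  (hρ.codim_one_iff (t i)).2 (t i).2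

/-- Going through the table, `R` leads to `c_jj`, then to `z_kj` with `k ≠ j`. For `i ≠ j` and `k`
the third index, `c_ij` and `x` are complementary summands of `B_i ⊗ z_kj`. -/
theorem generated_labelBimodule (l : A2Label) :
    generated (reflectionBimodules cs ρ) (labelBimodule ρ (fun i => (t i : W)) l) := by
  have h := cs.isA2Triple t
  have hB : ∀ (k : Fin 3) {M}, generated (reflectionBimodules cs ρ) M →
      generated (reflectionBimodules cs ρ) ((soergelBimodule ρ (t k : W)).tensor M) :=
    fun k M hM => generated_tensor _ (generated_of (reflectionBimodules cs ρ) (t k)) hM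
  have hone : generated (reflectionBimodules cs ρ) (labelBimodule ρ (fun i => (t i : W)) .one) :=
    generated_of_iso (generated_unit _) (unit_iso_labelBimodule ρ _).some
  have hcc : ∀ k, generated (reflectionBimodules cs ρ)
      (labelBimodule ρ (fun i => (t i : W)) (.c k k)) := fun k =>
    generated_of_iso (hB k hone) (soergel_tensor_one h hρ.faithful (hρ.codim t) k).some
  have hz : ∀ i j k, i ≠ k → generated (reflectionBimodules cs ρ)
      (labelBimodule ρ (fun i => (t i : W)) (.c i j)) → generated (reflectionBimodules cs ρ)
      (labelBimodule ρ (fun i => (t i : W)) (.z k j)) := fun i j k hik hc =>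
    generated_of_iso (hB k hc) (soergel_tensor_c h hρ.faithful (hρ.codim t) hik j).some
  have hx : ∀ i j k, i ≠ k → generated (reflectionBimodules cs ρ)
      (labelBimodule ρ (fun i => (t i : W)) (.z i j)) → generated (reflectionBimodules cs ρ)
      (labelBimodule ρ (fun i => (t i : W)) .x) ∧ generated (reflectionBimodules cs ρ)
      (labelBimodule ρ (fun i => (t i : W)) (.c k j)) := fun i j k hik hc =>
    generated_of_sum (hB k hc) (soergel_tensor_z h hρ.faithful (hρ.codim t) hik j).some
  have hc : ∀ i j, generated (reflectionBimodules cs ρ)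
      (labelBimodule ρ (fun i => (t i : W)) (.c i j)) := by
    intro i j
    by_cases hij : i = j
    · subst hij
      exact hcc i
    · have h3 := fin3_third hij
      exact (hx (-(i + j)) j i h3.1 (hz j j _ h3.2.1.symm (hcc j))).2
  have hk : ∀ k : Fin 3, k + 1 ≠ k := by decide
  cases l with
  | one => exact hone
  | c i j => exact hc i j
  | z i j => exact hz (i + 1) j i (hk i) (hc _ j)
  | x => exact (hx (0 + 1) 0 0 (hk 0) (hz (0 + 1 + 1) 0 (0 + 1) (hk (0 + 1)) (hc _ _))).1

theorem isFamilySum_labelBimodule {M : GradedBimodule (polyGrading V)}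
    (hM : generated (reflectionBimodules cs ρ) M) :
    IsFamilySum (labelBimodule ρ (fun i => (t i : W))) M := by
  refine isFamilySum_generated (fun l n => ?_) ?_ (fun s l => ?_) hM
  · exact (GradedAction.isScalarEnd_graphs (symGrading_isConnected _) (l.level + n)).of_iso
      (shiftShift _ _ _)
  · exact (isFamilySum_self _).of_iso (unit_iso_labelBimodule ρ _).some
  · obtain ⟨k, rfl⟩ := t.surjective s
    exact soergel_tensor_label (cs.isA2Triple t) hρ.faithful (hρ.codim t) k l

end Generated

end

noncomputable section

/-! ### The multiplication table -/

section Algebra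

open LaurentPolynomial

/-- The relations between the generators `C_i`. -/
structure A2Relations {A : Type*} [Ring A] [Algebra (LaurentPolynomial ℤ) A] (C : Fin 3 → A) :
    Prop where
  quadratic : ∀ i, C i * C i = (T 1 + T (-1) : LaurentPolynomial ℤ) • C i
  braid : ∀ i j, i ≠ j → C i * C j * C i + C j = C i + C j * C i * C j
  three : ∀ i j k, i ≠ j → i ≠ k → j ≠ k → C i * C j * C i = C i * C k * C i
  four : ∀ i j k, i ≠ j → i ≠ k → j ≠ k → C i * C j * C k * C i = C i * C k * C j * C i

/-- The products of the elements `C k` with a family of elements indexed by `A2Label`. -/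
structure A2Table {A : Type*} [Ring A] [Algebra (LaurentPolynomial ℤ) A] (C : Fin 3 → A)
    (f : A2Label → A) : Prop where
  one : f .one = 1
  mul_one : ∀ k, C k * f .one = f (.c k k)
  mul_c_self : ∀ k j, C k * f (.c k j) = (T 1 + T (-1) : LaurentPolynomial ℤ) • f (.c k j)
  mul_c : ∀ i k j, i ≠ k → C k * f (.c i j) = f (.z k j)
  mul_z_self : ∀ k j, C k * f (.z k j) = (T 1 + T (-1) : LaurentPolynomial ℤ) • f (.z k j)
  mul_z : ∀ i k j, i ≠ k → C k * f (.z i j) = f .x + f (.c k j)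
  mul_x : ∀ k, C k * f .x = (T 1 + T (-1) : LaurentPolynomial ℤ) • f .x

variable {A : Type*} [Ring A] [Algebra (LaurentPolynomial ℤ) A] {C : Fin 3 → A}

namespace A2Relations

variable (C) in
/-- The elements with the multiplication table `A2Table`. -/
def elements : A2Label → A
  | .one => 1
  -- For `i ≠ j` this solves `C i * z = x + c`, where `z = C k * C j` with third index `k`. Likewise
  -- the diagonal `z` below is `C i` times the `c` with indices `i + 1` and `i`.
  | .c i j => if i = j then C i else C i * C (-(i + j)) * C j - (C 0 * C 1 * C 0 - C 0)
  | .z i j => if i = j then C i * C (i + 1) * C (i + 2) * C i -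
      (T 1 + T (-1) : LaurentPolynomial ℤ) • (C 0 * C 1 * C 0 - C 0) else C i * C j
  | .x => C 0 * C 1 * C 0 - C 0

variable (hC : A2Relations C)
include hC

/-- The element `C i * C j * C i - C i` is independent of `j` by relation `three` and symmetric in
`i` and `j` by relation `braid`, so it is the same for all pairs. The common value is `x`. -/
theorem mul_mul_same {i j : Fin 3} (hij : i ≠ j) :
    C i * C j * C i = C 0 * C 1 * C 0 - C 0 + C i := by
  have h1 : ∀ i j, i ≠ j → C i * C j * C i - C i = C j * C i * C j - C j := fun i j hij => by
    rw [sub_eq_sub_iff_add_eq_add, hC.braid i j hij, add_comm]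
  have h2 : ∀ i j k, i ≠ j → i ≠ k → C i * C j * C i - C i = C i * C k * C i - C i :=
    fun i j k hij hik => by
      by_cases hjk : j = k
      · rw [hjk]
      · rw [hC.three i j k hij hik hjk]
  rw [← sub_eq_iff_eq_add]
  by_cases hi : i = 0
  · subst hi
    exact h2 0 j 1 hij (by decide)
  · rw [h2 i j 0 hij hi, h1 i 0 hi]
    exact h2 0 i 1 (Ne.symm hi) (by decide)

/-- Write `x` with `C k` as its first factor and use the quadratic relation. -/
theorem mul_x (k : Fin 3) : C k * (C 0 * C 1 * C 0 - C 0) =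
    (T 1 + T (-1) : LaurentPolynomial ℤ) • (C 0 * C 1 * C 0 - C 0) := by
  have hk : k ≠ k + 1 := by revert k; decide
  rw [← sub_eq_iff_eq_add.2 (hC.mul_mul_same hk), mul_sub, ← mul_assoc, ← mul_assoc,
    hC.quadratic, smul_mul_assoc, smul_mul_assoc, smul_sub]

theorem x_mul (k : Fin 3) : (C 0 * C 1 * C 0 - C 0) * C k =
    (T 1 + T (-1) : LaurentPolynomial ℤ) • (C 0 * C 1 * C 0 - C 0) := by
  have hk : k ≠ k + 1 := by revert k; decide
  rw [← sub_eq_iff_eq_add.2 (hC.mul_mul_same hk), sub_mul, mul_assoc, hC.quadratic,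
    mul_smul_comm, smul_sub]

/-- Relation `four` makes the order of the two middle factors irrelevant, so the cyclic choice in
the definition is harmless. -/
theorem elements_z_self {i j k : Fin 3} (hij : i ≠ j) (hik : i ≠ k) (hjk : j ≠ k) :
    elements C (.z i i) = C i * C j * C k * C i -
      (T 1 + T (-1) : LaurentPolynomial ℤ) • (C 0 * C 1 * C 0 - C 0) := by
  simp only [elements, if_true]
  congr 1
  have : (j = i + 1 ∧ k = i + 2) ∨ (k = i + 1 ∧ j = i + 2) := by
    clear hC; revert i j k; decide
  rcases this with ⟨rfl, rfl⟩ | ⟨rfl, rfl⟩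
  · rfl
  · exact hC.four _ _ _ hik hij hjk.symm

theorem table : A2Table C (elements C) where
  one := rfl
  mul_one k := by simp [elements]
  mul_c_self k j := by
    by_cases hkj : k = j
    · subst hkj
      simp [elements, hC.quadratic]
    · simp only [elements, if_neg hkj]
      rw [mul_sub, hC.mul_x, ← mul_assoc, ← mul_assoc, hC.quadratic, smul_mul_assoc,
        smul_mul_assoc, ← smul_sub]
  mul_c i k j hik := by
    by_cases hij : i = j
    · subst hij
      simp [elements, hik.symm]
    · have h3 := fin3_third hij
      rcases fin3_eq_or hij k with rfl | rfl | rfl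
      · exact absurd rfl hik
      · rw [hC.elements_z_self hik.symm h3.2.1.symm h3.1.symm]
        simp only [elements, if_neg hij]
        rw [mul_sub, hC.mul_x, ← mul_assoc, ← mul_assoc]
      · simp only [elements, if_neg hij, if_neg h3.2.1]
        rw [mul_sub, hC.mul_x, ← mul_assoc, ← mul_assoc, hC.mul_mul_same hik.symm, add_mul,
          hC.x_mul, add_sub_cancel_left]
  mul_z_self k j := by
    by_cases hkj : k = j
    · subst hkj
      simp only [elements, if_true]
      rw [mul_sub, mul_smul_comm, hC.mul_x, ← mul_assoc, ← mul_assoc, ← mul_assoc, hC.quadratic,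
        smul_mul_assoc, smul_mul_assoc, smul_mul_assoc, ← smul_sub]
    · simp only [elements, if_neg hkj]
      rw [← mul_assoc, hC.quadratic, smul_mul_assoc]
  mul_z i k j hik := by
    by_cases hij : i = j
    · subst hij
      have h3 := fin3_third hik
      rw [hC.elements_z_self hik h3.1.symm h3.2.1.symm]
      simp only [elements, if_neg hik.symm]
      rw [mul_sub, mul_smul_comm, hC.mul_x, ← mul_assoc, ← mul_assoc, ← mul_assoc,
        hC.mul_mul_same hik.symm, add_mul, add_mul, hC.x_mul, smul_mul_assoc, hC.x_mul,
        add_sub_cancel_left, add_sub_cancel, add_comm k i]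
    · have h3 := fin3_third hij
      rcases fin3_eq_or hij k with rfl | rfl | rfl
      · exact absurd rfl hik
      · simp only [elements, if_neg hij, if_true]
        rw [← mul_assoc, hC.mul_mul_same hik.symm]
      · simp only [elements, if_neg hij, if_neg h3.2.1]
        rw [add_sub_cancel, ← mul_assoc, h3.2.2]
  mul_x := hC.mul_x

end A2Relations

namespace A2Table

variable {f : A2Label → A} (hf : A2Table C f)
include hf

theorem c_self (k : Fin 3) : f (.c k k) = C k := by
  rw [← hf.mul_one, hf.one, _root_.mul_one]

theorem mul_of_ne {i j : Fin 3} (hij : i ≠ j) : C j * C i = f (.z j i) := by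
  rw [← hf.mul_c i j i hij, hf.c_self]

theorem mul_mul_same {i j : Fin 3} (hij : i ≠ j) : C i * C j * C i = f .x + C i := by
  rw [mul_assoc, hf.mul_of_ne hij, hf.mul_z j i i hij.symm, hf.c_self]

theorem mul_mul_mul {i j k : Fin 3} (hij : i ≠ j) (hik : i ≠ k) (hjk : j ≠ k) :
    C i * C j * C k * C i = (T 1 + T (-1) : LaurentPolynomial ℤ) • f .x + f (.z i i) := by
  rw [mul_assoc, mul_assoc, hf.mul_of_ne hik, hf.mul_z k j i hjk.symm, mul_add, hf.mul_x,
    hf.mul_c j i i hij.symm]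

/-- With the table both sides of each relation expand to the same combination of the family, for
instance `C i * C j * C i = x + C i`. -/
theorem relations : A2Relations C where
  quadratic i := by rw [← hf.c_self, ← hf.mul_c_self, hf.c_self]
  braid i j hij := by
    rw [hf.mul_mul_same hij, hf.mul_mul_same hij.symm]
    abel
  three i j k hij hik hjk := by rw [hf.mul_mul_same hij, hf.mul_mul_same hik]
  four i j k hij hik hjk := by
    rw [hf.mul_mul_mul hij hik hjk, hf.mul_mul_mul hik hij hjk.symm]

/-- The table expresses the whole family through the `C i`: off-diagonal `z` are products of two of
them, `x` is `C 0 * C 1 * C 0 - C 0`, the `c` come from `C k * z = x + c`, and the remaining `z`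
from the `c`. No independence is needed. -/
theorem unique {g : A2Label → A} (hg : A2Table C g) : f = g := by
  have hzne : ∀ i j, i ≠ j → f (.z i j) = g (.z i j) := fun i j hij => by
    rw [← hf.mul_of_ne hij.symm, ← hg.mul_of_ne hij.symm]
  have hx : f .x = g .x := by
    have h01 : (0 : Fin 3) ≠ 1 := by decide
    rw [← add_left_inj (C 0), ← hf.mul_mul_same h01, ← hg.mul_mul_same h01]
  have hc : ∀ i j, f (.c i j) = g (.c i j) := by
    intro i j
    by_cases hij : i = j
    · subst hij
      rw [hf.c_self, hg.c_self]
    · have h3 := fin3_third hij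
      have := hf.mul_z _ i j h3.1
      rw [hzne _ _ h3.2.1, hg.mul_z _ i j h3.1, hx] at this
      exact (add_left_cancel this).symm
  funext l
  cases l with
  | one => rw [hf.one, hg.one]
  | c i j => exact hc i j
  | z i j =>
    have hi : i + 1 ≠ i := by revert i; decide
    rw [← hf.mul_c _ i j hi, ← hg.mul_c _ i j hi, hc]
  | x => exact hx

theorem map {A' : Type*} [Ring A'] [Algebra (LaurentPolynomial ℤ) A']
    (φ : A →ₐ[LaurentPolynomial ℤ] A') : A2Table (fun i => φ (C i)) fun l => φ (f l) where
  one := by rw [hf.one, map_one]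
  mul_one k := by rw [← map_mul, hf.mul_one]
  mul_c_self k j := by rw [← map_mul, hf.mul_c_self, map_smul]
  mul_c i k j hik := by rw [← map_mul, hf.mul_c i k j hik]
  mul_z_self k j := by rw [← map_mul, hf.mul_z_self, map_smul]
  mul_z i k j hik := by rw [← map_mul, hf.mul_z i k j hik, map_add]
  mul_x k := by rw [← map_mul, hf.mul_x, map_smul]

theorem mul_mem_span (k : Fin 3) {a : A}
    (ha : a ∈ Submodule.span (LaurentPolynomial ℤ) (Set.range f)) :
    C k * a ∈ Submodule.span (LaurentPolynomial ℤ) (Set.range f) := by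
  have hm : ∀ l, f l ∈ Submodule.span (LaurentPolynomial ℤ) (Set.range f) := fun l =>
    Submodule.subset_span ⟨l, rfl⟩
  induction ha using Submodule.span_induction with
  | zero => rw [mul_zero]; exact zero_mem _
  | add a b _ _ ha hb => rw [mul_add]; exact add_mem ha hb
  | smul c a _ ha => rw [mul_smul_comm]; exact Submodule.smul_mem _ c ha
  | mem a ha =>
    obtain ⟨l, rfl⟩ := ha
    cases l with
    | one => rw [hf.mul_one]; exact hm _
    | c i j =>
      by_cases hik : i = k
      · subst hik
        rw [hf.mul_c_self]
        exact Submodule.smul_mem _ _ (hm _)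
      · rw [hf.mul_c i k j hik]
        exact hm _
    | z i j =>
      by_cases hik : i = k
      · subst hik
        rw [hf.mul_z_self]
        exact Submodule.smul_mem _ _ (hm _)
      · rw [hf.mul_z i k j hik]
        exact add_mem (hm _) (hm _)
    | x =>
      rw [hf.mul_x]
      exact Submodule.smul_mem _ _ (hm _)

end A2Table

theorem A2Algebra.relations : A2Relations A2Algebra.gen where
  quadratic i := by
    have := RingQuot.mkAlgHom_rel (LaurentPolynomial ℤ) (A2Relation.quadratic i)
    rw [map_smul, map_pow, pow_two] at this
    exact this
  braid i j hij := by
    have := RingQuot.mkAlgHom_rel (LaurentPolynomial ℤ) (A2Relation.braid i j hij)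
    simp only [map_add, map_mul] at this
    exact this
  three i j k hij hik hjk := by
    have := RingQuot.mkAlgHom_rel (LaurentPolynomial ℤ) (A2Relation.three i j k hij hik hjk)
    simp only [map_mul] at this
    exact this
  four i j k hij hik hjk := by
    have := RingQuot.mkAlgHom_rel (LaurentPolynomial ℤ) (A2Relation.four i j k hij hik hjk)
    simp only [map_mul] at this
    exact this

/-- The homomorphism given by elements which satisfy the relations. -/
def A2Algebra.lift (hC : A2Relations C) : A2Algebra →ₐ[LaurentPolynomial ℤ] A :=
  RingQuot.liftAlgHom (LaurentPolynomial ℤ) ⟨FreeAlgebra.lift _ C, by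
    rintro _ _ (i | ⟨i, j, hij⟩ | ⟨i, j, k, hij, hik, hjk⟩ | ⟨i, j, k, hij, hik, hjk⟩)
    · simpa only [map_smul, map_mul, pow_two, FreeAlgebra.lift_ι_apply] using hC.quadratic i
    · simpa only [map_add, map_mul, FreeAlgebra.lift_ι_apply] using hC.braid i j hij
    · simpa only [map_add, map_mul, FreeAlgebra.lift_ι_apply] using hC.three i j k hij hik hjk
    · simpa only [map_add, map_mul, FreeAlgebra.lift_ι_apply] using hC.four i j k hij hik hjk⟩

theorem A2Algebra.lift_gen (hC : A2Relations C) (i : Fin 3) :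
    A2Algebra.lift hC (A2Algebra.gen i) = C i :=
  (RingQuot.liftAlgHom_mkAlgHom_apply _ _ _ _).trans (FreeAlgebra.lift_ι_apply _ _)

/-- By the table the span is stable under left multiplication by the generators, so it is a left
ideal, and it contains `1`. -/
theorem A2Algebra.span_elements : Submodule.span (LaurentPolynomial ℤ)
    (Set.range (A2Relations.elements A2Algebra.gen)) = ⊤ := by
  refine eq_top_iff.2 fun a _ => ?_
  have hmul : ∀ (b : FreeAlgebra (LaurentPolynomial ℤ) (Fin 3)),
      ∀ a ∈ Submodule.span (LaurentPolynomial ℤ) (Set.range (A2Relations.elements A2Algebra.gen)),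
      RingQuot.mkAlgHom (LaurentPolynomial ℤ) A2Relation b * a ∈ Submodule.span
        (LaurentPolynomial ℤ) (Set.range (A2Relations.elements A2Algebra.gen)) := by
    intro b
    induction b using FreeAlgebra.induction with
    | grade0 r =>
      intro a ha
      rw [AlgHom.commutes, ← Algebra.smul_def]
      exact Submodule.smul_mem _ r ha
    | grade1 i => exact fun a ha => A2Algebra.relations.table.mul_mem_span i ha
    | mul b c hb hc =>
      intro a ha
      rw [map_mul, mul_assoc]
      exact hb _ (hc _ ha)
    | add b c hb hc =>
      intro a ha
      rw [map_add, add_mul]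
      exact add_mem (hb _ ha) (hc _ ha)
  obtain ⟨b, rfl⟩ := RingQuot.mkAlgHom_surjective (LaurentPolynomial ℤ) A2Relation a
  rw [← mul_one (RingQuot.mkAlgHom _ _ _)]
  exact hmul b 1 (Submodule.subset_span ⟨.one, rfl⟩)

/-- An algebra which has a basis with the multiplication table is isomorphic to `A2Algebra`. -/
theorem A2Table.lift_bijective {f : A2Label → A} (hf : A2Table C f)
    (hli : LinearIndependent (LaurentPolynomial ℤ) f)
    (hspan : Submodule.span (LaurentPolynomial ℤ) (Set.range f) = ⊤) :
    Function.Bijective (A2Algebra.lift hf.relations) := by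
  have hmap : ∀ l, A2Algebra.lift hf.relations (A2Relations.elements A2Algebra.gen l) = f l := by
    intro l
    have h1 := A2Algebra.relations.table.map (A2Algebra.lift hf.relations)
    simp only [A2Algebra.lift_gen] at h1
    exact congrFun (h1.unique hf) l
  constructor
  -- A kernel element is a combination of the spanning family; the same combination of the
  -- independent family `f` is zero, so its coefficients vanish.
  · refine (injective_iff_map_eq_zero _).2 fun a ha => ?_
    have h1 : a ∈ Submodule.span (LaurentPolynomial ℤ)
      (Set.range (A2Relations.elements A2Algebra.gen)) := A2Algebra.span_elements ▸ trivial
    obtain ⟨c, rfl⟩ := (Submodule.mem_span_range_iff_exists_fun _).1 h1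
    simp only [map_sum, map_smul, hmap] at ha
    have h2 := Fintype.linearIndependent_iff.1 hli c ha
    simp [h2]
  · intro b
    have h1 : b ∈ Submodule.span (LaurentPolynomial ℤ) (Set.range f) := hspan ▸ trivial
    obtain ⟨c, rfl⟩ := (Submodule.mem_span_range_iff_exists_fun _).1 h1
    refine ⟨∑ l, c l • A2Relations.elements A2Algebra.gen l, ?_⟩
    simp only [map_sum, map_smul, hmap]

/-- Elements which satisfy the relations define a homomorphism from the Hecke algebra. -/
theorem A2Relations.exists_heckeHom (hC : A2Relations C) :
    ∃ ψ : HeckeAlgebra affineA2 →ₐ[LaurentPolynomial ℤ] A,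
      ∀ i, ψ (HeckeAlgebra.klGen affineA2 i) = C i := by
  set v : A := algebraMap (LaurentPolynomial ℤ) A (T 1) with hv
  set u : A := algebraMap (LaurentPolynomial ℤ) A (T (-1)) with hu
  have hvu : v * u = 1 := by
    rw [hv, hu, ← map_mul, ← T_add]
    simp
  have hcv : ∀ a : A, a * v = v * a := fun a => (Algebra.commutes _ a).symm
  have hq : ∀ i, C i * C i = v * C i + u * C i := fun i => by
    rw [hC.quadratic, Algebra.smul_def, map_add, add_mul]
  have hb : ∀ i j, i ≠ j → (C i - v) * ((C j - v) * (C i - v)) =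
      (C j - v) * ((C i - v) * (C j - v)) := by
    intro i j hij
    -- The bracket on the right is symmetric in `i` and `j`. The term `-C i` comes from `v * (C i *
    -- C i)`, because `v u = 1`; the braid relation makes `C i * C j * C i - C i` symmetric as well.
    have key : ∀ i j, (C i - v) * ((C j - v) * (C i - v)) =
        C i * C j * C i - C i + (v * v * C j + v * v * C i - v * (C i * C j) - v * (C j * C i)
          - v * v * v) := by
      intro i j
      have e : (C i - v) * ((C j - v) * (C i - v)) =
        C i * C j * C i - (C i * C j) * v - C i * v * C i + C i * v * v - v * (C j * C i) +
          v * (C j * v) + v * v * C i - v * v * v := by noncomm_ring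
      rw [e, hcv (C i * C j), hcv (C i), hcv (C j), mul_assoc v (C i) (C i), hq i, mul_add,
        ← mul_assoc v u, hvu, mul_assoc v (C i) v, hcv (C i)]
      noncomm_ring
    rw [key i j, key j i, sub_eq_sub_iff_add_eq_add.2 ((hC.braid i j hij).trans (add_comm _ _))]
    abel
  refine ⟨RingQuot.liftAlgHom (LaurentPolynomial ℤ) ⟨FreeAlgebra.lift _ fun i => C i - v, ?_⟩, ?_⟩
  · rintro _ _ (i | ⟨i, j, hM⟩)
    · simp only [map_mul, map_add, map_one, map_smul, FreeAlgebra.lift_ι_apply, pow_two]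
      rw [Algebra.smul_def, map_sub, ← hv, ← hu]
      have e : (C i - v) * (C i - v) = C i * C i - C i * v - v * C i + v * v := by noncomm_ring
      have huv : u * v = 1 := by rw [hcv, hvu]
      rw [e, hq, hcv, sub_mul, mul_sub, mul_sub, huv]
      noncomm_ring
    · by_cases hij : i = j
      · subst hij
        rfl
      · have h3 : affineA2 i j = 3 := by simp [affineA2, hij]
        rw [h3]
        -- The alternating word in `i`, `j` of length three ends with `j`, so it is `j i j`; hence
        -- the exchanged indices.
        simpa [CoxeterSystem.alternatingWord, mul_assoc] using hb j i (Ne.symm hij)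
  · intro i
    rw [HeckeAlgebra.klGen, map_add, AlgHom.commutes]
    exact (congrArg (· + v) ((RingQuot.liftAlgHom_mkAlgHom_apply _ _ _ _).trans
      (FreeAlgebra.lift_ι_apply _ i))).trans (sub_add_cancel _ _)

end Algebra

end

noncomputable section

/-! ### The classes of the objects -/

namespace GradedBimodule

variable {R : Type u} [CommRing R] [Algebra ℝ R] {𝒜 : ℤ → Submodule ℝ R} [GradedAlgebra 𝒜]
  {J : Type*} {B : J → GradedBimodule 𝒜}

open SplitGrothendieckRing LaurentPolynomial

theorem SplitGrothendieckRing.cls_eq_add {M N P : GeneratedCategory B}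
    (e : M.obj ≅ N.obj.sum P.obj) : cls M = cls N + cls P := by
  rw [← cls_sum]
  exact cls_eq e

theorem SplitGrothendieckRing.cls_eq_smul {M N : GeneratedCategory B}
    (e : M.obj ≅ (N.obj.shift 1).sum (N.obj.shift (-1))) :
    cls M = (T 1 + T (-1) : LaurentPolynomial ℤ) • cls N := by
  rw [add_smul, v_smul_cls, v_smul_cls]
  exact cls_eq_add (N := N.shift 1) (P := N.shift (-1)) e

theorem SplitGrothendieckRing.span_cls_eq_top {Λ : Type*} {E : Λ → GradedBimodule 𝒜}
    (hE : ∀ l, generated B (E l)) (h : ∀ M, generated B M → IsFamilySum E M) :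
    Submodule.span (LaurentPolynomial ℤ)
      (Set.range fun l => (cls ⟨E l, hE l⟩ : SplitGrothendieckRing B)) = ⊤ := by
  refine eq_top_iff.2 fun a _ => ?_
  induction a using SplitGrothendieckRing.induction with
  | h0 => exact zero_mem _
  | hadd x y hx hy => exact add_mem (hx trivial) (hy trivial)
  | hneg x hx => exact neg_mem (hx trivial)
  | hc M =>
    -- The membership proof is quantified, so that the induction can pass to isomorphic bimodules
    -- and to summands.
    have key : ∀ hM : generated B M.obj, (cls ⟨M.obj, hM⟩ : SplitGrothendieckRing B) ∈
        Submodule.span (LaurentPolynomial ℤ)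
          (Set.range fun l => (cls ⟨E l, hE l⟩ : SplitGrothendieckRing B)) := by
      refine (h M.obj M.property).induction (p := fun M => ∀ hM : generated B M,
        (cls ⟨M, hM⟩ : SplitGrothendieckRing B) ∈ Submodule.span (LaurentPolynomial ℤ)
          (Set.range fun l => (cls ⟨E l, hE l⟩ : SplitGrothendieckRing B))) ?_ ?_ ?_
      · rintro M N ⟨e⟩ hN hM
        have hN' := generated_of_iso hM e
        rw [cls_eq (N := ⟨N, hN'⟩) e]
        exact hN hN'
      · intro h0
        have h1 : (cls ⟨zero 𝒜, h0⟩ : SplitGrothendieckRing B) = 0 := by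
          have := cls_eq_add (M := ⟨zero 𝒜, h0⟩) (N := ⟨zero 𝒜, h0⟩) (P := ⟨zero 𝒜, h0⟩)
            (zeroSum _).symm
          exact left_eq_add.1 this
        rw [h1]
        exact zero_mem _
      · intro M l n _ hM hsum
        have h2 := (generated_of_sum hsum (Iso.refl _)).2
        rw [cls_eq_add (N := GeneratedCategory.shift ⟨E l, hE l⟩ n) (P := ⟨M, h2⟩) (Iso.refl _),
          ← v_smul_cls]
        exact add_mem (Submodule.smul_mem _ _ (Submodule.subset_span ⟨l, rfl⟩)) (hM h2)
    exact key M.property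

end GradedBimodule

section Classes

open GradedBimodule SplitGrothendieckRing

variable {W : Type*} [Group W] {cs : CoxeterSystem (CoxeterMatrix.A 2) W}
  {V : Type u} [AddCommGroup V] [Module ℝ V] {ρ : Representation ℝ W V}
  (hρ : IsReflectionFaithful cs ρ) (t : Fin 3 ≃ {t : W // cs.IsReflection t})

/-- The object belonging to a label. -/
def labelObject (l : A2Label) : ReflectionCategory cs ρ :=
  ⟨labelBimodule ρ (fun i => (t i : W)) l, generated_labelBimodule hρ t l⟩

theorem labelObject_table :
    A2Table (fun i => (cls (ReflectionCategory.of cs ρ (t i)) : ReflectionAlgebra cs ρ))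
      fun l => cls (labelObject hρ t l) where
  one := by
    rw [← cls_unit]
    exact cls_eq (unit_iso_labelBimodule ρ _).some.symm
  mul_one k := by
    rw [cls_mul]
    exact cls_eq (soergel_tensor_one (cs.isA2Triple t) hρ.faithful (hρ.codim t) k).some
  mul_c_self k j := by
    rw [cls_mul]
    exact cls_eq_smul (soergel_tensor_label_self (cs.isA2Triple t) hρ.faithful (hρ.codim t) k
      (Or.inl ⟨j, rfl⟩)).some
  mul_c i k j hik := by
    rw [cls_mul]
    exact cls_eq (soergel_tensor_c (cs.isA2Triple t) hρ.faithful (hρ.codim t) hik j).some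
  mul_z_self k j := by
    rw [cls_mul]
    exact cls_eq_smul (soergel_tensor_label_self (cs.isA2Triple t) hρ.faithful (hρ.codim t) k
      (Or.inr (Or.inl ⟨j, rfl⟩))).some
  mul_z i k j hik := by
    rw [cls_mul]
    exact cls_eq_add (soergel_tensor_z (cs.isA2Triple t) hρ.faithful (hρ.codim t) hik j).some
  mul_x k := by
    rw [cls_mul]
    exact cls_eq_smul (soergel_tensor_label_self (cs.isA2Triple t) hρ.faithful (hρ.codim t) k
      (Or.inr (Or.inr rfl))).some

theorem span_labelObject : Submodule.span (LaurentPolynomial ℤ)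
    (Set.range fun l => (cls (labelObject hρ t l) : ReflectionAlgebra cs ρ)) = ⊤ :=
  span_cls_eq_top (generated_labelBimodule hρ t) fun _ hM => isFamilySum_labelBimodule hρ t hM

end Classes

end

noncomputable section

/-! ### Linear independence of the classes -/

namespace GradedBimodule

section Annihilated

variable {R : Type u} [CommRing R] [Algebra ℝ R] {𝒜 : ℤ → Submodule ℝ R} [GradedAlgebra 𝒜]
  (I : Submodule ℝ (base 𝒜).carrier) {M N : GradedBimodule 𝒜}

/-- The homogeneous elements of degree `i` which are annihilated by `I ⊆ R ⊗ R`. -/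
def annihilated (M : GradedBimodule 𝒜) (i : ℤ) : Submodule ℝ M.carrier :=
  M.gr i ⊓ ⨅ ξ ∈ I, LinearMap.ker (biact M ξ)

variable {I}

theorem mem_annihilated {i : ℤ} {m : M.carrier} :
    m ∈ annihilated I M i ↔ m ∈ M.gr i ∧ ∀ ξ ∈ I, biact M ξ m = 0 := by
  simp only [annihilated, Submodule.mem_inf, Submodule.mem_iInf, LinearMap.mem_ker]

theorem Hom.map_annihilated (f : M ⟶ N) {i : ℤ} {m : M.carrier} (hm : m ∈ annihilated I M i) :
    Hom.toLin f m ∈ annihilated I N i := by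
  rw [mem_annihilated] at hm ⊢
  refine ⟨Hom.map_gr f hm.1, fun ξ hξ => ?_⟩
  rw [← Hom.map_biact, hm.2 ξ hξ, map_zero]

theorem finrank_annihilated_iso (e : M ≅ N) (i : ℤ) :
    Module.finrank ℝ (annihilated I M i) = Module.finrank ℝ (annihilated I N i) := by
  have h1 : ∀ m, Hom.toLin e.inv (Hom.toLin e.hom m) = m := fun m =>
    LinearMap.congr_fun (congrArg Hom.toLin e.hom_inv_id) m
  have h2 : ∀ m, Hom.toLin e.hom (Hom.toLin e.inv m) = m := fun m =>
    LinearMap.congr_fun (congrArg Hom.toLin e.inv_hom_id) m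
  exact LinearEquiv.finrank_eq (LinearEquiv.ofLinearMap
    ((Hom.toLin e.hom).restrict fun _ => Hom.map_annihilated e.hom)
    ((Hom.toLin e.inv).restrict fun _ => Hom.map_annihilated e.inv)
    (LinearMap.ext fun m => Subtype.ext (h2 m)) (LinearMap.ext fun m => Subtype.ext (h1 m)))

theorem exists_mem_annihilated {i : ℤ} (h : Module.finrank ℝ (annihilated I M i) ≠ 0) :
    ∃ m ∈ annihilated I M i, m ≠ 0 := by
  by_contra! h0
  have : Subsingleton (annihilated I M i) :=
    ⟨fun a b => Subtype.ext (by rw [h0 a a.2, h0 b b.2])⟩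
  exact h Module.finrank_zero_of_subsingleton

theorem finrank_annihilated_eq_one {i : ℤ} {m : M.carrier} (hm : m ∈ annihilated I M i)
    (hm0 : m ≠ 0) (h : ∀ m' ∈ annihilated I M i, ∃ c : ℝ, m' = c • m) :
    Module.finrank ℝ (annihilated I M i) = 1 := by
  refine finrank_eq_one_iff'.2 ⟨⟨m, hm⟩, fun h0 => hm0 (congrArg Subtype.val h0), ?_⟩
  rintro ⟨m', hm'⟩
  obtain ⟨c, rfl⟩ := h m' hm'
  exact ⟨c, rfl⟩

/-- The elements of a direct sum which are annihilated by `I`. -/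
def annihilatedSum (M N : GradedBimodule 𝒜) (i : ℤ) :
    annihilated I (M.sum N) i ≃ₗ[ℝ] annihilated I M i × annihilated I N i :=
  LinearEquiv.ofLinearMap
    (((Hom.toLin (sumFst M N)).restrict fun _ => Hom.map_annihilated (sumFst M N)).prod
      ((Hom.toLin (sumSnd M N)).restrict fun _ => Hom.map_annihilated (sumSnd M N)))
    (((Hom.toLin (sumInl M N)).restrict fun _ => Hom.map_annihilated (sumInl M N)).coprod
      ((Hom.toLin (sumInr M N)).restrict fun _ => Hom.map_annihilated (sumInr M N)))
    (LinearMap.ext fun m => Prod.ext (Subtype.ext (add_zero m.1.1)) (Subtype.ext (zero_add m.2.1)))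
    (LinearMap.ext fun m => Subtype.ext (Prod.ext (add_zero m.1.1) (zero_add m.1.2)))

/-- The homogeneous components are finite-dimensional. -/
def IsLocallyFinite (M : GradedBimodule 𝒜) : Prop := ∀ i, FiniteDimensional ℝ (M.gr i)

/-- Local finiteness enters because `Module.finrank` is zero on infinite-dimensional spaces and
additive only in the finite-dimensional case. -/
theorem finrank_annihilated_sum (hM : M.IsLocallyFinite) (hN : N.IsLocallyFinite) (i : ℤ) :
    Module.finrank ℝ (annihilated I (M.sum N) i) =
      Module.finrank ℝ (annihilated I M i) + Module.finrank ℝ (annihilated I N i) := by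
  have := hM i
  have := hN i
  have h1 : FiniteDimensional ℝ (annihilated I M i) :=
    Submodule.finiteDimensional_of_le (S₂ := M.gr i) inf_le_left
  have h2 : FiniteDimensional ℝ (annihilated I N i) :=
    Submodule.finiteDimensional_of_le (S₂ := N.gr i) inf_le_left
  rw [(annihilatedSum M N i).finrank_eq, Module.finrank_prod]

end Annihilated

/-! ### Local finiteness, and annihilated elements of the graph bimodules -/

section LocallyFinite

variable {R : Type u} [CommRing R] [Algebra ℝ R] {𝒜 : ℤ → Submodule ℝ R}
  {M N : GradedBimodule 𝒜}

theorem IsLocallyFinite.of_iso (hM : M.IsLocallyFinite) (e : N ≅ M) : N.IsLocallyFinite := by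
  intro i
  have := hM i
  have h1 : ∀ m, Hom.toLin e.inv (Hom.toLin e.hom m) = m := fun m =>
    LinearMap.congr_fun (congrArg Hom.toLin e.hom_inv_id) m
  refine FiniteDimensional.of_injective
    ((Hom.toLin e.hom).restrict (p := N.gr i) (q := M.gr i) fun _ => Hom.map_gr e.hom) ?_
  intro x y hxy
  have h2 : Hom.toLin e.hom x = Hom.toLin e.hom y := congrArg Subtype.val hxy
  exact Subtype.ext (by rw [← h1 x, h2, h1])

theorem IsLocallyFinite.shift (hM : M.IsLocallyFinite) (n : ℤ) : (M.shift n).IsLocallyFinite :=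
  fun i => hM (n + i)

theorem IsLocallyFinite.sum (hM : M.IsLocallyFinite) (hN : N.IsLocallyFinite) :
    (M.sum N).IsLocallyFinite := by
  intro i
  have := hM i
  have := hN i
  refine FiniteDimensional.of_injective
    (((Hom.toLin (sumFst M N)).restrict (p := (M.sum N).gr i) (q := M.gr i)
      fun _ => Hom.map_gr (sumFst M N)).prod
      ((Hom.toLin (sumSnd M N)).restrict (p := (M.sum N).gr i) (q := N.gr i)
        fun _ => Hom.map_gr (sumSnd M N))) ?_
  intro x y hxy
  exact Subtype.ext (Prod.ext (congrArg (fun z => (z.1 : M.carrier)) hxy)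
    (congrArg (fun z => (z.2 : N.carrier)) hxy))

theorem isLocallyFinite_zero : (zero 𝒜).IsLocallyFinite := fun i =>
  inferInstanceAs (FiniteDimensional ℝ ((zero 𝒜).gr i))

theorem IsFamilySum.isLocallyFinite {Λ : Type*} {E : Λ → GradedBimodule 𝒜}
    (hE : ∀ l, (E l).IsLocallyFinite) (hM : IsFamilySum E M) : M.IsLocallyFinite := by
  refine hM.induction (p := IsLocallyFinite) ?_ isLocallyFinite_zero ?_
  · rintro M N ⟨e⟩ hN
    exact hN.of_iso e
  · intro M l n _ hM
    exact ((hE l).shift n).sum hM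

variable [GradedAlgebra 𝒜]

theorem isLocallyFinite_base (h𝒜 : IsConnected 𝒜) (hfin : ∀ i, FiniteDimensional ℝ (𝒜 i)) :
    (base 𝒜).IsLocallyFinite := by
  intro i
  -- As the grading is nonnegative, only the bidegrees `(p, i - p)` with `0 ≤ p ≤ i` contribute to
  -- degree `i`.
  let Q : ℤ → Submodule ℝ (base 𝒜).carrier := fun p =>
    Submodule.map₂ (tmulBilin (𝒜 := 𝒜) ⊥ (unit 𝒜) (unit 𝒜)) (𝒜 p) (𝒜 (i - p))
  have hQ : ∀ p, FiniteDimensional ℝ (Q p) := fun p => by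
    have h1 : (𝒜 p).FG := Module.Finite.iff_fg.1 (hfin p)
    have h2 : (𝒜 (i - p)).FG := Module.Finite.iff_fg.1 (hfin (i - p))
    exact Module.Finite.iff_fg.2 (Submodule.FG.map₂ _ h1 h2)
  refine Submodule.finiteDimensional_of_le (S₂ := (Finset.Icc 0 i).sup Q) ?_
  intro ξ hξ
  refine mem_of_tensorGr (M := unit 𝒜) (N := unit 𝒜) ⊥ LinearMap.id i _ ?_ hξ
  rintro p q hpq (a : R) ha (b : R) hb
  rw [LinearMap.id_apply]
  obtain rfl : q = i - p := by lia
  by_cases hp : p ∈ Finset.Icc 0 i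
  · exact Finset.le_sup (f := Q) hp (Submodule.apply_mem_map₂ _ ha hb)
  · rw [Finset.mem_Icc, not_and_or, not_le, not_le] at hp
    rcases hp with hp | hp
    · have : a = 0 := by simpa [h𝒜.neg p hp] using ha
      rw [this]
      refine (tmul_zero_left (M := unit 𝒜) (N := unit 𝒜) ⊥ b).symm ▸ zero_mem _
    · have : b = 0 := by simpa [h𝒜.neg (i - p) (by lia)] using hb
      rw [this]
      refine (tmul_zero_right (M := unit 𝒜) (N := unit 𝒜) ⊥ a).symm ▸ zero_mem _

variable {W : Type*} [Group W] {σ : GradedAction 𝒜 W} {S S' : Set W}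

theorem GradedAction.isLocallyFinite_graphs (h𝒜 : IsConnected 𝒜)
    (hfin : ∀ i, FiniteDimensional ℝ (𝒜 i)) (S : Set W) : (σ.graphs S).IsLocallyFinite := by
  intro i
  have := isLocallyFinite_base h𝒜 hfin i
  exact Module.Finite.map ((base 𝒜).gr i) (σ.vanishing S).mkQ

/-- Such elements correspond to morphisms from `graphs S` shifted by `n`. For `n > n'` they would
have negative degree; for `n = n'` they are multiples of the constant one, whose annihilator is
`vanishing S'`. -/
theorem GradedAction.annihilated_graphs (h𝒜 : IsConnected 𝒜) {n n' : ℤ}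
    (h : Module.finrank ℝ (annihilated (σ.vanishing S) ((σ.graphs S').shift n') (-n)) ≠ 0) :
    n < n' ∨ n = n' ∧ σ.vanishing S ≤ σ.vanishing S' := by
  obtain ⟨m, hm, hm1⟩ := exists_mem_annihilated h
  obtain ⟨hgr, hann⟩ := mem_annihilated.1 hm
  have hgr' : m ∈ (σ.graphs S').gr (n' + -n) := hgr
  rcases lt_trichotomy n n' with h1 | h1 | h1
  · exact Or.inl h1
  · refine Or.inr ⟨h1, fun ξ hξ => ?_⟩
    rw [h1, add_neg_cancel] at hgr'
    obtain ⟨c, rfl⟩ := graphs_gr_zero h𝒜 hgr'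
    have h2 : biact (σ.graphs S') ξ (c • graphOne σ S') = 0 := hann ξ hξ
    rw [map_smul, biact_graphOne] at h2
    have hc : c ≠ 0 := fun hc => hm1 (by rw [hc]; exact zero_smul ℝ (graphOne σ S'))
    have h3 := (smul_eq_zero.1 h2).resolve_left hc
    exact (Submodule.Quotient.mk_eq_zero _).1 h3
  · exact absurd (graphs_gr_neg h𝒜 (i := n' + -n)
      (by rw [← sub_eq_add_neg]; exact sub_neg.2 h1) hgr') hm1

theorem GradedAction.finrank_annihilated_graphs [Nontrivial R] (h𝒜 : IsConnected 𝒜) (n : ℤ)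
    (hS : S.Nonempty) :
    Module.finrank ℝ (annihilated (σ.vanishing S) ((σ.graphs S).shift n) (-n)) = 1 := by
  obtain ⟨w, hw⟩ := hS
  have h1 : graphOne σ S ∈ annihilated (σ.vanishing S) ((σ.graphs S).shift n) (-n) := by
    refine mem_annihilated.2 ⟨?_, fun ξ hξ => ?_⟩
    · change graphOne σ S ∈ (σ.graphs S).gr (n + -n)
      rw [add_neg_cancel]
      exact graphOne_mem
    · exact (biact_graphOne ξ).trans ((Submodule.Quotient.mk_eq_zero _).2 hξ)
  refine finrank_annihilated_eq_one h1 (fun h2 => ?_) fun m hm => ?_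
  · have h3 := graphValue_one (σ := σ) hw
    rw [h2, map_zero] at h3
    exact zero_ne_one h3
  · have hgr : m ∈ (σ.graphs S).gr (n + -n) := (mem_annihilated.1 hm).1
    rw [add_neg_cancel] at hgr
    exact graphs_gr_zero h𝒜 hgr

/-- Graphs of distinct elements are separated by elements of `R ⊗ R`. -/
theorem GradedAction.subset_of_vanishing_le [IsDomain R]
    (hsep : ∀ v w : W, v ≠ w → ∃ a, σ.act v a ≠ σ.act w a) (hS : S.Finite)
    (h : σ.vanishing S ≤ σ.vanishing S') : S' ⊆ S := by
  intro s hs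
  by_contra hsS
  -- Multiply, over all `v ∈ S`, factors `v(a) ⊗ 1 - 1 ⊗ a` with `v(a) ≠ s(a)`: such a factor
  -- vanishes on the graph of `v` but not on that of `s`.
  have key : ∃ ξ ∈ σ.vanishing S, ev 𝒜 (σ.act s) ξ ≠ 0 := by
    clear h hs
    induction S, hS using Set.Finite.induction_on with
    | empty =>
      refine ⟨bt 𝒜 1 1, σ.mem_vanishing.2 fun w hw => absurd hw (Set.notMem_empty w), ?_⟩
      refine (evOver_tmul (𝒜 := 𝒜) ⊥ _ (fix_bot _) 1 1).symm ▸ ?_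
      rw [map_one, mul_one]
      exact one_ne_zero
    | @insert v S hv hS ih =>
      rw [Set.mem_insert_iff, not_or] at hsS
      obtain ⟨ξ, hξ, hne⟩ := ih hsS.2
      obtain ⟨a, ha⟩ := hsep v s (Ne.symm hsS.1)
      have hev : ∀ w, ev 𝒜 (σ.act w) ((base 𝒜).lact (σ.act v a) ξ - (base 𝒜).ract a ξ) =
          (σ.act v a - σ.act w a) * ev 𝒜 (σ.act w) ξ := fun w => by
        rw [map_sub, ev_lact, ev_ract, sub_mul]
      refine ⟨_, σ.mem_vanishing.2 fun w hw => (hev w).trans ?_, ?_⟩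
      · rcases hw with rfl | hw
        · rw [sub_self, zero_mul]
        · rw [σ.mem_vanishing.1 hξ w hw, mul_zero]
      · rw [hev]
        exact mul_ne_zero (sub_ne_zero.2 ha) hne
  obtain ⟨ξ, hξ, hne⟩ := key
  exact hne (σ.mem_vanishing.1 (h hξ) s hs)

end LocallyFinite

/-! ### Additive functionals on the split Grothendieck ring -/

section Functional

open SplitGrothendieckRing LaurentPolynomial

variable {R : Type u} [CommRing R] [Algebra ℝ R] {𝒜 : ℤ → Submodule ℝ R} [GradedAlgebra 𝒜]
  {J : Type*} {B : J → GradedBimodule 𝒜}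

/-- This is the universal property of the split Grothendieck group. The functional is only additive;
no compatibility with `v` is asked for. -/
theorem SplitGrothendieckRing.exists_addHom (d : GeneratedCategory B → ℤ)
    (hiso : ∀ M N : GeneratedCategory B, Nonempty (M.obj ≅ N.obj) → d M = d N)
    (hsum : ∀ M N : GeneratedCategory B, d (M.sum N) = d M + d N) :
    ∃ χ : SplitGrothendieckRing B →+ ℤ, ∀ M, χ (cls M) = d M := by
  let g : FreeAbelianGroup (IsoClass B) →+ ℤ := FreeAbelianGroup.lift
    (Quotient.lift d fun M N ⟨e⟩ => hiso M N ⟨GeneratedCategory.toIso e⟩)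
  have hgm : ∀ M, g (FreeAbelianGroup.of (IsoClass.mk M)) = d M := fun M =>
    FreeAbelianGroup.lift_apply_of _ _
  have hg : splitRelations B ≤ g.ker := by
    refine (AddSubgroup.closure_le _).2 ?_
    rintro _ ⟨M, N, rfl⟩
    change g _ = 0
    rw [map_sub, map_sub, hgm, hgm, hgm, hsum]
    ring
  have hlift : ∀ x y, (splitIdeal B).ringCon x y → g x = g y := by
    intro x y hxy
    rw [TwoSidedIdeal.rel_iff, splitIdeal, TwoSidedIdeal.mem_mk'] at hxy
    have : g (x - y) = 0 := hg hxy
    rwa [map_sub, sub_eq_zero] at this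
  refine ⟨AddMonoidHom.mk' (fun x : (splitIdeal B).ringCon.Quotient => Quotient.lift g hlift x)
    ?_, hgm⟩
  rintro ⟨x⟩ ⟨y⟩
  exact map_add g x y

/-- Since `χ` need not be linear over `ℤ[v, v⁻¹]`, the powers of `v` are moved into the object as
shifts. -/
theorem SplitGrothendieckRing.addHom_smul (χ : SplitGrothendieckRing B →+ ℤ)
    (c : LaurentPolynomial ℤ) (M : GeneratedCategory B) :
    χ (c • cls M) = c.coeff.sum fun k a => a * χ (cls (M.shift k)) := by
  induction c using LaurentPolynomial.induction_on' with
  | add p q hp hq =>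
    rw [add_smul, map_add, hp, hq, AddMonoidAlgebra.coeff_add,
      Finsupp.sum_add_index' (fun _ => zero_mul _) (fun _ _ _ => add_mul _ _ _)]
  | C_mul_T n a =>
    have h1 : (C a : LaurentPolynomial ℤ) = (a : LaurentPolynomial ℤ) := by simp
    rw [mul_smul, h1, Int.cast_smul_eq_zsmul, map_zsmul, v_smul_cls, ← h1, ← single_eq_C_mul_T,
      AddMonoidAlgebra.coeff_single, Finsupp.sum_single_index (zero_mul _), smul_eq_mul]

/-- Linear independence by a triangularity argument. -/
theorem SplitGrothendieckRing.linearIndependent_cls {Λ : Type*} [Fintype Λ]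
    (E : Λ → GeneratedCategory B) (key : Λ → ℤ → ℤ)
    (h : ∀ l k, ∃ χ : SplitGrothendieckRing B →+ ℤ, χ (cls ((E l).shift k)) ≠ 0 ∧
      ∀ l' k', χ (cls ((E l').shift k')) ≠ 0 → (l' = l ∧ k' = k) ∨ key l k < key l' k') :
    LinearIndependent (LaurentPolynomial ℤ) fun l => (cls (E l) : SplitGrothendieckRing B) := by
  classical
  rw [Fintype.linearIndependent_iff]
  intro c hc
  by_contra! hne
  let s : Finset (Σ _ : Λ, ℤ) := Finset.univ.sigma fun l => (c l).coeff.support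
  have hs : s.Nonempty := by
    obtain ⟨l, hl⟩ := hne
    have : (c l).coeff ≠ 0 := fun h0 => hl (AddMonoidAlgebra.ext h0)
    obtain ⟨k, hk⟩ := Finsupp.support_nonempty_iff.2 this
    exact ⟨⟨l, k⟩, Finset.mem_sigma.2 ⟨Finset.mem_univ _, hk⟩⟩
  -- Take the functional of a term with maximal key. Any other term that it does not kill would have
  -- a larger key, so the coefficient of the chosen term is zero, a contradiction.
  obtain ⟨⟨l, k⟩, hlk, hmax⟩ := s.exists_max_image (fun p => key p.1 p.2) hs
  obtain ⟨χ, hχ, hχ'⟩ := h l k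
  have h0 : ∑ p ∈ s, (c p.1).coeff p.2 * χ (cls ((E p.1).shift p.2)) = 0 := by
    have h1 := congrArg χ hc
    rw [map_sum, map_zero] at h1
    simp only [addHom_smul] at h1
    rw [Finset.sum_sigma]
    exact h1
  rw [Finset.sum_eq_single_of_mem (⟨l, k⟩ : Σ _ : Λ, ℤ) hlk] at h0
  · have hck : (c l).coeff k ≠ 0 := Finsupp.mem_support_iff.1 (Finset.mem_sigma.1 hlk).2
    exact (mul_ne_zero hck hχ) h0
  · rintro ⟨l', k'⟩ hp hpne
    by_contra hmul
    rcases hχ' l' k' (right_ne_zero_of_mul hmul) with ⟨rfl, rfl⟩ | hlt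
    · exact hpne rfl
    · exact absurd (hmax _ hp) (not_le.2 hlt)

end Functional

end GradedBimodule

/-- The equation `2 k = i` has at most one solution, so at most one power of the space of linear
elements contributes. -/
theorem finiteDimensional_symGrading (U : Type u) [AddCommGroup U] [Module ℝ U]
    [FiniteDimensional ℝ U] (i : ℤ) : FiniteDimensional ℝ (symGrading U i) := by
  have hfg : ∀ k : ℕ, FiniteDimensional ℝ
      ↥(LinearMap.range (SymmetricAlgebra.ι ℝ U) ^ k) := fun k =>
    Module.Finite.iff_fg.2 (Submodule.FG.pow (Module.Finite.iff_fg.1 inferInstance) k)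
  have := hfg i.toNat
  refine Submodule.finiteDimensional_of_le
    (S₂ := LinearMap.range (SymmetricAlgebra.ι ℝ U) ^ (i / 2).toNat) (iSup₂_le fun k hk => ?_)
  obtain rfl : k = (i / 2).toNat := by lia
  exact le_rfl

/-! ### The order on labels and shifts used for triangularity -/

namespace A2Label

variable {W : Type*} [Group W] {t : Fin 3 → W}

theorem set_nonempty (h : IsA2Triple t) (l : A2Label) : (l.set t).Nonempty := by
  cases l with
  | one => exact ⟨1, rfl⟩
  | c i j => exact h.transporter_nonempty i j
  | z i j =>
    by_contra! h0
    exact h.compl_not_singleton (h0.trans_subset (Set.empty_subset _))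
  | x => exact ⟨1, trivial⟩

/-- Distinct sets of the same level are incomparable, and a set is never contained in one of lower
level. -/
theorem eq_or_level_lt (h : IsA2Triple t) {l l' : A2Label} (hs : l.set t ⊆ l'.set t) :
    l = l' ∨ l.level < l'.level := by
  cases l with
  | one => cases l' <;> simp [level]
  | c i j =>
    cases l' with
    | one => exact absurd hs h.transporter_not_singleton
    | c i' j' =>
      obtain ⟨rfl, rfl⟩ := h.transporter_le hs
      exact Or.inl rfl
    | z i' j' => simp [level]
    | x => simp [level]
  | z i j =>
    cases l' with
    | one => exact absurd hs h.compl_not_singleton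
    | c i' j' => exact absurd hs h.compl_not_le
    | z i' j' =>
      obtain ⟨rfl, rfl⟩ := h.transporter_le (Set.compl_subset_compl.1 hs)
      exact Or.inl rfl
    | x => simp [level]
  | x =>
    cases l' with
    | one => exact absurd (hs (Set.mem_univ (t 0))) (h.ne_one 0)
    | c i j => exact absurd ((Set.subset_univ _).trans hs) (h.compl_not_le (i := 0) (j := 0))
    | z i j =>
      obtain ⟨w, hw⟩ := h.transporter_nonempty i j
      exact absurd hw (hs (Set.mem_univ w))
    | x => exact Or.inl rfl

/-- The rank of the shift by `k` of the bimodule belonging to a label. -/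
def key (l : A2Label) (k : ℤ) : ℤ := 10 * (l.level + k) - l.level

/-- All levels lie between `0` and `3`, so with the factor `10` the total shift dominates; ties are
decided by the level, the smaller level having the larger key. -/
theorem key_lt_of_lt {l l' : A2Label} {k k' : ℤ} (h : l.level + k < l'.level + k') :
    l.key k < l'.key k' := by
  have hb : ∀ l : A2Label, 0 ≤ l.level ∧ l.level ≤ 3 := fun l => by
    cases l <;> simp [level]
  have hb1 := hb l
  have hb2 := hb l'
  simp only [key]
  lia

theorem key_lt_of_level_lt {l l' : A2Label} {k k' : ℤ} (h : l.level + k = l'.level + k')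
    (hl : l'.level < l.level) : l.key k < l'.key k' := by
  simp only [key]
  lia

end A2Label

section Independence

open GradedBimodule SplitGrothendieckRing

variable {W : Type*} [Group W] {cs : CoxeterSystem (CoxeterMatrix.A 2) W}
  {V : Type u} [AddCommGroup V] [Module ℝ V] {ρ : Representation ℝ W V}

theorem CoxeterSystem.A2_finite (cs : CoxeterSystem (CoxeterMatrix.A 2) W) : Finite W := by
  refine Set.finite_univ_iff.1 (Set.Finite.subset (s := {1, cs.simple 0, cs.simple 1,
    cs.simple 0 * cs.simple 1, cs.simple 1 * cs.simple 0,
    cs.simple 0 * (cs.simple 1 * cs.simple 0)}) (Set.toFinite _) fun w _ => ?_)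
  simpa using cs.A2_cases w

theorem polyGradedAction_separates (hρ : Function.Injective ρ) (v w : W) (hvw : v ≠ w) :
    ∃ a, (polyGradedAction ρ).act v a ≠ (polyGradedAction ρ).act w a := by
  by_contra! h
  have hdual : ∀ φ : Module.Dual ℝ V, ρ.dual v φ = ρ.dual w φ := fun φ => by
    apply symmetricAlgebra_ι_injective
    rw [← polyGradedAction_ι, ← polyGradedAction_ι, h]
  -- The operator `ρ.dual v` is the transpose of `ρ v⁻¹`, so faithfulness is applied to the
  -- inverses.
  refine hvw (inv_injective (hρ (LinearMap.ext fun x => ?_)))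
  rw [← sub_eq_zero, ← Module.forall_dual_apply_eq_zero_iff ℝ]
  intro φ
  rw [map_sub, sub_eq_zero]
  exact LinearMap.congr_fun (hdual φ) x

variable (hρ : IsReflectionFaithful cs ρ) (t : Fin 3 ≃ {t : W // cs.IsReflection t})

theorem linearIndependent_labelObject [FiniteDimensional ℝ V] :
    LinearIndependent (LaurentPolynomial ℤ)
      fun l => (cls (labelObject hρ t l) : ReflectionAlgebra cs ρ) := by
  have hW := cs.A2_finite
  have h := cs.isA2Triple t
  have hconn := symGrading_isConnected (Module.Dual ℝ V)
  have hfin := finiteDimensional_symGrading (Module.Dual ℝ V)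
  have hloc : ∀ M : ReflectionCategory cs ρ, M.obj.IsLocallyFinite := fun M =>
    (isFamilySum_labelBimodule hρ t M.property).isLocallyFinite fun l =>
      (GradedAction.isLocallyFinite_graphs hconn hfin _).shift _
  refine linearIndependent_cls _ (fun l => l.key) fun l k => ?_
  set S := l.set fun i => (t i : W) with hS
  -- The functional counts the morphisms from the bimodule of the label `l`, shifted by `k`.
  obtain ⟨χ, hχ⟩ := exists_addHom (B := reflectionBimodules cs ρ)
    (fun M => (Module.finrank ℝ (annihilated ((polyGradedAction ρ).vanishing S) M.obj
      (-(l.level + k))) : ℤ))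
    (fun M N ⟨e⟩ => congrArg Nat.cast (finrank_annihilated_iso e _))
    (fun M N => (congrArg Nat.cast (finrank_annihilated_sum (hloc M) (hloc N) _)).trans
      (Nat.cast_add _ _))
  have hχ' : ∀ l' k', χ (cls ((labelObject hρ t l').shift k')) =
      (Module.finrank ℝ (annihilated ((polyGradedAction ρ).vanishing S)
        ((graphBimodule ρ (l'.set fun i => (t i : W))).shift (l'.level + k'))
          (-(l.level + k))) : ℤ) := fun l' k' =>
    (hχ _).trans (congrArg Nat.cast (finrank_annihilated_iso (shiftShift _ _ _) _))
  refine ⟨χ, ?_, fun l' k' hne => ?_⟩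
  · rw [hχ', GradedAction.finrank_annihilated_graphs hconn _ (l.set_nonempty h)]
    exact one_ne_zero
  · rw [hχ', Nat.cast_ne_zero] at hne
    rcases GradedAction.annihilated_graphs hconn hne with h1 | ⟨h1, h2⟩
    · exact Or.inr (A2Label.key_lt_of_lt h1)
    · have h3 := GradedAction.subset_of_vanishing_le
        (polyGradedAction_separates hρ.faithful) (Set.toFinite S) h2
      rcases A2Label.eq_or_level_lt h h3 with rfl | h4
      · exact Or.inl ⟨rfl, (add_left_cancel h1).symm⟩
      · exact Or.inr (A2Label.key_lt_of_level_lt h1 h4)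

end Independence

end

theorem mainTheorem2 {W : Type*} [Group W] (cs : CoxeterSystem (CoxeterMatrix.A 2) W)
    {V : Type u} [AddCommGroup V] [Module ℝ V] [FiniteDimensional ℝ V]
    (ρ : Representation ℝ W V) (hρ : IsReflectionFaithful cs ρ)
    (t : Fin 3 ≃ {t : W // cs.IsReflection t}) :
    (algebraMap (LaurentPolynomial ℤ) (ReflectionAlgebra cs ρ) (LaurentPolynomial.T 1) =
        GradedBimodule.SplitGrothendieckRing.cls
          (GradedBimodule.GeneratedCategory.unitShift (reflectionBimodules cs ρ) 1)) ∧
    (∃ φ : A2Algebra ≃ₐ[LaurentPolynomial ℤ] ReflectionAlgebra cs ρ,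
      ∀ i, φ (A2Algebra.gen i) =
        GradedBimodule.SplitGrothendieckRing.cls (ReflectionCategory.of cs ρ (t i))) ∧
    (∃ ψ : HeckeAlgebra affineA2 →ₐ[LaurentPolynomial ℤ] ReflectionAlgebra cs ρ,
      Function.Surjective ψ ∧
      ∀ i, ψ (HeckeAlgebra.klGen affineA2 i) =
        GradedBimodule.SplitGrothendieckRing.cls (ReflectionCategory.of cs ρ (t i))) := by
  have htable := labelObject_table hρ t
  have hbij := htable.lift_bijective (linearIndependent_labelObject hρ t) (span_labelObject hρ t)
  refine ⟨GradedBimodule.SplitGrothendieckRing.laurentHom_T _ 1,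
    ⟨AlgEquiv.ofBijective _ hbij, A2Algebra.lift_gen htable.relations⟩, ?_⟩
  obtain ⟨ψ, hψ⟩ := htable.relations.exists_heckeHom
  refine ⟨ψ, ?_, hψ⟩
  -- The range of `ψ` is a subalgebra containing the classes of the `B_t`. These generate
  -- everything, because the map from the presented algebra is surjective.
  rw [← AlgHom.range_eq_top, eq_top_iff]
  rintro a -
  obtain ⟨a, rfl⟩ := hbij.2 a
  obtain ⟨b, rfl⟩ := RingQuot.mkAlgHom_surjective (LaurentPolynomial ℤ) A2Relation a
  induction b using FreeAlgebra.induction with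
  | grade0 r => rw [AlgHom.commutes, AlgHom.commutes]; exact Subalgebra.algebraMap_mem _ r
  | grade1 i => exact ⟨HeckeAlgebra.klGen affineA2 i, (hψ i).trans
      (A2Algebra.lift_gen htable.relations i).symm⟩
  | mul b c hb hc => rw [map_mul, map_mul]; exact mul_mem hb hc
  | add b c hb hc => rw [map_add, map_add]; exact add_mem hb hc
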